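/- Conventions. Let $d\ge 2$, $\mathbb{T}^d=\mathbb{R}^d/2\pi\mathbb{Z}^d$, $T^*\mathbb{T}^d=\mathbb{T}^d\times\mathbb{R}^d\ni(x,\xi)$, $e_k(x)=(2\pi)^{-d/2}e^{ik\cdot x}$, and let $|\cdot|$ be the Euclidean norm. For a function $g$ on $T^*\mathbb{T}^d$ put $\widehat g(k,\xi)=(2\pi)^{-d/2}\int_{\mathbb{T}^d}g(x,\xi)e^{-ik\cdot x}\,dx$, $k\in\mathbb{Z}^d$. For $s>0$ put $\|f\|_{\mathcal{A}_s}=(2\pi)^{-d/2}\int_{\mathbb{R}^d}|\widehat f(\eta)|e^{s|\eta|}\,d\eta$, where $\widehat f\in L^1(\mathbb{R}^d)$ is the Fourier transform of $f$, i.e. $f(\xi)=(2\pi)^{-d/2}\int\widehat f(\eta)e^{i\eta\cdot\xi}\,d\eta$ (and $\|f\|_{\mathcal A_s}=\infty$ if there is no such $\widehat f$); $\mathcal{A}_s(\mathbb{R}^d)$ is the space of real-valued real-analytic functions $f$ on $\mathbb{R}^d$ with $\|f\|_{\mathcal{A}_s}<\infty$. For $s,\rho>0$, $\mathcal{A}_{s,\rho}(T^*\mathbb{T}^d)$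 is the space of real-valued real-analytic functions $g$ on $T^*\mathbb{T}^d$ with $\|g\|_{s,\rho}=(2\pi)^{-d/2}\sum_{k\in\mathbb{Z}^d}\|\widehat g(k,\cdot)\|_{\mathcal{A}_s}e^{\rho|k|}<\infty$. For $\hbar\in(0,1]$, the semiclassical Weyl quantization of a symbol $a$ on $T^*\mathbb{T}^d$ is the operator on $L^2(\mathbb{T}^d)$ (with its maximal domain) given by $\operatorname{Op}_\hbar(a)e_k=(2\pi)^{-d/2}\sum_{j\in\mathbb{Z}^d}\widehat a\big(j-k,\tfrac{\hbar(j+k)}{2}\big)e_j$, and $\widehat L_{\omega,\hbar}=\omega\cdot\hbar D_x$ with $D_x=-i\partial_x$, so that $\widehat L_{\omega,\hbar}e_k=\hbar\,\omega\cdot k\,e_k$. $\operatorname{Sp}^p$ denotes the set of eigenvalues in $L^2(\mathbb{T}^d)$. For a family $(\widehat A_\hbar)_{\hbar\in(0,1]}$ of operators on $L^2(\mathbb{T}^d)$, consider sequences $\hbar_n\to0$ in $(0,1]$ and $\Psi_n$ with $\|\Psi_n\|_{L^2}=1$, $\widehat A_{\hbar_n}\Psi_n=\lambda_n\Psi_n$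 and $\lambda_n\to1$. $\mathcal{M}(\widehat A_\hbar)$ is the set of all Radon measures $\mu$ on $T^*\mathbb{T}^d$ for which there is such a sequence with $\langle\Psi_n,\operatorname{Op}_{\hbar_n}(a)\Psi_n\rangle\to\int a\,d\mu$ for all $a\in\mathcal{C}_c^\infty(T^*\mathbb{T}^d)$, and $\mathcal{N}(\widehat A_\hbar)$ is the set of all weak-$\star$ limits, as measures on $\mathbb{T}^d$, of the densities $|\Psi_n|^2dx$ along such sequences. Theorem. Let $s,\rho,\varsigma>0$ and $\gamma>d\ge2$. There are constants $\varepsilon>0$ and $C>0$, depending only on $s,\rho,\gamma,\varsigma$, such that the following holds. Let $\omega\in\mathbb{R}^d$ satisfy $|k\cdot\omega|\ge\varsigma|k|^{-(\gamma-1)}$ for all $k\in\mathbb{Z}^d\setminus\{0\}$, and let $V\in\mathcal{A}_{s,\rho}(T^*\mathbb{T}^d)$ satisfy $\|V\|_{s,\rho}\le\varepsilon$. Then there are functions $R_\hbar\in\mathcal{A}_s(\mathbb{R}^d)$ of $\xi$ alone, $\hbar\in(0,1]$, with $\|R_\hbar\|_{\mathcal{A}_s}\le C\|V\|_{s,\rho}$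 for all $\hbar\in(0,1]$, such that the operators $\widehat Q_\hbar=\widehat L_{\omega,\hbar}+\hbar\operatorname{Op}_\hbar(V-R_\hbar)$ satisfy $$\operatorname{Sp}^p(\widehat Q_\hbar)=\operatorname{Sp}^p(\widehat L_{\omega,\hbar})=\{\hbar\,\omega\cdot k:k\in\mathbb{Z}^d\}\qquad\text{for all }\hbar\in(0,1],$$ $$\mathcal{M}(\widehat Q_\hbar)=\mathcal{M}(\widehat L_{\omega,\hbar})=\{\mathfrak{h}_{\mathbb{T}^d\times\{\xi\}}:\xi\in\mathbb{R}^d,\ \omega\cdot\xi=1\}\cup\{0\},\qquad \mathcal{N}(\widehat Q_\hbar)=\Big\{\tfrac{1}{(2\pi)^d}dx\Big\},$$ where $\mathfrak{h}_{\mathbb{T}^d\times\{\xi\}}$ is the normalized Haar measure on the torus $\mathbb{T}^d\times\{\xi\}$. -/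

import Mathlib

open Filter Topology MeasureTheory
open scoped ENNReal

noncomputable section

namespace SemiclassicalTorus

/-! ### The torus, its characters and Fourier coefficients -/

instance instFactTwoPiPos : Fact ((0 : ℝ) < 2 * Real.pi) := ⟨Real.two_pi_pos⟩

/-- The torus `𝕋ᵈ = ℝᵈ / 2πℤᵈ`. Its `volume` is Lebesgue measure `dx`, of total mass `(2π)ᵈ`. -/
abbrev Torus (d : ℕ) : Type := Fin d → AddCircle (2 * Real.pi)

/-- `ℝᵈ` with its Euclidean structure. -/
abbrev E (d : ℕ) : Type := EuclideanSpace ℝ (Fin d)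

/-- The cotangent bundle `T*𝕋ᵈ = 𝕋ᵈ × ℝᵈ`, with points `(x, ξ)`. -/
abbrev Phase (d : ℕ) : Type := Torus d × E d

/-- The quotient map `ℝᵈ → 𝕋ᵈ`. -/
def toTorus {d : ℕ} (y : E d) : Torus d := fun i => (y i : AddCircle (2 * Real.pi))

/-- An integer vector as a vector of `ℝᵈ`; in particular `‖intVec k‖` is the Euclidean `|k|`. -/
def intVec {d : ℕ} (k : Fin d → ℤ) : E d := WithLp.toLp 2 fun i => (k i : ℝ)

/-- The character `x ↦ exp (i k · x)` of `𝕋ᵈ`. -/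
def character {d : ℕ} (k : Fin d → ℤ) : C(Torus d, ℂ) where
  toFun x := ∏ i, fourier (k i) (x i)
  continuous_toFun := by fun_prop

/-- The constant `(2π)^(-d/2)`. -/
def normConst (d : ℕ) : ℝ := (2 * Real.pi) ^ (-(d : ℝ) / 2)

/-- Fourier coefficient `f̂(k) = (2π)^(-d/2) ∫ f(x) exp (-i k · x) dx`. -/
def coeff {d : ℕ} (f : Torus d → ℂ) (k : Fin d → ℤ) : ℂ :=
  (normConst d : ℂ) * ∫ x, f x * character (-k) x

/-- Fourier coefficient `ĝ(k, ξ)` of `g` in the variable `x`. -/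
def coeffX {d : ℕ} (g : Phase d → ℂ) (k : Fin d → ℤ) (ξ : E d) : ℂ :=
  coeff (fun x => g (x, ξ)) k

/-! ### Spaces of analytic symbols -/

/-- `h` is the Fourier transform of the (continuous, bounded) function `f` on `ℝᵈ`, in the sense
that `h` is integrable and `f(ξ) = (2π)^(-d/2) ∫ h(η) exp (i η · ξ) dη`. Such an `h` is unique
almost everywhere. No integrability of `f` is demanded. -/
def IsFourierTransform {d : ℕ} (f h : E d → ℂ) : Prop :=
  Integrable h ∧
    ∀ ξ, f ξ = (normConst d : ℂ) * ∫ η, h η * Complex.exp (Complex.I * (inner ℝ η ξ : ℝ))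

/-- `‖f‖ = (2π)^(-d/2) ∫ |f̂(η)| exp (s |η|) dη`; it is `∞` if `f` has no integrable Fourier
transform. The infimum runs over the almost everywhere unique Fourier transform of `f`. -/
def normA {d : ℕ} (s : ℝ) (f : E d → ℂ) : ℝ≥0∞ :=
  ⨅ (h : E d → ℂ) (_ : IsFourierTransform f h),
    ENNReal.ofReal (normConst d) * ∫⁻ η, ‖h η‖ₑ * ENNReal.ofReal (Real.exp (s * ‖η‖))

/-- Membership of a real function in `𝒜_s(ℝᵈ)`. -/
def MemA {d : ℕ} (s : ℝ) (f : E d → ℝ) : Prop :=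
  AnalyticOnNhd ℝ f Set.univ ∧ normA s (fun ξ => (f ξ : ℂ)) < ∞

/-- `‖g‖_{s,ρ} = (2π)^(-d/2) ∑_k ‖ĝ(k, ·)‖_{𝒜_s} exp (ρ |k|)`. -/
def normSymbol {d : ℕ} (s ρ : ℝ) (g : Phase d → ℂ) : ℝ≥0∞ :=
  ENNReal.ofReal (normConst d) *
    ∑' k : Fin d → ℤ, normA s (coeffX g k) * ENNReal.ofReal (Real.exp (ρ * ‖intVec k‖))

/-- Membership of a real function in `𝒜_{s,ρ}(T*𝕋ᵈ)`. Analyticity is that of the lift to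
`ℝᵈ × ℝᵈ`, periodic in the first variable. -/
def MemSymbol {d : ℕ} (s ρ : ℝ) (g : Phase d → ℝ) : Prop :=
  AnalyticOnNhd ℝ (fun p : E d × E d => g (toTorus p.1, p.2)) Set.univ ∧
    normSymbol s ρ (fun p => (g p : ℂ)) < ∞

/-! ### Operators on `L²(𝕋ᵈ)` -/

/-- The Hilbert space `L²(𝕋ᵈ, dx)`. -/
abbrev L2T (d : ℕ) : Type := Lp ℂ 2 (volume : Measure (Torus d))

lemma integrable_mul_character {d : ℕ} (ψ : L2T d) (k : Fin d → ℤ) :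
    Integrable (fun x => ψ x * character k x) := by
  have h1 : Integrable (fun x => ψ x) := (Lp.memLp ψ).integrable (by norm_num)
  refine h1.mul_bdd (c := ‖character k‖) (character k).continuous.aestronglyMeasurable ?_
  exact Filter.Eventually.of_forall fun x => (character k).norm_coe_le_norm x

lemma coeff_congr_ae {d : ℕ} {f g : Torus d → ℂ} (h : f =ᵐ[volume] g) (k : Fin d → ℤ) :
    coeff f k = coeff g k := by
  unfold coeff
  congr 1
  refine integral_congr_ae ?_
  filter_upwards [h] with x hx
  rw [hx]

lemma coeff_add {d : ℕ} (ψ φ : L2T d) (k : Fin d → ℤ) :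
    coeff (ψ + φ : L2T d) k = coeff ψ k + coeff φ k := by
  rw [coeff_congr_ae (Lp.coeFn_add ψ φ)]
  simp only [coeff, Pi.add_apply, add_mul]
  rw [integral_add (integrable_mul_character ψ _) (integrable_mul_character φ _), mul_add]

lemma coeff_smul {d : ℕ} (c : ℂ) (ψ : L2T d) (k : Fin d → ℤ) :
    coeff (c • ψ : L2T d) k = c * coeff ψ k := by
  rw [coeff_congr_ae (Lp.coeFn_smul c ψ)]
  simp only [coeff, Pi.smul_apply, smul_eq_mul, mul_assoc]
  rw [integral_const_mul]
  ring

lemma coeff_zero {d : ℕ} (k : Fin d → ℤ) : coeff (0 : L2T d) k = 0 := by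
  have := coeff_smul (0 : ℂ) (0 : L2T d) k
  simpa using this

/-- The graph of the operator on `L²(𝕋ᵈ)` with matrix `M` in the basis
`e_k = (2π)^(-d/2) exp (i k · x)`, on its maximal domain: the pairs `(ψ, φ)` with
`φ̂(j) = ∑_k M j k ψ̂(k)` for all `j`. -/
def matrixGraph {d : ℕ} (M : (Fin d → ℤ) → (Fin d → ℤ) → ℂ) :
    Submodule ℂ (L2T d × L2T d) where
  carrier := {p | ∀ j, HasSum (fun k => M j k * coeff p.1 k) (coeff p.2 j)}
  zero_mem' := by
    intro j
    simp only [Prod.fst_zero, Prod.snd_zero, coeff_zero, mul_zero]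
    exact hasSum_zero
  add_mem' := by
    intro p q hp hq j
    simp only [Prod.fst_add, Prod.snd_add, coeff_add, mul_add]
    exact (hp j).add (hq j)
  smul_mem' := by
    intro c p hp j
    simp only [Prod.smul_fst, Prod.smul_snd, coeff_smul, mul_left_comm _ c]
    exact (hp j).mul_left c

lemma character_neg {d : ℕ} (k : Fin d → ℤ) (x : Torus d) :
    character (-k) x = (starRingEnd ℂ) (character k x) := by
  simp only [character, Pi.neg_apply, fourier_neg, ContinuousMap.coe_mk, map_prod]

/-- The linear span of the characters is dense in `C(𝕋ᵈ)`. -/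
lemma span_character_dense (d : ℕ) :
    (Submodule.span ℂ (Set.range (character (d := d)))).topologicalClosure = ⊤ := by
  classical
  let S : StarSubalgebra ℂ C(Torus d, ℂ) :=
    { toSubalgebra := Algebra.adjoin ℂ (Set.range character)
      star_mem' := by
        change Algebra.adjoin ℂ (Set.range character) ≤
          star (Algebra.adjoin ℂ (Set.range character))
        refine Algebra.adjoin_le ?_
        rintro _ ⟨n, rfl⟩
        refine Algebra.subset_adjoin ⟨-n, ?_⟩
        ext1 x
        simp only [character_neg, starRingEnd_apply, ContinuousMap.star_apply] }
  have hspan : Subalgebra.toSubmodule S.toSubalgebra =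
      Submodule.span ℂ (Set.range (character (d := d))) := by
    apply Algebra.adjoin_eq_span_of_subset
    refine Set.Subset.trans
      (fun x => Submonoid.closure_induction (fun _ => id) ⟨0, ?_⟩ ?_) Submodule.subset_span
    · ext z
      simp [character]
    · rintro _ _ _ _ ⟨m, rfl⟩ ⟨n, rfl⟩
      refine ⟨m + n, ?_⟩
      ext z
      simp only [character, Pi.add_apply, fourier_add, Finset.prod_mul_distrib,
        ContinuousMap.coe_mk, ContinuousMap.mul_apply]
  have hsep : S.SeparatesPoints := by
    intro x y hxy
    rw [Ne, funext_iff, not_forall] at hxy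
    obtain ⟨i, hi⟩ := hxy
    have hs : ∀ z : Torus d, character (Pi.single i 1) z = fourier 1 (z i) := by
      intro z
      simp only [character, ContinuousMap.coe_mk]
      rw [Finset.prod_eq_single i]
      · simp
      · intro j _ hj
        simp [Pi.single_eq_of_ne hj]
      · simp
    refine ⟨_, ⟨character (Pi.single i 1), Algebra.subset_adjoin ⟨Pi.single i 1, rfl⟩, rfl⟩, ?_⟩
    dsimp only
    rw [hs, hs, fourier_one, fourier_one]
    intro h
    exact hi (AddCircle.injective_toCircle Real.two_pi_pos.ne' (Circle.ext h))
  rw [← hspan]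
  exact congr_arg (Subalgebra.toSubmodule <| StarSubalgebra.toSubalgebra ·)
    (ContinuousMap.starSubalgebra_topologicalClosure_eq_top_of_separatesPoints S hsep)

lemma normConst_pos (d : ℕ) : 0 < normConst d :=
  Real.rpow_pos_of_pos Real.two_pi_pos _

/-- An element of `L²(𝕋ᵈ)` is determined by its Fourier coefficients. -/
lemma eq_zero_of_coeff {d : ℕ} (ψ : L2T d) (h : ∀ k, coeff ψ k = 0) : ψ = 0 := by
  have hd : Dense (Submodule.map (ContinuousMap.toLp (E := ℂ) 2
      (volume : Measure (Torus d)) ℂ).toLinearMap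
      (Submodule.span ℂ (Set.range (character (d := d)))) : Set (L2T d)) := by
    rw [Submodule.dense_iff_topologicalClosure_eq_top]
    exact (ContinuousMap.toLp_denseRange ℂ (volume : Measure (Torus d)) ℂ
      (by norm_num)).topologicalClosure_map_submodule (span_character_dense d)
  have key : ∀ g ∈ Submodule.span ℂ (Set.range (character (d := d))),
      inner ℂ (ContinuousMap.toLp (E := ℂ) 2 (volume : Measure (Torus d)) ℂ g) ψ = 0 := by
    intro g hg
    induction hg using Submodule.span_induction with
    | mem g hg =>
      obtain ⟨k, rfl⟩ := hg
      have h1 : ∫ x, ψ x * character (-k) x = 0 := by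
        have := h k
        simp only [coeff, mul_eq_zero, Complex.ofReal_eq_zero] at this
        exact this.resolve_left (normConst_pos d).ne'
      rw [L2.inner_def, ← h1]
      refine integral_congr_ae ?_
      filter_upwards [ContinuousMap.coeFn_toLp (p := 2) (𝕜 := ℂ)
        (volume : Measure (Torus d)) (character k)] with x hx
      rw [hx, character_neg]
      simp
    | zero => simp
    | add f g _ _ hf hg => rw [map_add, inner_add_left, hf, hg, add_zero]
    | smul c f _ hf => rw [map_smul, inner_smul_left, hf, mul_zero]
  refine hd.eq_zero_of_inner_right (𝕜 := ℂ) ?_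
  intro v hv
  obtain ⟨g, hg, rfl⟩ := hv
  exact key g hg

/-- `matrixGraph M` is the graph of a single-valued operator. -/
lemma matrixGraph_functional {d : ℕ} (M : (Fin d → ℤ) → (Fin d → ℤ) → ℂ)
    (p : L2T d × L2T d) (hp : p ∈ matrixGraph M) (h : p.1 = 0) : p.2 = 0 := by
  refine eq_zero_of_coeff _ fun j => ?_
  have := hp j
  simp only [h, coeff_zero, mul_zero] at this
  exact this.unique hasSum_zero

/-- The unbounded operator on `L²(𝕋ᵈ)` with matrix `M` in the basis `(e_k)`, on its maximal
domain. -/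
def matrixOp {d : ℕ} (M : (Fin d → ℤ) → (Fin d → ℤ) → ℂ) : L2T d →ₗ.[ℂ] L2T d :=
  (matrixGraph M).toLinearPMap

/-- `L̂_{ω,ħ} = ω · ħ D_x`, `D_x = -i ∂_x`: the Fourier multiplier `ħ ω · k`. -/
def Lhat {d : ℕ} (ω : E d) (ħ : ℝ) : L2T d →ₗ.[ℂ] L2T d :=
  matrixOp fun j k => if j = k then ((ħ * inner ℝ ω (intVec k) : ℝ) : ℂ) else 0

/-- The semiclassical Weyl quantization `Op_ħ(a)`:
`Op_ħ(a) e_k = (2π)^(-d/2) ∑_j â(j - k, ħ (j + k) / 2) e_j`. -/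
def weylOp {d : ℕ} (ħ : ℝ) (a : Phase d → ℂ) : L2T d →ₗ.[ℂ] L2T d :=
  matrixOp fun j k => (normConst d : ℂ) * coeffX a (j - k) ((ħ / 2) • intVec (j + k))

/-- `Q̂_ħ = L̂_{ω,ħ} + ħ Op_ħ(V - R)`. -/
def Qhat {d : ℕ} (ω : E d) (V : Phase d → ℝ) (R : E d → ℝ) (ħ : ℝ) : L2T d →ₗ.[ℂ] L2T d :=
  Lhat ω ħ + (ħ : ℂ) • weylOp ħ (fun p => ((V p - R p.2 : ℝ) : ℂ))

/-- `ψ` lies in the domain of `A` and `A ψ = z ψ`. -/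
def EigenEq {d : ℕ} (A : L2T d →ₗ.[ℂ] L2T d) (z : ℂ) (ψ : L2T d) : Prop :=
  ∃ h : ψ ∈ A.domain, A ⟨ψ, h⟩ = z • ψ

/-- The point spectrum: the set of eigenvalues. -/
def pointSpectrum {d : ℕ} (A : L2T d →ₗ.[ℂ] L2T d) : Set ℂ :=
  {z | ∃ ψ, ψ ≠ 0 ∧ EigenEq A z ψ}

/-! ### Semiclassical measures and quantum limits -/

/-- Test functions: `C_c^∞(T*𝕋ᵈ)`. -/
def IsTestFunction {d : ℕ} (a : Phase d → ℂ) : Prop :=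
  ContDiff ℝ ((⊤ : ℕ∞) : WithTop ℕ∞) (fun p : E d × E d => a (toTorus p.1, p.2)) ∧ HasCompactSupport a

open Classical in
/-- The Wigner distribution `W^ħ_ψ(a) = ⟨ψ, Op_ħ(a) ψ⟩`. For test functions `a` the operator
`Op_ħ(a)` is bounded and everywhere defined, so that the second branch does not occur. -/
def wigner {d : ℕ} (ħ : ℝ) (ψ : L2T d) (a : Phase d → ℂ) : ℂ :=
  if h : ψ ∈ (weylOp ħ a).domain then inner ℂ ψ (weylOp ħ a ⟨ψ, h⟩) else 0

/-- `ħ_n → 0` in `(0, 1]`, and `Ψ_n` is a normalized eigenfunction of `A ħ_n` whose eigenvalue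
`z_n` tends to `1`. -/
def IsEigenSequence {d : ℕ} (A : ℝ → L2T d →ₗ.[ℂ] L2T d) (ħ : ℕ → ℝ) (z : ℕ → ℂ)
    (Ψ : ℕ → L2T d) : Prop :=
  (∀ n, ħ n ∈ Set.Ioc (0 : ℝ) 1) ∧ Tendsto ħ atTop (𝓝 0) ∧ Tendsto z atTop (𝓝 1) ∧
    ∀ n, ‖Ψ n‖ = 1 ∧ EigenEq (A (ħ n)) (z n) (Ψ n)

/-- The set `ℳ(A_ħ)` of semiclassical measures of sequences of normalized eigenfunctions with
eigenvalues tending to `1`: the Radon measures on `T*𝕋ᵈ` that are limits of the Wigner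
distributions. -/
def semiclassicalMeasures {d : ℕ} (A : ℝ → L2T d →ₗ.[ℂ] L2T d) : Set (Measure (Phase d)) :=
  {μ | IsLocallyFiniteMeasure μ ∧ ∃ (ħ : ℕ → ℝ) (z : ℕ → ℂ) (Ψ : ℕ → L2T d),
    IsEigenSequence A ħ z Ψ ∧ ∀ a : Phase d → ℂ, IsTestFunction a →
      Tendsto (fun n => wigner (ħ n) (Ψ n) a) atTop (𝓝 (∫ p, a p ∂μ))}

/-- The set `𝒩(A_ħ)` of quantum limits: the weak-star limits on `𝕋ᵈ` of the densities `|Ψ_n|² dx`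
of sequences of normalized eigenfunctions with eigenvalues tending to `1`. -/
def quantumLimits {d : ℕ} (A : ℝ → L2T d →ₗ.[ℂ] L2T d) : Set (Measure (Torus d)) :=
  {ν | IsFiniteMeasure ν ∧ ∃ (ħ : ℕ → ℝ) (z : ℕ → ℂ) (Ψ : ℕ → L2T d),
    IsEigenSequence A ħ z Ψ ∧ ∀ b : C(Torus d, ℝ),
      Tendsto (fun n => ∫ x, b x * ‖Ψ n x‖ ^ 2) atTop (𝓝 (∫ x, b x ∂ν))}

/-- The normalized Lebesgue measure `(2π)^(-d) dx` on `𝕋ᵈ`. -/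
def normalizedLebesgue (d : ℕ) : Measure (Torus d) :=
  ENNReal.ofReal (((2 * Real.pi) ^ d)⁻¹) • volume

/-- The normalized Haar measure on the torus `𝕋ᵈ × {ξ}`, as a measure on `T*𝕋ᵈ`. -/
def haarTorus {d : ℕ} (ξ : E d) : Measure (Phase d) :=
  (normalizedLebesgue d).prod (Measure.dirac ξ)

/-- Diophantine condition `|k · ω| ≥ ς / |k|^(γ - 1)` for `k ∈ ℤᵈ`, `k ≠ 0`. -/
def IsDiophantine {d : ℕ} (ς γ : ℝ) (ω : E d) : Prop :=
  ∀ k : Fin d → ℤ, k ≠ 0 → ς / ‖intVec k‖ ^ (γ - 1) ≤ |inner ℝ ω (intVec k)|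

end SemiclassicalTorus

end

open Filter Topology MeasureTheory
open scoped ENNReal

noncomputable section

set_option linter.unusedSectionVars false

namespace SemiclassicalTorus

section

/-! ### Crossed products of Banach algebras -/

/-! The operators are handled through their matrices in the basis `e_k`. The Weyl quantization of a
symbol has matrix `a_{j-k}(ħk)`, where `a_m` is the suitably translated `m`-th Fourier coefficient.
Such matrices multiply by a convolution in the degree `m` twisted by the translations `a ↦ a(· +
ħl)`. They therefore live in a crossed product `ℓ¹(ℤᵈ, 𝔸)`, where `𝔸` is the algebra of symbols `c +
f` with `c` constant and `f` of finite `𝒜_s`-norm; the constants supply the unit. Translations are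
isometries of `𝔸`, so every norm estimate in the crossed product is uniform in `ħ`.

After division by `ħ`, commutation with `ω·D` becomes the derivation `D` that multiplies degree `k`
by `ω·k`, and a function of `ξ` alone is an element of degree `0`. The operator `ω·D + V - R` is
conjugated to `ω·D` by an invertible `U` exactly when `DU + (V - R)U = 0`.
`CrossedProduct.exists_conjugation` solves this by a KAM iteration. Each step solves `DF = -P` for
the current error `P`, replaces `U` by `U(1 + F)`, and adjusts `R` so that the new error has no
degree-`0` part (`ApproxConj.step`). The Diophantine condition costs some width in the weight `exp
(r|k|)`, but the division is by the scalars `ω·k`, so nothing is lost in `s`, and `R` is controlled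
in `𝒜_s` itself.

The conjugation `U` is not unitary. The Hermitian symmetry of `V` makes up for this through Green's
identity (`IsConjugation.tsum_green`). Applied to a column of `U` and itself, it shows that `R` is
real, because `U` is close to `1`. Applied to a column and any bounded eigenvector, it gives
orthogonality when the eigenvalues differ. Since `U` is invertible, its columns are complete, so
every eigenfunction is a multiple of one column and the point spectrum is that of `ω·ħD`.

An eigenfunction attached to `k` has coefficients that decay exponentially away from `k`, uniformly
in `ħ`, so its Wigner distribution only sees the point `ħk` and the correlations `∑_m conj (ψ̂(m+l))
ψ̂(m)`. Moving along a column by `l` is, up to `O(ħ|l|)`, the same as passing to column `k - l`,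
because symbols are Lipschitz in `ξ`. Columns `k - l` and `k` are orthogonal, so the correlations
with `l ≠ 0` tend to `0` (`IsDiagonalizedBy.norm_correlation_le`). Hence Wigner distributions are
asymptotic to `𝔥_{𝕋ᵈ×{ħk}}` and densities to Lebesgue measure, exactly as for pure exponentials. The
limits are then read off from the points `ħ_n k_n` with `ω·ħ_n k_n → 1`: these accumulate on the
hyperplane `ω·ξ = 1` or escape to infinity. -/

/-- An action of `G` on a normed ring by isometric automorphisms. -/
structure IsometricAction (G 𝔸 : Type*) [AddCommGroup G] [NormedRing 𝔸] where
  toFun : G → 𝔸 →+* 𝔸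
  map_zero : ∀ a, toFun 0 a = a
  map_add : ∀ k l a, toFun (k + l) a = toFun k (toFun l a)
  norm_map : ∀ k a, ‖toFun k a‖ = ‖a‖

instance {G 𝔸 : Type*} [AddCommGroup G] [NormedRing 𝔸] :
    CoeFun (IsometricAction G 𝔸) fun _ => G → 𝔸 →+* 𝔸 := ⟨IsometricAction.toFun⟩

/-! ### Weighted `ℓ¹` norms of families. -/

section WeightedNorm

variable {ι 𝔸 : Type*} [NormedRing 𝔸]

/-- The `ℓ¹`-norm of a family with weight `w`. -/
def weightedNorm (w : ι → ℝ≥0∞) (a : ι → 𝔸) : ℝ≥0∞ := ∑' k, ‖a k‖ₑ * w k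

lemma weightedNorm_add_le (w : ι → ℝ≥0∞) (a b : ι → 𝔸) :
    weightedNorm w (a + b) ≤ weightedNorm w a + weightedNorm w b := by
  unfold weightedNorm
  rw [← ENNReal.tsum_add]
  refine ENNReal.tsum_le_tsum fun k => ?_
  rw [← add_mul]
  gcongr
  exact enorm_add_le _ _

lemma weightedNorm_neg (w : ι → ℝ≥0∞) (a : ι → 𝔸) : weightedNorm w (-a) = weightedNorm w a := by
  simp [weightedNorm]

lemma weightedNorm_mono {w w' : ι → ℝ≥0∞} (h : ∀ k, w k ≤ w' k) (a : ι → 𝔸) :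
    weightedNorm w a ≤ weightedNorm w' a :=
  ENNReal.tsum_le_tsum fun k => by gcongr; exact h k

open Classical in
lemma weightedNorm_single (w : ι → ℝ≥0∞) (k : ι) (a : 𝔸) :
    weightedNorm w (Pi.single k a) = ‖a‖ₑ * w k := by
  unfold weightedNorm
  rw [tsum_eq_single k]
  · simp
  · intro j hj; simp [Pi.single_eq_of_ne hj]

end WeightedNorm

/-! ### Twisted convolution. -/

section Conv

variable {G 𝔸 : Type*} [AddCommGroup G] [NormedRing 𝔸]

/-- Twisted convolution of families. -/
def twistedConv (α : IsometricAction G 𝔸) (a b : G → 𝔸) (m : G) : 𝔸 :=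
  ∑' l, α l (a (m - l)) * b l

lemma IsometricAction.enorm_map (α : IsometricAction G 𝔸) (k : G) (a : 𝔸) : ‖α k a‖ₑ = ‖a‖ₑ := by
  rw [← ofReal_norm, ← ofReal_norm, α.norm_map]

lemma IsometricAction.continuous (α : IsometricAction G 𝔸) (k : G) : Continuous (α k) :=
  (AddMonoidHomClass.isometry_of_norm (α k) (α.norm_map k)).continuous

lemma enorm_mul_le' (a b : 𝔸) : ‖a * b‖ₑ ≤ ‖a‖ₑ * ‖b‖ₑ := by
  rw [← ofReal_norm, ← ofReal_norm, ← ofReal_norm, ← ENNReal.ofReal_mul (norm_nonneg _)]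
  exact ENNReal.ofReal_le_ofReal (norm_mul_le a b)

/-- Young's inequality for `ℓ¹` with a submultiplicative weight. It bounds the double sum of norms
rather than the norm of the convolution, so that it also provides the absolute summability needed
for Fubini. -/
lemma tsum_tsum_enorm_le {w : G → ℝ≥0∞} (hw : ∀ k l, w (k + l) ≤ w k * w l) (a b : G → 𝔸) :
    ∑' m, ∑' l, ‖a (m - l)‖ₑ * ‖b l‖ₑ * w m ≤ weightedNorm w a * weightedNorm w b := by
  calc ∑' m, ∑' l, ‖a (m - l)‖ₑ * ‖b l‖ₑ * w m
      ≤ ∑' m, ∑' l, (‖a (m - l)‖ₑ * w (m - l)) * (‖b l‖ₑ * w l) := by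
        refine ENNReal.tsum_le_tsum fun m => ENNReal.tsum_le_tsum fun l => ?_
        have := hw (m - l) l
        rw [sub_add_cancel] at this
        calc _ ≤ ‖a (m - l)‖ₑ * ‖b l‖ₑ * (w (m - l) * w l) := by gcongr
          _ = _ := by ring
    _ = ∑' l, ∑' m, (‖a (m - l)‖ₑ * w (m - l)) * (‖b l‖ₑ * w l) := ENNReal.tsum_comm
    _ = ∑' l, weightedNorm w a * (‖b l‖ₑ * w l) := by
        refine tsum_congr fun l => ?_
        rw [ENNReal.tsum_mul_right]
        congr 1
        exact (Equiv.subRight l).tsum_eq fun k => ‖a k‖ₑ * w k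
    _ = _ := by rw [ENNReal.tsum_mul_left]; rfl

lemma enorm_conv_term_le (α : IsometricAction G 𝔸) (a b : G → 𝔸) (m l : G) :
    ‖α l (a (m - l)) * b l‖ₑ ≤ ‖a (m - l)‖ₑ * ‖b l‖ₑ :=
  (enorm_mul_le' _ _).trans_eq (by rw [α.enorm_map])

lemma weightedNorm_twistedConv_le {w : G → ℝ≥0∞} (hw : ∀ k l, w (k + l) ≤ w k * w l)
    (α : IsometricAction G 𝔸) (a b : G → 𝔸) :
    weightedNorm w (twistedConv α a b) ≤ weightedNorm w a * weightedNorm w b := by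
  refine le_trans ?_ (tsum_tsum_enorm_le hw a b)
  refine ENNReal.tsum_le_tsum fun m => ?_
  rw [ENNReal.tsum_mul_right]
  gcongr
  exact enorm_tsum_le_tsum_enorm.trans (ENNReal.tsum_le_tsum fun l => enorm_conv_term_le α a b m l)

lemma summable_of_tsum_enorm_ne_top [CompleteSpace 𝔸] {ι : Type*} {f : ι → 𝔸} (h : ∑' i, ‖f i‖ₑ ≠ ∞) :
    Summable f := by
  refine Summable.of_norm ?_
  have h' : Summable fun i => ‖f i‖₊ := ENNReal.tsum_coe_ne_top_iff_summable.mp h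
  exact NNReal.summable_coe.mpr h'

lemma summable_conv_prod (α : IsometricAction G 𝔸) {a b : G → 𝔸}
    (ha : weightedNorm 1 a ≠ ∞) (hb : weightedNorm 1 b ≠ ∞) :
    ∑' m, ∑' l, ‖α l (a (m - l)) * b l‖ₑ ≠ ∞ := by
  refine ne_top_of_le_ne_top (ENNReal.mul_ne_top ha hb) ?_
  refine le_trans ?_ (tsum_tsum_enorm_le (w := 1) (by simp) a b)
  refine ENNReal.tsum_le_tsum fun m => ENNReal.tsum_le_tsum fun l => ?_
  simpa using enorm_conv_term_le α a b m l

variable [CompleteSpace 𝔸]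

lemma summable_conv (α : IsometricAction G 𝔸) {a b : G → 𝔸}
    (ha : weightedNorm 1 a ≠ ∞) (hb : weightedNorm 1 b ≠ ∞) (m : G) :
    Summable fun l => α l (a (m - l)) * b l :=
  summable_of_tsum_enorm_ne_top (ENNReal.ne_top_of_tsum_ne_top (summable_conv_prod α ha hb) m)

/-- Everything is absolutely summable, so the double sum over `(l, j)` may be reindexed by `(l + j,
l)`; the additivity of the action in the group variable then matches the terms. -/
lemma twistedConv_assoc (α : IsometricAction G 𝔸) {a b c : G → 𝔸}
    (ha : weightedNorm 1 a ≠ ∞) (hb : weightedNorm 1 b ≠ ∞) (hc : weightedNorm 1 c ≠ ∞) :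
    twistedConv α (twistedConv α a b) c = twistedConv α a (twistedConv α b c) := by
  funext m
  have hsum : Summable fun p : G × G =>
      α p.1 (α p.2 (a (m - p.1 - p.2)) * b p.2) * c p.1 := by
    apply summable_of_tsum_enorm_ne_top
    rw [ENNReal.tsum_prod']
    have hle : ∑' l, ∑' j, ‖α l (α j (a (m - l - j)) * b j) * c l‖ₑ
        ≤ ∑' l, (∑' j, ‖a (m - l - j)‖ₑ * ‖b j‖ₑ) * ‖c l‖ₑ := by
      refine ENNReal.tsum_le_tsum fun l => ?_
      rw [← ENNReal.tsum_mul_right]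
      refine ENNReal.tsum_le_tsum fun j => ?_
      refine (enorm_mul_le' _ _).trans ?_
      rw [α.enorm_map]
      gcongr
      exact enorm_conv_term_le α a b (m - l) j
    refine ne_top_of_le_ne_top ?_ hle
    have hbound : ∀ k, ∑' j, ‖a (k - j)‖ₑ * ‖b j‖ₑ ≤ weightedNorm 1 a * weightedNorm 1 b := by
      intro k
      refine le_trans ?_ (tsum_tsum_enorm_le (w := 1) (by simp) a b)
      refine le_trans ?_ (ENNReal.le_tsum k)
      simp
    refine ne_top_of_le_ne_top (ENNReal.mul_ne_top (ENNReal.mul_ne_top ha hb) hc) ?_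
    calc _ ≤ ∑' l, (weightedNorm 1 a * weightedNorm 1 b) * ‖c l‖ₑ :=
          ENNReal.tsum_le_tsum fun l => mul_le_mul_left (hbound _) _
      _ = _ := by rw [ENNReal.tsum_mul_left]; simp [weightedNorm]
  let e : G × G ≃ G × G :=
    { toFun := fun p => (p.2, p.1 - p.2)
      invFun := fun p => (p.1 + p.2, p.1)
      left_inv := fun p => by simp
      right_inv := fun p => by simp }
  have hsum' := (e.summable_iff).mpr hsum
  calc twistedConv α (twistedConv α a b) c m
      = ∑' l, ∑' j, α l (α j (a (m - l - j)) * b j) * c l := by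
        refine tsum_congr fun l => ?_
        unfold twistedConv
        rw [((summable_conv α ha hb (m - l)).map_tsum (α l) (α.continuous l))]
        exact (((summable_conv α ha hb (m - l)).map (α l) (α.continuous l)).tsum_mul_right _).symm
    _ = ∑' p : G × G, α p.1 (α p.2 (a (m - p.1 - p.2)) * b p.2) * c p.1 := by
        rw [hsum.tsum_prod]
    _ = ∑' p : G × G, α p.2 (α (p.1 - p.2) (a (m - p.1)) * b (p.1 - p.2)) * c p.2 := by
        rw [← e.tsum_eq]
        refine tsum_congr fun p => ?_
        simp [e]
    _ = ∑' l, ∑' j, α j (α (l - j) (a (m - l)) * b (l - j)) * c j := by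
        refine Summable.tsum_prod (hsum'.congr fun p => ?_)
        simp [e]
    _ = _ := by
        refine tsum_congr fun l => ?_
        unfold twistedConv
        rw [← (summable_conv α hb hc l).tsum_mul_left]
        refine tsum_congr fun j => ?_
        rw [map_mul, ← α.map_add, add_sub_cancel, mul_assoc]

end Conv

/-! ### The crossed product algebra -/

/-- The crossed product `ℓ¹(G, 𝔸)` with twisted convolution. -/
def CrossedProduct {G 𝔸 : Type*} [AddCommGroup G] [NormedRing 𝔸] (_α : IsometricAction G 𝔸) :
    Type _ := lp (fun _ : G => 𝔸) 1

namespace CrossedProduct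

variable {G 𝔸 : Type*} [AddCommGroup G] [NormedRing 𝔸] {α : IsometricAction G 𝔸}

instance : NormedAddCommGroup (CrossedProduct α) :=
  inferInstanceAs (NormedAddCommGroup (lp (fun _ : G => 𝔸) 1))

instance [CompleteSpace 𝔸] : CompleteSpace (CrossedProduct α) :=
  inferInstanceAs (CompleteSpace (lp (fun _ : G => 𝔸) 1))

instance : FunLike (CrossedProduct α) G 𝔸 where
  coe a := (show lp (fun _ : G => 𝔸) 1 from a).1
  coe_injective _ _ h := lp.ext h

@[ext] lemma ext {a b : CrossedProduct α} (h : ∀ k, a k = b k) : a = b := DFunLike.ext _ _ h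

@[simp] lemma add_apply (a b : CrossedProduct α) (k : G) : (a + b) k = a k + b k := rfl
@[simp] lemma neg_apply (a : CrossedProduct α) (k : G) : (-a) k = -a k := rfl
@[simp] lemma sub_apply (a b : CrossedProduct α) (k : G) : (a - b) k = a k - b k := rfl
@[simp] lemma zero_apply (k : G) : (0 : CrossedProduct α) k = 0 := rfl

lemma hasSum_norm (a : CrossedProduct α) : HasSum (fun k => ‖a k‖) ‖a‖ := by
  have := lp.hasSum_norm (E := fun _ : G => 𝔸) (p := 1) (by norm_num) a
  simp only [ENNReal.toReal_one, Real.rpow_one] at this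
  exact this

lemma weightedNorm_one_eq (a : CrossedProduct α) : weightedNorm 1 a = ‖a‖ₑ := by
  have h := a.hasSum_norm
  rw [← ofReal_norm, ← h.tsum_eq, ENNReal.ofReal_tsum_of_nonneg (fun _ => norm_nonneg _) h.summable]
  simp [weightedNorm]

lemma weightedNorm_one_ne_top (a : CrossedProduct α) : weightedNorm 1 a ≠ ∞ := by
  rw [weightedNorm_one_eq]; exact enorm_ne_top

/-- A family with finite `ℓ¹`-norm as an element of the crossed product. -/
def mk (α : IsometricAction G 𝔸) (a : G → 𝔸) (h : weightedNorm 1 a ≠ ∞) : CrossedProduct α :=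
  (⟨a, memℓp_gen (by
    have h' : Summable fun i => ‖a i‖₊ := ENNReal.tsum_coe_ne_top_iff_summable.mp (by
      refine ne_of_eq_of_ne (tsum_congr fun k => ?_) h
      simp [enorm])
    simpa using NNReal.summable_coe.mpr h')⟩ : lp (fun _ : G => 𝔸) 1)

@[simp] lemma mk_apply (a : G → 𝔸) (h : weightedNorm 1 a ≠ ∞) (k : G) : mk α a h k = a k := rfl
lemma coe_mk (a : G → 𝔸) (h : weightedNorm 1 a ≠ ∞) : ⇑(mk α a h) = a := rfl

lemma norm_apply_le (a : CrossedProduct α) (k : G) : ‖a k‖ ≤ ‖a‖ :=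
  lp.norm_apply_le_norm (E := fun _ : G => 𝔸) (p := 1) (by norm_num) a k

lemma lipschitzWith_apply (k : G) : LipschitzWith 1 fun a : CrossedProduct α => a k := by
  refine LipschitzWith.of_dist_le_mul fun a b => ?_
  simp only [dist_eq_norm, NNReal.coe_one, one_mul]
  exact norm_apply_le (a - b) k

lemma continuous_apply (k : G) : Continuous fun a : CrossedProduct α => a k :=
  (lipschitzWith_apply k).continuous

/-- Lower semicontinuity of weighted norms along convergent sequences. -/
lemma weightedNorm_le_of_tendsto {w : G → ℝ≥0∞} (hw : ∀ k, w k ≠ ∞) {a : ℕ → CrossedProduct α}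
    {b : CrossedProduct α}
    (h : Tendsto a atTop (𝓝 b)) {C : ℝ≥0∞} (hC : ∀ n, weightedNorm w (a n) ≤ C) :
    weightedNorm w b ≤ C := by
  unfold weightedNorm
  rw [ENNReal.tsum_eq_iSup_sum]
  refine iSup_le fun s => ?_
  have ht : Tendsto (fun n => ∑ k ∈ s, ‖a n k‖ₑ * w k) atTop (𝓝 (∑ k ∈ s, ‖b k‖ₑ * w k)) := by
    refine tendsto_finsetSum _ fun k _ => ?_
    refine ENNReal.Tendsto.mul_const ?_ (Or.inr (hw k))
    exact (((continuous_apply k).tendsto b).comp h).enorm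
  exact le_of_tendsto' ht fun n => (ENNReal.sum_le_tsum s).trans (hC n)

open Classical in
/-- The element `a` placed in degree `0`. -/
def diag (α : IsometricAction G 𝔸) (a : 𝔸) : CrossedProduct α :=
  mk α (Pi.single 0 a) (by rw [weightedNorm_single]; simp)

@[simp] lemma diag_apply_zero (a : 𝔸) : diag α a 0 = a := by simp [diag]
lemma diag_apply_ne (a : 𝔸) {k : G} (hk : k ≠ 0) : diag α a k = 0 := by simp [diag, hk]

lemma weightedNorm_diag {w : G → ℝ≥0∞} (hw : w 0 = 1) (a : 𝔸) :
    weightedNorm w (diag α a) = ‖a‖ₑ := by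
  rw [diag, coe_mk, weightedNorm_single, hw, mul_one]

lemma norm_diag (a : 𝔸) : ‖diag α a‖ = ‖a‖ := by
  have := weightedNorm_diag (α := α) (w := 1) rfl a
  rw [weightedNorm_one_eq] at this
  simpa using congrArg ENNReal.toReal this

lemma diag_add (a b : 𝔸) : diag α (a + b) = diag α a + diag α b := by
  ext k; by_cases hk : k = 0
  · subst hk; simp
  · simp [diag_apply_ne _ hk]

lemma diag_neg (a : 𝔸) : diag α (-a) = -diag α a := by
  ext k; by_cases hk : k = 0
  · subst hk; simp
  · simp [diag_apply_ne _ hk]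

lemma diag_sub (a b : 𝔸) : diag α (a - b) = diag α a - diag α b := by
  rw [sub_eq_add_neg, diag_add, diag_neg, ← sub_eq_add_neg]

instance : One (CrossedProduct α) := ⟨diag α 1⟩

instance : Mul (CrossedProduct α) := ⟨fun a b => mk α (twistedConv α a b)
  (ne_top_of_le_ne_top (ENNReal.mul_ne_top a.weightedNorm_one_ne_top b.weightedNorm_one_ne_top)
    (weightedNorm_twistedConv_le (by simp) α a b))⟩

lemma mul_apply (a b : CrossedProduct α) (m : G) : (a * b) m = ∑' l, α l (a (m - l)) * b l := rfl
lemma coe_mul (a b : CrossedProduct α) : ⇑(a * b) = twistedConv α a b := rfl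
lemma weightedNorm_mul_le {w : G → ℝ≥0∞} (hw : ∀ k l, w (k + l) ≤ w k * w l)
    (a b : CrossedProduct α) : weightedNorm w ⇑(a * b) ≤
      weightedNorm w a * weightedNorm w b :=
  weightedNorm_twistedConv_le hw α a b

lemma one_def : (1 : CrossedProduct α) = diag α 1 := rfl

lemma mul_diag_apply (a : CrossedProduct α) (b : 𝔸) (m : G) : (a * diag α b) m = a m * b := by
  rw [mul_apply, tsum_eq_single 0]
  · rw [sub_zero, α.map_zero, diag_apply_zero]
  · intro l hl; rw [diag_apply_ne _ hl, mul_zero]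

/-- Unlike right multiplication, left multiplication by a degree-`0` element shifts it. In matrix
terms the left factor is evaluated at the row index, the right factor at the column index. -/
lemma diag_mul_apply (a : 𝔸) (b : CrossedProduct α) (m : G) : (diag α a * b) m = α m a * b m := by
  rw [mul_apply, tsum_eq_single m]
  · rw [sub_self, diag_apply_zero]
  · intro l hl; rw [diag_apply_ne _ (sub_ne_zero.mpr hl.symm), map_zero, zero_mul]

variable [CompleteSpace 𝔸]

lemma summable_mul (a b : CrossedProduct α) (m : G) : Summable fun l => α l (a (m - l)) * b l :=
  summable_conv α a.weightedNorm_one_ne_top b.weightedNorm_one_ne_top m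

instance : NormedRing (CrossedProduct α) :=
  { (inferInstance : NormedAddCommGroup (CrossedProduct α)) with
    mul := (· * ·)
    one := 1
    left_distrib := fun a b c => by
      ext m
      change (a * (b + c)) m = (a * b) m + (a * c) m
      simp only [mul_apply, add_apply, mul_add]
      exact (summable_mul a b m).tsum_add (summable_mul a c m)
    right_distrib := fun a b c => by
      ext m
      change ((a + b) * c) m = (a * c) m + (b * c) m
      simp only [mul_apply, add_apply, map_add, add_mul]
      exact (summable_mul a c m).tsum_add (summable_mul b c m)
    zero_mul := fun a => by
      ext m
      change ((0 : CrossedProduct α) * a) m = (0 : CrossedProduct α) m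
      simp [mul_apply]
    mul_zero := fun a => by
      ext m
      change (a * (0 : CrossedProduct α)) m = (0 : CrossedProduct α) m
      simp [mul_apply]
    mul_assoc := fun a b c => by
      ext m
      exact congrFun (twistedConv_assoc α a.weightedNorm_one_ne_top b.weightedNorm_one_ne_top
        c.weightedNorm_one_ne_top) m
    one_mul := fun a => by
      ext m
      change (diag α 1 * a) m = a m
      rw [diag_mul_apply, map_one, one_mul]
    mul_one := fun a => by
      ext m
      change (a * diag α 1) m = a m
      rw [mul_diag_apply, mul_one]
    norm_mul_le := fun a b => by
      have h := weightedNorm_twistedConv_le (w := 1) (by simp) α a b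
      rw [← coe_mul, weightedNorm_one_eq, weightedNorm_one_eq, weightedNorm_one_eq, ← ofReal_norm,
        ← ofReal_norm, ← ofReal_norm, ← ENNReal.ofReal_mul (norm_nonneg _)] at h
      exact (ENNReal.ofReal_le_ofReal_iff (by positivity)).mp h }

end CrossedProduct

end

section

/-! ### A KAM scheme with counterterm in a crossed product -/

/-- The weight `exp (r ℓ(k))`. -/
def expWeight {G : Type*} [AddCommGroup G] (ℓ : AddGroupSeminorm G) (r : ℝ) (k : G) : ℝ≥0∞ :=
  ENNReal.ofReal (Real.exp (r * ℓ k))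

section

variable {G : Type*} [AddCommGroup G] (ℓ : AddGroupSeminorm G)

lemma expWeight_ne_top (r : ℝ) (k : G) : expWeight ℓ r k ≠ ∞ := ENNReal.ofReal_ne_top

lemma expWeight_zero (r : ℝ) : expWeight ℓ r 0 = 1 := by simp [expWeight]

lemma expWeight_add_le {r : ℝ} (hr : 0 ≤ r) (k l : G) :
    expWeight ℓ r (k + l) ≤ expWeight ℓ r k * expWeight ℓ r l := by
  unfold expWeight
  rw [← ENNReal.ofReal_mul (Real.exp_pos _).le, ← Real.exp_add, ← mul_add]
  gcongr
  exact map_add_le_add ℓ k l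

lemma expWeight_mono {r r' : ℝ} (h : r ≤ r') (k : G) : expWeight ℓ r k ≤ expWeight ℓ r' k := by
  unfold expWeight
  have := apply_nonneg ℓ k
  gcongr

lemma one_le_expWeight {r : ℝ} (hr : 0 ≤ r) (k : G) : 1 ≤ expWeight ℓ r k := by
  have := expWeight_mono ℓ hr k
  simpa [expWeight] using this

end

namespace CrossedProduct

variable {G 𝔸 : Type*} [AddCommGroup G] [NormedRing 𝔸] [CompleteSpace 𝔸]
  {α : IsometricAction G 𝔸} {ℓ : AddGroupSeminorm G} {r x y : ℝ} {a b : CrossedProduct α}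

/-! ### Calculus of weighted bounds and the Neumann series. -/

/-- The weighted norm of `a` with weight `exp (r ℓ)` is at most `x`. -/
def NormLE (ℓ : AddGroupSeminorm G) (r : ℝ) (a : CrossedProduct α) (x : ℝ) : Prop :=
  0 ≤ x ∧ weightedNorm (expWeight ℓ r) a ≤ ENNReal.ofReal x

namespace NormLE

lemma add (ha : NormLE ℓ r a x) (hb : NormLE ℓ r b y) : NormLE ℓ r (a + b) (x + y) := by
  refine ⟨add_nonneg ha.1 hb.1, ?_⟩
  rw [ENNReal.ofReal_add ha.1 hb.1]
  exact (weightedNorm_add_le _ a b).trans (add_le_add ha.2 hb.2)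

lemma neg (ha : NormLE ℓ r a x) : NormLE ℓ r (-a) x :=
  ⟨ha.1, (weightedNorm_neg _ (a : G → 𝔸)).trans_le ha.2⟩

lemma sub (ha : NormLE ℓ r a x) (hb : NormLE ℓ r b y) : NormLE ℓ r (a - b) (x + y) := by
  rw [sub_eq_add_neg]; exact ha.add hb.neg

lemma mul (hr : 0 ≤ r) (ha : NormLE ℓ r a x) (hb : NormLE ℓ r b y) :
    NormLE ℓ r (a * b) (x * y) := by
  refine ⟨mul_nonneg ha.1 hb.1, ?_⟩
  rw [ENNReal.ofReal_mul ha.1]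
  exact (weightedNorm_mul_le (expWeight_add_le ℓ hr) a b).trans (mul_le_mul' ha.2 hb.2)

lemma mono (ha : NormLE ℓ r a x) (h : x ≤ y) : NormLE ℓ r a y :=
  ⟨ha.1.trans h, ha.2.trans (ENNReal.ofReal_le_ofReal h)⟩

lemma anti {r' : ℝ} (ha : NormLE ℓ r a x) (h : r' ≤ r) : NormLE ℓ r' a x :=
  ⟨ha.1, (weightedNorm_mono (expWeight_mono ℓ h) _).trans ha.2⟩

lemma norm_le (hr : 0 ≤ r) (ha : NormLE ℓ r a x) : ‖a‖ ≤ x := by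
  have h : weightedNorm 1 a ≤ ENNReal.ofReal x :=
    (weightedNorm_mono (one_le_expWeight ℓ hr) _).trans ha.2
  rw [weightedNorm_one_eq, ← ofReal_norm] at h
  exact (ENNReal.ofReal_le_ofReal_iff ha.1).mp h

lemma diag {c : 𝔸} (h : ‖c‖ ≤ x) : NormLE ℓ r (diag α c) x := by
  refine ⟨(norm_nonneg _).trans h, ?_⟩
  rw [weightedNorm_diag (expWeight_zero ℓ r), ← ofReal_norm]
  exact ENNReal.ofReal_le_ofReal h

lemma one [NormOneClass 𝔸] : NormLE ℓ r (1 : CrossedProduct α) 1 := by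
  rw [one_def]; exact diag norm_one.le

lemma zero : NormLE ℓ r (0 : CrossedProduct α) 0 := by
  refine ⟨le_rfl, ?_⟩
  simp [weightedNorm]

lemma of_sub_one [NormOneClass 𝔸] (h : NormLE ℓ r (a - 1) x) : NormLE ℓ r a (x + 1) := by
  have := h.add (one (ℓ := ℓ) (r := r) (α := α))
  rwa [sub_add_cancel] at this

/-- Weighted balls are closed for unweighted convergence (Fatou). So limits need only be taken in
the `ℓ¹` norm, and the exponential bounds survive. -/
lemma of_tendsto {u : ℕ → CrossedProduct α} (h : Tendsto u atTop (𝓝 a))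
    (hu : ∀ n, NormLE ℓ r (u n) x) : NormLE ℓ r a x :=
  ⟨(hu 0).1, weightedNorm_le_of_tendsto (expWeight_ne_top ℓ r) h fun n => (hu n).2⟩

/-- The inverse is the geometric series, summed in the unweighted norm. The partial sums satisfy
`S_{n+1} = -a S_n + 1`, so the weighted bound `2` propagates because `2f + 1 ≤ 2`. The bound on `g -
1` then comes from `g - 1 = -a g`. -/
lemma exists_inverse [NormOneClass 𝔸] (hr : 0 ≤ r) {f : ℝ} (hf : f ≤ 1 / 2) (ha : NormLE ℓ r a f) :
    ∃ g : CrossedProduct α, (1 + a) * g = 1 ∧ g * (1 + a) = 1 ∧ NormLE ℓ r g 2 ∧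
      NormLE ℓ r (g - 1) (2 * f) := by
  have hn : ‖-a‖ < 1 := by
    rw [norm_neg]; exact (ha.norm_le hr).trans_lt (by linarith)
  have hs : Summable fun n : ℕ => (-a) ^ n := summable_geometric_of_norm_lt_one hn
  set g : CrossedProduct α := ∑' n : ℕ, (-a) ^ n with hg
  have h1 : (1 + a) * g = 1 := by
    have := mul_neg_geom_series (-a) hn
    rwa [sub_neg_eq_add] at this
  have h2 : g * (1 + a) = 1 := by
    have := geom_series_mul_neg (-a) hn
    rwa [sub_neg_eq_add] at this
  have h3 : NormLE ℓ r g 2 := by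
    refine of_tendsto hs.hasSum.tendsto_sum_nat fun n => ?_
    have hS : ∀ n : ℕ, NormLE ℓ r (∑ i ∈ Finset.range n, (-a) ^ i) 2 := by
      intro n
      induction n with
      | zero => simpa using (zero (ℓ := ℓ) (r := r) (α := α)).mono zero_le_two
      | succ n ih =>
        have : ∑ i ∈ Finset.range (n + 1), (-a) ^ i
            = (-a) * ∑ i ∈ Finset.range n, (-a) ^ i + 1 := by
          rw [Finset.sum_range_succ', Finset.mul_sum, pow_zero]
          simp only [pow_succ']
        rw [this]
        exact ((ha.neg.mul hr ih).add one).mono (by linarith)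
    exact hS n
  refine ⟨g, h1, h2, h3, ?_⟩
  have h4 : g - 1 = -(a * g) := by
    have : g + a * g = 1 := by rw [← h1]; noncomm_ring
    rw [← this]; abel
  rw [h4]
  exact (ha.mul hr h3).neg.mono (by linarith)

end NormLE

variable [NormedAlgebra ℝ 𝔸]

/-! ### The derivation and the homological equation. -/

/-- `b` is the image of `a` under the derivation multiplying degree `k` by `lam k`. -/
def IsDeriv (lam : G →+ ℝ) (a b : CrossedProduct α) : Prop := ∀ k, b k = lam k • a k

namespace IsDeriv

variable {lam : G →+ ℝ} {a' b' : CrossedProduct α}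

lemma add (ha : IsDeriv lam a a') (hb : IsDeriv lam b b') : IsDeriv lam (a + b) (a' + b') := by
  intro k; simp [ha k, hb k]

/-- Leibniz rule: `lam m = lam (m - l) + lam l`, and the action, being continuous and additive,
commutes with real scalars. -/
lemma mul (ha : IsDeriv lam a a') (hb : IsDeriv lam b b') :
    IsDeriv lam (a * b) (a' * b + a * b') := by
  intro m
  rw [add_apply, mul_apply, mul_apply, mul_apply, ← (summable_mul a' b m).tsum_add
    (summable_mul a b' m), ← (summable_mul a b m).tsum_const_smul]
  refine tsum_congr fun l => ?_
  rw [ha, hb, map_real_smul (α l) (α.continuous l), smul_mul_assoc, mul_smul_comm, ← add_smul,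
    ← map_add, sub_add_cancel]

lemma diag (c : 𝔸) : IsDeriv lam (diag α c) 0 := by
  intro k
  by_cases hk : k = 0
  · subst hk; simp
  · simp [diag_apply_ne _ hk]

lemma of_tendsto {u u' : ℕ → CrossedProduct α} (h : ∀ n, IsDeriv lam (u n) (u' n))
    (hu : Tendsto u atTop (𝓝 a)) (hu' : Tendsto u' atTop (𝓝 a')) : IsDeriv lam a a' := by
  intro k
  have h1 : Tendsto (fun n => u' n k) atTop (𝓝 (a' k)) := ((continuous_apply k).tendsto a').comp hu'
  have h2 : Tendsto (fun n => lam k • u n k) atTop (𝓝 (lam k • a k)) :=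
    (((continuous_apply k).tendsto a).comp hu).const_smul _
  exact tendsto_nhds_unique (h1.congr fun n => h n k) h2

end IsDeriv

/-- Controls the loss from small divisors: a polynomial factor in `|k|` is absorbed by giving up
width `σ`. It follows from `y ≤ exp y` at `y = σx/p`, raised to the power `p`. -/
lemma rpow_mul_exp_neg_le {p σ x : ℝ} (hp : 0 < p) (hσ : 0 < σ) (hx : 0 ≤ x) :
    x ^ p * Real.exp (-(σ * x)) ≤ (p / σ) ^ p := by
  have h1 : x ≤ (p / σ) * Real.exp (σ * x / p) := by
    have := Real.add_one_le_exp (σ * x / p)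
    calc x = (p / σ) * (σ * x / p) := by field_simp
      _ ≤ _ := by gcongr; linarith
  calc x ^ p * Real.exp (-(σ * x)) ≤ ((p / σ) * Real.exp (σ * x / p)) ^ p * Real.exp (-(σ * x)) := by
        gcongr
    _ = (p / σ) ^ p * (Real.exp (σ * x) * Real.exp (-(σ * x))) := by
        rw [Real.mul_rpow (by positivity) (by positivity), ← Real.exp_mul]
        field_simp
    _ = _ := by rw [← Real.exp_add]; simp

/-- Solution of the homological equation with loss of width `σ`. -/
lemma exists_homological {lam : G →+ ℝ} {ς p σ e : ℝ} (hς : 0 < ς) (hp : 0 < p) (hσ : 0 < σ)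
    (hℓ : ∀ k : G, k ≠ 0 → 0 < ℓ k) (hlam : ∀ k : G, k ≠ 0 → ς / ℓ k ^ p ≤ |lam k|)
    (hr : 0 ≤ r - σ)
    {P : CrossedProduct α} (hP0 : P 0 = 0) (hP : NormLE ℓ r P e) :
    ∃ F : CrossedProduct α, IsDeriv lam F (-P) ∧ NormLE ℓ (r - σ) F ((p / σ) ^ p / ς * e) := by
  have hK : 0 ≤ (p / σ) ^ p / ς := by positivity
  -- Degree `0` causes no trouble: there `lam` vanishes, its inverse is `0` by convention, and `P 0
  -- = 0` makes the equation hold.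
  set Φ : G → 𝔸 := fun k => -((lam k)⁻¹ • P k) with hΦ
  have hle : weightedNorm (expWeight ℓ (r - σ)) Φ ≤ ENNReal.ofReal ((p / σ) ^ p / ς * e) := by
    rw [ENNReal.ofReal_mul hK]
    refine le_trans ?_ (mul_le_mul_right hP.2 _)
    unfold weightedNorm
    rw [← ENNReal.tsum_mul_left]
    refine ENNReal.tsum_le_tsum fun k => ?_
    by_cases hk : k = 0
    · subst hk; simp [hΦ, hP0]
    have hlk := hℓ k hk
    have hlp : 0 < ℓ k ^ p := Real.rpow_pos_of_pos hlk p
    have hpos : 0 < |lam k| := lt_of_lt_of_le (by positivity) (hlam k hk)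
    rw [← ofReal_norm, ← ofReal_norm, expWeight, expWeight, ← ENNReal.ofReal_mul (norm_nonneg _),
      ← ENNReal.ofReal_mul (norm_nonneg _), ← ENNReal.ofReal_mul hK]
    refine ENNReal.ofReal_le_ofReal ?_
    have h1 : ‖Φ k‖ = |lam k|⁻¹ * ‖P k‖ := by
      simp [hΦ, norm_smul]
    have h2 : |lam k|⁻¹ ≤ ℓ k ^ p / ς := by
      rw [inv_le_comm₀ hpos (by positivity), inv_div]
      exact hlam k hk
    have h3 := rpow_mul_exp_neg_le hp hσ hlk.le
    have h4 : Real.exp ((r - σ) * ℓ k) = Real.exp (-(σ * ℓ k)) * Real.exp (r * ℓ k) := by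
      rw [← Real.exp_add]; ring_nf
    rw [h1, h4]
    calc |lam k|⁻¹ * ‖P k‖ * (Real.exp (-(σ * ℓ k)) * Real.exp (r * ℓ k))
        ≤ ℓ k ^ p / ς * ‖P k‖ * (Real.exp (-(σ * ℓ k)) * Real.exp (r * ℓ k)) := by gcongr
      _ = (ℓ k ^ p * Real.exp (-(σ * ℓ k))) / ς * (‖P k‖ * Real.exp (r * ℓ k)) := by ring
      _ ≤ _ := by gcongr
  have h1 : weightedNorm 1 Φ ≠ ∞ :=
    ne_top_of_le_ne_top ENNReal.ofReal_ne_top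
      ((weightedNorm_mono (one_le_expWeight ℓ hr) _).trans hle)
  refine ⟨mk α Φ h1, fun k => ?_, mul_nonneg hK hP.1, hle⟩
  by_cases hk : k = 0
  · subst hk; simp [hP0]
  have hlk := hℓ k hk
  have hlp : 0 < ℓ k ^ p := Real.rpow_pos_of_pos hlk p
  have hpos : 0 < |lam k| := lt_of_lt_of_le (by positivity) (hlam k hk)
  rw [neg_apply, mk_apply, hΦ]
  simp only [smul_neg]
  rw [smul_inv_smul₀ (abs_pos.mp hpos)]

/-- Solution of `⟨Ũ δ U⟩ = g` for `U`, `Ũ` close to `1`. -/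
lemma exists_counterterm [NormOneClass 𝔸] {U U' : CrossedProduct α} (hU : ‖U - 1‖ ≤ 1 / 8)
    (hU' : ‖U' - 1‖ ≤ 1 / 4) (g : 𝔸) :
    ∃ δ : 𝔸, (U' * CrossedProduct.diag α δ * U) 0 = g ∧ ‖δ‖ ≤ 2 * ‖g‖ := by
  let T0 : 𝔸 →+ 𝔸 :=
    { toFun := fun δ => (U' * CrossedProduct.diag α δ * U) 0
      map_zero' := by
        have : CrossedProduct.diag α (0 : 𝔸) = 0 := by
          simpa using CrossedProduct.diag_sub (α := α) (0 : 𝔸) 0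
        simp [this]
      map_add' := fun x y => by rw [diag_add, mul_add, add_mul, add_apply] }
  -- The map `δ ↦ (U' δ U)_0` is within `1/2` of the identity, since `(1/4)(9/8) + 1/8 < 1/2`, hence
  -- invertible by a Neumann series.
  have hest : ∀ δ, ‖δ - T0 δ‖ ≤ 1 / 2 * ‖δ‖ := by
    intro δ
    have h1 : δ - T0 δ = (-((U' - 1) * CrossedProduct.diag α δ * U
        + CrossedProduct.diag α δ * (U - 1))) 0 := by
      have : -((U' - 1) * CrossedProduct.diag α δ * U + CrossedProduct.diag α δ * (U - 1))
          = CrossedProduct.diag α δ - U' * CrossedProduct.diag α δ * U := by noncomm_ring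
      rw [this, sub_apply, diag_apply_zero]
      rfl
    have hUn : ‖U‖ ≤ 9 / 8 := by
      have h1 : ‖(1 : CrossedProduct α)‖ = 1 := by rw [one_def, norm_diag, norm_one]
      calc ‖U‖ = ‖(U - 1) + 1‖ := by rw [sub_add_cancel]
        _ ≤ ‖U - 1‖ + ‖(1 : CrossedProduct α)‖ := norm_add_le _ _
        _ ≤ 9 / 8 := by rw [h1]; linarith
    rw [h1]
    calc _ ≤ _ := norm_apply_le _ _
      _ ≤ ‖(U' - 1) * CrossedProduct.diag α δ * U‖ + ‖CrossedProduct.diag α δ * (U - 1)‖ := by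
          rw [norm_neg]; exact norm_add_le _ _
      _ ≤ ‖U' - 1‖ * ‖δ‖ * ‖U‖ + ‖δ‖ * ‖U - 1‖ := by
          gcongr
          · refine (norm_mul_le _ _).trans ?_
            gcongr
            exact (norm_mul_le _ _).trans_eq (by rw [norm_diag])
          · exact (norm_mul_le _ _).trans_eq (by rw [norm_diag])
      _ ≤ 1 / 4 * ‖δ‖ * (9 / 8) + ‖δ‖ * (1 / 8) := by gcongr
      _ ≤ _ := by nlinarith [norm_nonneg δ]
  have hcont : Continuous T0 := by
    refine AddMonoidHomClass.continuous_of_bound T0 2 fun δ => ?_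
    have h1 := hest δ
    have h2 : ‖T0 δ‖ ≤ ‖δ‖ + ‖δ - T0 δ‖ := by
      calc ‖T0 δ‖ = ‖δ - (δ - T0 δ)‖ := by rw [sub_sub_cancel]
        _ ≤ _ := norm_sub_le _ _
    linarith [norm_nonneg δ]
  -- Additivity and continuity already give real linearity, so inversion can take place among
  -- bounded operators on `𝔸`.
  let T : 𝔸 →L[ℝ] 𝔸 := T0.toRealLinearMap hcont
  have hT : ‖(1 : 𝔸 →L[ℝ] 𝔸) - T‖ < 1 := by
    refine (ContinuousLinearMap.opNorm_le_bound _ (by norm_num) hest).trans_lt (by norm_num)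
  let u := Units.oneSub ((1 : 𝔸 →L[ℝ] 𝔸) - T) hT
  have hu : (u : 𝔸 →L[ℝ] 𝔸) = T := by simp [u]
  refine ⟨(↑u⁻¹ : 𝔸 →L[ℝ] 𝔸) g, ?_, ?_⟩
  · have : (T * ↑u⁻¹ : 𝔸 →L[ℝ] 𝔸) g = g := by rw [← hu, u.mul_inv]; rfl
    exact this
  · set δ := (↑u⁻¹ : 𝔸 →L[ℝ] 𝔸) g
    have hg : T0 δ = g := by
      have : (T * ↑u⁻¹ : 𝔸 →L[ℝ] 𝔸) g = g := by rw [← hu, u.mul_inv]; rfl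
      exact this
    have h1 := hest δ
    have h2 : ‖δ‖ ≤ ‖δ - T0 δ‖ + ‖T0 δ‖ := by
      calc ‖δ‖ = ‖(δ - T0 δ) + T0 δ‖ := by rw [sub_add_cancel]
        _ ≤ _ := norm_add_le _ _
    rw [hg] at h1 h2
    linarith

end CrossedProduct

end

/-! ### The KAM step and its iteration. -/

section

namespace CrossedProduct

variable {G 𝔸 : Type*} [AddCommGroup G] [NormedRing 𝔸] [CompleteSpace 𝔸] [NormOneClass 𝔸]
  [NormedAlgebra ℝ 𝔸] {α : IsometricAction G 𝔸} {ℓ : AddGroupSeminorm G}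

/-- An approximate conjugation: `D U + (V - R) U = U P` with `P` small and of zero mean. -/
structure ApproxConj (lam : G →+ ℝ) (ℓ : AddGroupSeminorm G) (V : CrossedProduct α) (r t e : ℝ)
    (U U' : CrossedProduct α) (R : 𝔸) (P : CrossedProduct α) : Prop where
  mul_inv : U * U' = 1
  inv_mul : U' * U = 1
  norm_sub : NormLE ℓ r (U - 1) (t / 8)
  norm_inv_sub : NormLE ℓ r (U' - 1) (t / 4)
  deriv : IsDeriv lam U (U * P - (V - CrossedProduct.diag α R) * U)
  mean : P 0 = 0
  norm_error : NormLE ℓ r P e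

/-- Newton step. With `DF = -P` and `g = (1 + F)⁻¹`, conjugating `D + P` by `1 + F` leaves `D +
gPF`, which is quadratic in the error up to the small divisor loss. Its degree-`0` part cannot be
removed by the next homological equation, so it is cancelled by changing the counterterm by `δ`,
which contributes `-W' δ W`. The parameter `t` is a budget for the distance of `U` to `1`; each step
spends `16 f` of it. -/
lemma ApproxConj.step {lam : G →+ ℝ} {ς p : ℝ} (hς : 0 < ς) (hp : 0 < p)
    (hℓ : ∀ k : G, k ≠ 0 → 0 < ℓ k) (hlam : ∀ k : G, k ≠ 0 → ς / ℓ k ^ p ≤ |lam k|)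
    {V : CrossedProduct α} {r t e σ f : ℝ} {U U' P : CrossedProduct α} {R : 𝔸}
    (h : ApproxConj lam ℓ V r t e U U' R P) (hσ : 0 < σ) (hr : 0 ≤ r - σ)
    (hf : (p / σ) ^ p / ς * e ≤ f) (hft : t + 16 * f ≤ 1) :
    ∃ (W W' : CrossedProduct α) (S : 𝔸) (Q : CrossedProduct α),
      ApproxConj lam ℓ V (r - σ) (t + 16 * f) (8 * e * f) W W' S Q ∧
      ‖W - U‖ ≤ 2 * f ∧ ‖W' - U'‖ ≤ 3 * f ∧ ‖S - R‖ ≤ 4 * e * f := by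
  obtain ⟨F, hFd, hF⟩ := exists_homological (α := α) hς hp hσ hℓ hlam hr h.mean h.norm_error
  replace hF := hF.mono hf
  have hf0 : 0 ≤ f := hF.1
  have he0 : 0 ≤ e := h.norm_error.1
  have ht0 : 0 ≤ t := by have := h.norm_sub.1; linarith
  have ht1 : t ≤ 1 := by linarith
  have hrr : r - σ ≤ r := by linarith
  obtain ⟨g, hg1, hg2, hg, hg'⟩ := hF.exists_inverse hr (by linarith)
  have hU1 := h.norm_sub.anti hrr
  have hU'1 := h.norm_inv_sub.anti hrr
  have hU : NormLE ℓ (r - σ) U (9 / 8) := hU1.of_sub_one.mono (by linarith)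
  have hU' : NormLE ℓ (r - σ) U' (5 / 4) := hU'1.of_sub_one.mono (by linarith)
  have hWU : NormLE ℓ (r - σ) (U * F) (2 * f) := (hU.mul hr hF).mono (by linarith)
  have hWU' : NormLE ℓ (r - σ) ((g - 1) * U') (3 * f) := (hg'.mul hr hU').mono (by linarith)
  set W := U * (1 + F) with hW
  set W' := g * U' with hW'
  have eW : W = U + U * F := by rw [hW]; noncomm_ring
  have eW' : W' = U' + (g - 1) * U' := by rw [hW']; noncomm_ring
  have hW1 : NormLE ℓ (r - σ) (W - 1) ((t + 16 * f) / 8) := by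
    have : W - 1 = (U - 1) + U * F := by rw [eW]; abel
    rw [this]
    exact (hU1.add hWU).mono (by linarith)
  have hW'1 : NormLE ℓ (r - σ) (W' - 1) ((t + 16 * f) / 4) := by
    have : W' - 1 = (U' - 1) + (g - 1) * U' := by rw [eW']; abel
    rw [this]
    exact (hU'1.add hWU').mono (by linarith)
  have hPF : NormLE ℓ (r - σ) (g * P * F) (2 * e * f) :=
    ((hg.mul hr (h.norm_error.anti hrr)).mul hr hF)
  -- `δ` is chosen so that `W' δ W` has the same degree-`0` part as `gPF`; the new error then has
  -- zero mean.
  obtain ⟨δ, hδ, hδn⟩ := exists_counterterm (α := α) (U := W) (U' := W')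
    ((hW1.norm_le hr).trans (by linarith)) ((hW'1.norm_le hr).trans (by linarith)) ((g * P * F) 0)
  have hδ4 : ‖δ‖ ≤ 4 * e * f := by
    have := (norm_apply_le (g * P * F) 0).trans (hPF.norm_le hr)
    linarith
  have hWinv : W * W' = 1 := by
    calc W * W' = U * ((1 + F) * g) * U' := by rw [hW, hW']; noncomm_ring
      _ = 1 := by rw [hg1, mul_one, h.mul_inv]
  have hWinv' : W' * W = 1 := by
    calc W' * W = g * (U' * U) * (1 + F) := by rw [hW, hW']; noncomm_ring
      _ = 1 := by rw [h.inv_mul, mul_one, hg2]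
  refine ⟨W, W', R + δ, g * P * F - W' * CrossedProduct.diag α δ * W,
    ⟨hWinv, hWinv', hW1, hW'1, ?_, ?_, ?_⟩, ?_, ?_, ?_⟩
  · have hd := h.deriv.add (h.deriv.mul hFd)
    rw [← eW] at hd
    have e1 : W * (g * P * F) = U * P * F := by
      calc W * (g * P * F) = U * ((1 + F) * g) * P * F := by rw [hW]; noncomm_ring
        _ = _ := by rw [hg1, mul_one]
    have e2 : W * (W' * CrossedProduct.diag α δ * W) = CrossedProduct.diag α δ * W := by
      calc _ = W * W' * CrossedProduct.diag α δ * W := by noncomm_ring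
        _ = _ := by rw [hWinv, one_mul]
    have e3 : W * (g * P * F - W' * CrossedProduct.diag α δ * W)
        - (V - CrossedProduct.diag α (R + δ)) * W
        = U * P - (V - CrossedProduct.diag α R) * U +
          ((U * P - (V - CrossedProduct.diag α R) * U) * F + U * -P) := by
      rw [mul_sub, e1, e2, diag_add, eW]
      noncomm_ring
    rw [e3]
    exact hd
  · rw [sub_apply, hδ, sub_self]
  · have h1 : NormLE ℓ (r - σ) W (9 / 8) := hW1.of_sub_one.mono (by linarith)
    have h2 : NormLE ℓ (r - σ) W' (5 / 4) := hW'1.of_sub_one.mono (by linarith)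
    have h3 := hPF.sub ((h2.mul hr (NormLE.diag hδ4)).mul hr h1)
    -- The total is `2ef + (5/4)(4ef)(9/8) = (61/8) ef`, below `8ef`.
    refine h3.mono ?_
    nlinarith [mul_nonneg he0 hf0]
  · have : W - U = U * F := by rw [eW]; abel
    rw [this]
    exact hWU.norm_le hr
  · have : W' - U' = (g - 1) * U' := by rw [eW']; abel
    rw [this]
    exact hWU'.norm_le hr
  · rw [add_sub_cancel_left]; exact hδ4

/-- The iteration starts from `U = 1` with counterterm the mean of `V`; dropping one degree does not
increase the weighted norm. -/
lemma approxConj_init {lam : G →+ ℝ} {V : CrossedProduct α} {ρ e : ℝ} (hV : NormLE ℓ ρ V e) :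
    ApproxConj lam ℓ V ρ 0 e 1 1 (V 0) (V - CrossedProduct.diag α (V 0)) where
  mul_inv := mul_one 1
  inv_mul := mul_one 1
  norm_sub := by simpa using NormLE.zero
  norm_inv_sub := by simpa using NormLE.zero
  deriv := by
    rw [one_mul, mul_one, sub_self, one_def]
    exact IsDeriv.diag 1
  mean := by simp
  norm_error := by
    refine ⟨hV.1, le_trans (ENNReal.tsum_le_tsum fun k => ?_) hV.2⟩
    by_cases hk : k = 0
    · subst hk; simp
    · rw [sub_apply, diag_apply_ne _ hk, sub_zero]

/-- Smallness threshold of the scheme. -/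
def kamThreshold (ρ p ς : ℝ) : ℝ := (2 : ℝ) ^ (-(p + 1)) * ς / (32 * (4 * p / ρ) ^ p)

lemma kamThreshold_pos {ρ p ς : ℝ} (hρ : 0 < ρ) (hp : 0 < p) (hς : 0 < ς) :
    0 < kamThreshold ρ p ς := by
  unfold kamThreshold; positivity

lemma cauchy_limit {X : Type*} [NormedAddCommGroup X] [CompleteSpace X] {u : ℕ → X} {C : ℝ}
    (h : ∀ n, ‖u (n + 1) - u n‖ ≤ C * (1 / 2) ^ n) : ∃ a, Tendsto u atTop (𝓝 a) ∧ ‖a - u 0‖ ≤ 2 * C := by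
  have h' : ∀ n, dist (u n) (u (n + 1)) ≤ C * (1 / 2) ^ n := fun n => by
    rw [dist_comm, dist_eq_norm]; exact h n
  obtain ⟨a, ha⟩ := cauchySeq_tendsto_of_complete (cauchySeq_of_le_geometric _ C (by norm_num) h')
  refine ⟨a, ha, ?_⟩
  have := dist_le_of_le_geometric_of_tendsto₀ _ C (by norm_num) h' ha
  rw [← dist_eq_norm, dist_comm]
  refine this.trans_eq ?_
  ring

/-- The counterterm theorem: `D U + (V - R) U = 0` has a solution with `U` close to `1`. -/
theorem exists_conjugation {lam : G →+ ℝ} {ς p ρ e : ℝ} (hς : 0 < ς) (hp : 0 < p) (hρ : 0 < ρ)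
    (hℓ : ∀ k : G, k ≠ 0 → 0 < ℓ k) (hlam : ∀ k : G, k ≠ 0 → ς / ℓ k ^ p ≤ |lam k|)
    {V : CrossedProduct α} (hV : NormLE ℓ ρ V e) (he : e ≤ kamThreshold ρ p ς) :
    ∃ (U U' : CrossedProduct α) (R : 𝔸), U * U' = 1 ∧ U' * U = 1 ∧
      NormLE ℓ (ρ / 2) (U - 1) (1 / 8) ∧ NormLE ℓ (ρ / 2) (U' - 1) (1 / 4) ∧
      IsDeriv lam U (-((V - CrossedProduct.diag α R) * U)) ∧ ‖R‖ ≤ 2 * e := by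
  -- `θ` is the geometric rate of the errors. The widths `σ_n = (ρ/4) 2⁻ⁿ` make the small divisor
  -- constant grow like `2^{np}`, and `2^{np} θⁿ = 2⁻ⁿ` keeps the corrections summable. Geometric
  -- decay suffices; the quadratic gain is used only to secure the factor `θ` at each step.
  set θ : ℝ := (2 : ℝ) ^ (-(p + 1)) with hθ
  set K : ℝ := (4 * p / ρ) ^ p / ς with hK
  have hθ0 : 0 < θ := by positivity
  have hK0 : 0 < K := by positivity
  have he0 : 0 ≤ e := hV.1
  have hKe : K * e ≤ θ / 32 := by
    have h1 : K * kamThreshold ρ p ς = θ / 32 := by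
      have : (4 * p / ρ) ^ p ≠ 0 := by positivity
      rw [hK, kamThreshold, hθ]; field_simp
    rw [← h1]; gcongr
  have hθ1 : θ ≤ 1 / 2 := by
    have h1 : (2 : ℝ) ^ (-(p + 1)) ≤ (2 : ℝ) ^ (-1 : ℝ) :=
      Real.rpow_le_rpow_of_exponent_le (by norm_num) (by linarith)
    rw [Real.rpow_neg_one] at h1
    rw [hθ]; linarith
  -- Widths decrease from `ρ` to `ρ/2`; the budget `1 - 2⁻ⁿ` of the distance to `1` never exceeds
  -- `1`.
  let r : ℕ → ℝ := fun n => ρ / 2 + ρ / 2 * (1 / 2) ^ n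
  let Inv : ℕ → CrossedProduct α × CrossedProduct α × 𝔸 × CrossedProduct α → Prop := fun n x =>
    ApproxConj lam ℓ V (r n) (1 - (1 / 2) ^ n) (e * θ ^ n) x.1 x.2.1 x.2.2.1 x.2.2.2
  have hstep : ∀ n x, Inv n x → ∃ y, Inv (n + 1) y ∧ ‖y.1 - x.1‖ ≤ (1 / 16) * (1 / 2) ^ n ∧
      ‖y.2.1 - x.2.1‖ ≤ (1 / 8) * (1 / 2) ^ n ∧ ‖y.2.2.1 - x.2.2.1‖ ≤ e / 2 * (1 / 2) ^ n := by
    intro n x hx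
    have hpow : (0 : ℝ) < (1 / 2) ^ n := by positivity
    set σ : ℝ := ρ / 4 * (1 / 2) ^ n with hσ
    have hσ0 : 0 < σ := by positivity
    have hrσ : r n - σ = r (n + 1) := by
      simp only [r, hσ, pow_succ]; ring
    have hf : (p / σ) ^ p / ς * (e * θ ^ n) = K * e * (1 / 2) ^ n := by
      have h1 : p / σ = (4 * p / ρ) * 2 ^ n := by
        rw [hσ, one_div, inv_pow]; field_simp
      have h2 : ((2 : ℝ) ^ n) ^ p * θ ^ n = (1 / 2) ^ n := by
        rw [hθ, ← Real.rpow_natCast, ← Real.rpow_mul (by norm_num), ← Real.rpow_natCast,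
          ← Real.rpow_mul (by norm_num), ← Real.rpow_add (by norm_num), one_div, inv_pow,
          ← Real.rpow_natCast, ← Real.rpow_neg (by norm_num)]
        congr 1; ring
      rw [h1, Real.mul_rpow (by positivity) (by positivity), ← h2, hK]
      ring
    have hKe1 : K * e * (1 / 2) ^ n ≤ (1 / 32) * (1 / 2) ^ n := by
      gcongr; linarith
    have hKe2 : K * e * (1 / 2) ^ n ≤ θ / 32 := by
      refine le_trans ?_ hKe
      exact mul_le_of_le_one_right (by positivity) (pow_le_one₀ (by norm_num) (by norm_num))
    have hθn : θ ^ n ≤ 1 := pow_le_one₀ hθ0.le (by linarith)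
    have hr0 : 0 ≤ r n - σ := by rw [hrσ]; positivity
    have hle : 1 - (1 / 2 : ℝ) ^ n + 16 * (K * e * (1 / 2) ^ n) ≤ 1 - (1 / 2) ^ (n + 1) := by
      rw [pow_succ]; linarith
    obtain ⟨W, W', S, Q, hA, h1, h2, h3⟩ := hx.step hς hp hℓ hlam hσ0 hr0 hf.le
      (hle.trans (by have : (0 : ℝ) < (1 / 2) ^ (n + 1) := by positivity
                     linarith))
    refine ⟨(W, W', S, Q), ?_, ?_, ?_, ?_⟩
    · rw [hrσ] at hA
      -- The new error is at most `8 e_n f_n` with `f_n ≤ θ/32`, hence at most `θ e_n / 4`.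
      refine ⟨hA.mul_inv, hA.inv_mul, hA.norm_sub.mono (by gcongr), hA.norm_inv_sub.mono (by gcongr),
        hA.deriv, hA.mean, hA.norm_error.mono ?_⟩
      calc 8 * (e * θ ^ n) * (K * e * (1 / 2) ^ n) ≤ 8 * (e * θ ^ n) * (θ / 32) := by gcongr
        _ ≤ e * θ ^ (n + 1) := by
          rw [pow_succ]; nlinarith [mul_nonneg (mul_nonneg he0 (pow_nonneg hθ0.le n)) hθ0.le]
    · exact h1.trans (by linarith)
    · exact h2.trans (by linarith)
    · refine h3.trans ?_
      calc 4 * (e * θ ^ n) * (K * e * (1 / 2) ^ n) ≤ 4 * (e * 1) * ((1 / 32) * (1 / 2) ^ n) := by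
            gcongr
        _ ≤ _ := by nlinarith [mul_nonneg he0 hpow.le]
  choose! nxt hnxt using hstep
  let x : ℕ → CrossedProduct α × CrossedProduct α × 𝔸 × CrossedProduct α := fun n =>
    Nat.rec (1, 1, V 0, V - CrossedProduct.diag α (V 0)) (fun n y => nxt n y) n
  have hx0 : x 0 = (1, 1, V 0, V - CrossedProduct.diag α (V 0)) := rfl
  have hxs : ∀ n, x (n + 1) = nxt n (x n) := fun n => rfl
  have hInv : ∀ n, Inv n (x n) := by
    intro n
    induction n with
    | zero =>
      have h0 := approxConj_init (lam := lam) hV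
      have hr0 : r 0 = ρ := by simp [r]
      simp only [Inv, hx0, hr0, pow_zero, sub_self, mul_one]
      exact h0
    | succ n ih => rw [hxs]; exact (hnxt n _ ih).1
  obtain ⟨U, hU, -⟩ := cauchy_limit (u := fun n => (x n).1) fun n => by
    rw [hxs]; exact (hnxt n _ (hInv n)).2.1
  obtain ⟨U', hU', -⟩ := cauchy_limit (u := fun n => (x n).2.1) fun n => by
    rw [hxs]; exact (hnxt n _ (hInv n)).2.2.1
  obtain ⟨R, hR, hR0⟩ := cauchy_limit (u := fun n => (x n).2.2.1) fun n => by
    rw [hxs]; exact (hnxt n _ (hInv n)).2.2.2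
  -- The errors vanish in the limit, so the approximate equation becomes the exact one.
  have hP : Tendsto (fun n => (x n).2.2.2) atTop (𝓝 0) := by
    have h1 : Tendsto (fun n => e * θ ^ n) atTop (𝓝 (e * 0)) :=
      (tendsto_pow_atTop_nhds_zero_of_lt_one hθ0.le (by linarith)).const_mul e
    rw [mul_zero] at h1
    exact squeeze_zero_norm (fun n => (hInv n).norm_error.norm_le (by positivity)) h1
  have hdiag : Tendsto (fun n => CrossedProduct.diag α (x n).2.2.1) atTop
      (𝓝 (CrossedProduct.diag α R)) := by
    rw [tendsto_iff_norm_sub_tendsto_zero] at hR ⊢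
    simpa only [← diag_sub, norm_diag] using hR
  have hrn : ∀ n, ρ / 2 ≤ r n := fun n => by
    have : 0 ≤ ρ / 2 * (1 / 2) ^ n := by positivity
    simp only [r]; linarith
  have hpn : ∀ n : ℕ, (0 : ℝ) ≤ (1 / 2) ^ n := fun n => by positivity
  refine ⟨U, U', R, ?_, ?_, ?_, ?_, ?_, ?_⟩
  · refine tendsto_nhds_unique (hU.mul hU') ?_
    exact tendsto_const_nhds.congr fun n => (hInv n).mul_inv.symm
  · refine tendsto_nhds_unique (hU'.mul hU) ?_
    exact tendsto_const_nhds.congr fun n => (hInv n).inv_mul.symm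
  · exact NormLE.of_tendsto (hU.sub_const 1) fun n =>
      ((hInv n).norm_sub.anti (hrn n)).mono (by linarith [hpn n])
  · exact NormLE.of_tendsto (hU'.sub_const 1) fun n =>
      ((hInv n).norm_inv_sub.anti (hrn n)).mono (by linarith [hpn n])
  · refine IsDeriv.of_tendsto (fun n => (hInv n).deriv) hU ?_
    have := (hU.mul hP).sub ((hdiag.const_sub V).mul hU)
    rwa [mul_zero, zero_sub] at this
  -- The initial counterterm contributes `e`, and so does the sum of the increments `(e/2) 2⁻ⁿ`.
  -- This is the origin of the constant `2`.
  · have h1 : ‖V 0‖ ≤ e := (norm_apply_le V 0).trans (hV.norm_le hρ.le)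
    have h2 : ‖R‖ ≤ ‖R - (x 0).2.2.1‖ + ‖V 0‖ := by
      calc ‖R‖ = ‖(R - V 0) + V 0‖ := by rw [sub_add_cancel]
        _ ≤ _ := norm_add_le _ _
    linarith

end CrossedProduct

end

section

/-! ### The Banach algebra of constants plus Fourier transforms with exponential weight -/

section Kernel

variable {d : ℕ}

/-- The kernel `exp (-s |η|) exp (i η · ξ)`. -/
def kernel (s : ℝ) (ξ η : E d) : ℂ :=
  (Real.exp (-(s * ‖η‖)) : ℂ) * Complex.exp (Complex.I * (inner ℝ η ξ : ℝ))

lemma norm_cexp_I_mul (x : ℝ) : ‖Complex.exp (Complex.I * (x : ℂ))‖ = 1 := by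
  rw [mul_comm]; exact Complex.norm_exp_ofReal_mul_I x

lemma norm_kernel (s : ℝ) (ξ η : E d) : ‖kernel s ξ η‖ = Real.exp (-(s * ‖η‖)) := by
  rw [kernel, norm_mul, norm_cexp_I_mul, mul_one, Complex.norm_real,
    Real.norm_of_nonneg (Real.exp_pos _).le]

lemma continuous_kernel (s : ℝ) (ξ : E d) : Continuous (kernel s ξ) := by
  unfold kernel; fun_prop

variable {s : ℝ}

lemma norm_kernel_le_one (hs : 0 < s) (ξ η : E d) : ‖kernel s ξ η‖ ≤ 1 := by
  rw [norm_kernel, Real.exp_le_one_iff]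
  have := norm_nonneg η
  nlinarith

lemma integrable_kernel_mul (hs : 0 < s) (ξ : E d) {g : E d → ℂ} (hg : Integrable g) :
    Integrable fun η => kernel s ξ η * g η :=
  hg.bdd_mul (c := 1) (continuous_kernel s ξ).aestronglyMeasurable
    (Eventually.of_forall (norm_kernel_le_one hs ξ))

lemma norm_integral_kernel_mul_le (hs : 0 < s) (ξ : E d) {g : E d → ℂ} (hg : Integrable g) :
    ‖∫ η, kernel s ξ η * g η‖ ≤ ∫ η, ‖g η‖ := by
  refine norm_integral_le_of_norm_le hg.norm (Eventually.of_forall fun η => ?_)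
  rw [norm_mul]
  exact mul_le_of_le_one_left (norm_nonneg _) (norm_kernel_le_one hs ξ η)

/-- A product of two transforms is the transform of a weighted convolution, with a submultiplicative
`L¹` bound. -/
lemma exists_weighted_convolution (hs : 0 < s) {g g' : E d → ℂ} (hg : Integrable g)
    (hg' : Integrable g') : ∃ k : E d → ℂ, Integrable k ∧
      (∀ ξ, ∫ η, kernel s ξ η * k η = (∫ η, kernel s ξ η * g η) * ∫ η, kernel s ξ η * g' η) ∧
      ∫ η, ‖k η‖ ≤ (∫ η, ‖g η‖) * ∫ η, ‖g' η‖ := by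
  let L := ContinuousLinearMap.mul ℝ ℂ
  let LR := ContinuousLinearMap.mul ℝ ℝ
  -- At `ξ = 0` the kernel is the bare weight `exp (-s|η|)`.
  have hH : Integrable fun η => kernel s 0 η * g η := integrable_kernel_mul hs 0 hg
  have hH' : Integrable fun η => kernel s 0 η * g' η := integrable_kernel_mul hs 0 hg'
  have hconv := hH.integrable_convolution L hH'
  set C : E d → ℂ := convolution (fun η => kernel s 0 η * g η) (fun η => kernel s 0 η * g' η) L
    volume with hC
  have hCR := hg.norm.integrable_convolution LR hg'.norm
  -- The triangle inequality `|η| ≤ |t| + |η - t|` says that the exponential weight is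
  -- submultiplicative, so the reweighted convolution is dominated by the convolution of `|g|` and
  -- `|g'|`.
  have hle : ∀ᵐ η : E d, ‖(Real.exp (s * ‖η‖) : ℂ) * C η‖ ≤
      convolution (fun η => ‖g η‖) (fun η => ‖g' η‖) LR volume η := by
    filter_upwards [hg.norm.ae_convolution_exists LR hg'.norm] with η hη
    rw [norm_mul, Complex.norm_real, Real.norm_of_nonneg (Real.exp_pos _).le, hC, convolution_def,
      convolution_def, ← le_div_iff₀' (Real.exp_pos _), div_eq_mul_inv, ← Real.exp_neg,
      ← integral_mul_const]
    refine norm_integral_le_of_norm_le (hη.integrable.mul_const _) (Eventually.of_forall fun t => ?_)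
    simp only [L, LR, ContinuousLinearMap.mul_apply', norm_mul, norm_kernel]
    have h1 : Real.exp (-(s * ‖t‖)) * Real.exp (-(s * ‖η - t‖)) ≤ Real.exp (-(s * ‖η‖)) := by
      rw [← Real.exp_add, Real.exp_le_exp]
      have : ‖η‖ ≤ ‖t‖ + ‖η - t‖ := by
        calc ‖η‖ = ‖t + (η - t)‖ := by rw [add_sub_cancel]
          _ ≤ _ := norm_add_le _ _
      nlinarith
    calc _ = (Real.exp (-(s * ‖t‖)) * Real.exp (-(s * ‖η - t‖))) * (‖g t‖ * ‖g' (η - t)‖) := by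
          ring
      _ ≤ Real.exp (-(s * ‖η‖)) * (‖g t‖ * ‖g' (η - t)‖) := by gcongr
      _ = _ := by ring
  have hmeas : AEStronglyMeasurable (fun η : E d => (Real.exp (s * ‖η‖) : ℂ) * C η) := by
    refine AEStronglyMeasurable.mul ?_ hconv.aestronglyMeasurable
    exact (by fun_prop : Continuous fun η : E d => (Real.exp (s * ‖η‖) : ℂ)).aestronglyMeasurable
  refine ⟨fun η => (Real.exp (s * ‖η‖) : ℂ) * C η, hCR.mono' hmeas hle, fun ξ => ?_, ?_⟩
  · have h1 := integral_convolution (μ := (volume : Measure (E d))) (ν := volume) L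
      (integrable_kernel_mul hs ξ hg) (integrable_kernel_mul hs ξ hg')
    refine Eq.trans (integral_congr_ae (Eventually.of_forall fun η => ?_)) h1
    simp only [hC, convolution_def, L, ContinuousLinearMap.mul_apply']
    have h2 : kernel s ξ η * (Real.exp (s * ‖η‖) : ℂ) = Complex.exp (Complex.I * (inner ℝ η ξ : ℝ)) := by
      rw [kernel, mul_right_comm, ← Complex.ofReal_mul, ← Real.exp_add]
      simp
    rw [← mul_assoc, h2, ← integral_const_mul]
    refine integral_congr_ae (Eventually.of_forall fun t => ?_)
    have h3 : Complex.exp (Complex.I * (inner ℝ η ξ : ℝ)) = Complex.exp (Complex.I * (inner ℝ t ξ : ℝ))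
        * Complex.exp (Complex.I * (inner ℝ (η - t) ξ : ℝ)) := by
      rw [← Complex.exp_add, inner_sub_left]
      congr 1; push_cast; ring
    simp only [kernel, inner_zero_right, Complex.ofReal_zero, mul_zero, Complex.exp_zero, mul_one]
    rw [h3]; ring
  · calc _ ≤ ∫ η, convolution (fun η => ‖g η‖) (fun η => ‖g' η‖) LR volume η :=
          integral_mono_ae (hCR.mono' hmeas hle).norm hCR hle
      _ = _ := integral_convolution (μ := (volume : Measure (E d))) (ν := volume) LR hg.norm hg'.norm

end Kernel

/-! ### The symbol algebra as a quotient of representing pairs. -/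

/-- Pairs of a constant and an integrable function. -/
abbrev PreSymb (d : ℕ) : Type := WithLp 1 (ℂ × (E d →₁[volume] ℂ))

section PreSymb

variable {d : ℕ} (s : ℝ) [hs : Fact (0 < s)]

/-- Evaluation at `ξ` of the function represented by a pair. -/
def evalPre (ξ : E d) : PreSymb d →L[ℂ] ℂ :=
  LinearMap.mkContinuous
    { toFun := fun x => x.fst + ∫ η, kernel s ξ η * x.snd η
      map_add' := fun x y => by
        have h : ∫ η, kernel s ξ η * (x.snd + y.snd : E d →₁[volume] ℂ) η
            = (∫ η, kernel s ξ η * x.snd η) + ∫ η, kernel s ξ η * y.snd η := by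
          rw [← integral_add (integrable_kernel_mul hs.out ξ (L1.integrable_coeFn _))
            (integrable_kernel_mul hs.out ξ (L1.integrable_coeFn _))]
          refine integral_congr_ae ?_
          filter_upwards [Lp.coeFn_add x.snd y.snd] with η hη
          rw [hη, Pi.add_apply, mul_add]
        rw [WithLp.add_fst, WithLp.add_snd, h]; ring
      map_smul' := fun c x => by
        have h : ∫ η, kernel s ξ η * (c • x.snd : E d →₁[volume] ℂ) η
            = c * ∫ η, kernel s ξ η * x.snd η := by
          rw [← integral_const_mul]
          refine integral_congr_ae ?_
          filter_upwards [Lp.coeFn_smul c x.snd] with η hη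
          rw [hη, Pi.smul_apply, smul_eq_mul]; ring
        rw [WithLp.smul_fst, WithLp.smul_snd, h]; simp [mul_add] } 1 fun x => by
      rw [one_mul, WithLp.prod_norm_eq_of_L1, L1.norm_eq_integral_norm]
      exact (norm_add_le _ _).trans
        (add_le_add le_rfl (norm_integral_kernel_mul_le hs.out ξ (L1.integrable_coeFn _)))

lemma evalPre_apply (ξ : E d) (x : PreSymb d) :
    evalPre s ξ x = x.fst + ∫ η, kernel s ξ η * x.snd η := rfl

/-- The pairs representing the zero function. -/
def nullSymb (d : ℕ) : Submodule ℂ (PreSymb d) := ⨅ ξ, (evalPre s ξ).ker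

lemma mem_nullSymb {x : PreSymb d} : x ∈ nullSymb s d ↔ ∀ ξ, evalPre s ξ x = 0 := by
  simp [nullSymb]

instance isClosed_nullSymb : IsClosed (nullSymb s d : Set (PreSymb d)) := by
  have : (nullSymb s d : Set (PreSymb d)) = ⋂ ξ, (evalPre s ξ) ⁻¹' {0} := by
    ext x; simp [mem_nullSymb]
  rw [this]
  exact isClosed_iInter fun ξ => isClosed_singleton.preimage (evalPre s ξ).continuous

end PreSymb

/-- The Banach algebra of functions `c + f` on `ℝᵈ` with `c` constant and `‖f‖_{𝒜_s} < ∞`. -/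
def Symb (d : ℕ) (s : ℝ) [Fact (0 < s)] : Type := PreSymb d ⧸ nullSymb s d

namespace Symb

variable {d : ℕ} {s : ℝ} [hs : Fact (0 < s)]

instance : NormedAddCommGroup (Symb d s) :=
  inferInstanceAs (NormedAddCommGroup (PreSymb d ⧸ nullSymb s d))

instance : NormedSpace ℝ (Symb d s) :=
  inferInstanceAs (NormedSpace ℝ (PreSymb d ⧸ nullSymb s d))

instance : CompleteSpace (Symb d s) :=
  inferInstanceAs (CompleteSpace (PreSymb d ⧸ nullSymb s d))

/-- The function represented by an element. -/
def evalLinear (ξ : E d) : (PreSymb d ⧸ nullSymb s d) →ₗ[ℂ] ℂ :=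
  (nullSymb s d).liftQ (evalPre s ξ).toLinearMap fun _ hx => (mem_nullSymb s).mp hx ξ

instance : FunLike (Symb d s) (E d) ℂ where
  coe a ξ := evalLinear ξ (show PreSymb d ⧸ nullSymb s d from a)
  -- Passing to the quotient makes elements genuine functions: two pairs with the same values differ
  -- by a null pair. All algebraic identities can then be checked pointwise, without Fourier
  -- inversion.
  coe_injective a b h := by
    obtain ⟨x, rfl⟩ := Submodule.Quotient.mk_surjective _ (show PreSymb d ⧸ nullSymb s d from a)
    obtain ⟨y, rfl⟩ := Submodule.Quotient.mk_surjective _ (show PreSymb d ⧸ nullSymb s d from b)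
    refine (Submodule.Quotient.eq _).mpr ((mem_nullSymb s).mpr fun ξ => ?_)
    have := congrFun h ξ
    rw [map_sub, sub_eq_zero]
    exact this

@[ext] lemma ext {a b : Symb d s} (h : ∀ ξ, a ξ = b ξ) : a = b := DFunLike.ext _ _ h

@[simp] lemma add_apply (a b : Symb d s) (ξ : E d) : (a + b) ξ = a ξ + b ξ :=
  map_add (evalLinear (s := s) ξ) a b
@[simp] lemma neg_apply (a : Symb d s) (ξ : E d) : (-a) ξ = -a ξ := map_neg (evalLinear (s := s) ξ) a
@[simp] lemma sub_apply (a b : Symb d s) (ξ : E d) : (a - b) ξ = a ξ - b ξ :=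
  map_sub (evalLinear (s := s) ξ) a b
@[simp] lemma zero_apply (ξ : E d) : (0 : Symb d s) ξ = 0 := map_zero (evalLinear (s := s) ξ)
@[simp] lemma smul_apply (c : ℝ) (a : Symb d s) (ξ : E d) : (c • a) ξ = c * a ξ := by
  have : (c • a : Symb d s) ξ = c • a ξ := by
    obtain ⟨x, rfl⟩ := Submodule.Quotient.mk_surjective _ (show PreSymb d ⧸ nullSymb s d from a)
    exact (evalPre s ξ).toLinearMap.map_smul_of_tower c x
  rw [this, Complex.real_smul]

lemma exists_of_rep (c : ℂ) {g : E d → ℂ} (hg : Integrable g) :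
    ∃ a : Symb d s, (∀ ξ, a ξ = c + ∫ η, kernel s ξ η * g η) ∧ ‖a‖ ≤ ‖c‖ + ∫ η, ‖g η‖ := by
  let x : PreSymb d := WithLp.toLp 1 (c, hg.toL1 g)
  refine ⟨(Submodule.Quotient.mk x : PreSymb d ⧸ nullSymb s d), fun ξ => ?_, ?_⟩
  · change evalPre s ξ x = _
    rw [evalPre_apply]
    congr 1
    refine integral_congr_ae ?_
    filter_upwards [hg.coeFn_toL1] with η hη
    exact congrArg _ hη
  · refine (Submodule.Quotient.norm_mk_le _ x).trans ?_
    rw [WithLp.prod_norm_eq_of_L1]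
    exact add_le_add le_rfl (L1.norm_of_fun_eq_integral_norm hg).le

/-- The quotient norm is an infimum over representatives that need not be attained, hence the margin
`ε`. -/
lemma exists_rep (a : Symb d s) {ε : ℝ} (hε : 0 < ε) :
    ∃ (c : ℂ) (g : E d → ℂ), Integrable g ∧ (∀ ξ, a ξ = c + ∫ η, kernel s ξ η * g η) ∧
      ‖c‖ + ∫ η, ‖g η‖ < ‖a‖ + ε := by
  obtain ⟨x, rfl, hx⟩ := Submodule.Quotient.norm_mk_lt (show PreSymb d ⧸ nullSymb s d from a) hε
  refine ⟨x.fst, x.snd, L1.integrable_coeFn _, fun ξ => rfl, ?_⟩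
  rw [WithLp.prod_norm_eq_of_L1, L1.norm_eq_integral_norm] at hx
  exact hx

lemma norm_apply_le (a : Symb d s) (ξ : E d) : ‖a ξ‖ ≤ ‖a‖ := by
  refine le_of_forall_pos_lt_add fun ε hε => ?_
  obtain ⟨c, g, hg, h, hn⟩ := a.exists_rep hε
  rw [h ξ]
  exact ((norm_add_le _ _).trans
    (add_le_add le_rfl (norm_integral_kernel_mul_le hs.out ξ hg))).trans_lt hn

lemma norm_cexp_sub_le (x y : ℝ) :
    ‖Complex.exp (Complex.I * (x : ℂ)) - Complex.exp (Complex.I * (y : ℂ))‖ ≤ |x - y| := by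
  have h := Real.norm_exp_I_mul_ofReal_sub_one_le (x := x - y)
  have h2 : Complex.exp (Complex.I * (x : ℂ)) - Complex.exp (Complex.I * (y : ℂ))
      = Complex.exp (Complex.I * (y : ℂ)) * (Complex.exp (Complex.I * ((x - y : ℝ) : ℂ)) - 1) := by
    rw [mul_sub, ← Complex.exp_add, mul_one]; congr 2; push_cast; ring
  rw [h2, norm_mul, norm_cexp_I_mul, one_mul]
  exact h

/-- Differentiating the phase costs a factor `|η|`, and `s|η| exp (-s|η|) ≤ 1` pays for it. This
Lipschitz bound is what makes the correlations of eigenfunctions small with `ħ`. -/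
lemma norm_sub_apply_le (a : Symb d s) (ξ ξ' : E d) : ‖a ξ - a ξ'‖ ≤ ‖a‖ * (‖ξ - ξ'‖ / s) := by
  have hs0 := hs.out
  by_cases hξ : ‖ξ - ξ'‖ = 0
  · rw [norm_sub_eq_zero_iff] at hξ; simp [hξ]
  have hpos : 0 < ‖ξ - ξ'‖ / s := div_pos (lt_of_le_of_ne (norm_nonneg _) (Ne.symm hξ)) hs0
  rw [← div_le_iff₀ hpos]
  refine le_of_forall_pos_lt_add fun ε hε => ?_
  obtain ⟨c, g, hg, h, hn⟩ := a.exists_rep hε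
  refine lt_of_le_of_lt ?_ (lt_of_le_of_lt (le_add_of_nonneg_left (norm_nonneg c)) hn)
  rw [div_le_iff₀ hpos, h ξ, h ξ', add_sub_add_left_eq_sub,
    ← integral_sub (integrable_kernel_mul hs0 ξ hg) (integrable_kernel_mul hs0 ξ' hg),
    ← integral_mul_const]
  refine norm_integral_le_of_norm_le (hg.norm.mul_const _) (Eventually.of_forall fun η => ?_)
  rw [← sub_mul, norm_mul, mul_comm]
  refine mul_le_mul_of_nonneg_left ?_ (norm_nonneg _)
  have h1 : kernel s ξ η - kernel s ξ' η = (Real.exp (-(s * ‖η‖)) : ℂ) *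
      (Complex.exp (Complex.I * (inner ℝ η ξ : ℝ)) - Complex.exp (Complex.I * (inner ℝ η ξ' : ℝ))) := by
    simp only [kernel]; ring
  rw [h1, norm_mul, Complex.norm_real, Real.norm_of_nonneg (Real.exp_pos _).le]
  have h2 := norm_cexp_sub_le (inner ℝ η ξ) (inner ℝ η ξ')
  have h3 : |inner ℝ η ξ - inner ℝ η ξ'| ≤ ‖η‖ * ‖ξ - ξ'‖ := by
    rw [← inner_sub_right]; exact abs_real_inner_le_norm _ _
  have h4 : Real.exp (-(s * ‖η‖)) * (s * ‖η‖) ≤ 1 := by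
    rw [Real.exp_neg, inv_mul_le_iff₀ (Real.exp_pos _)]
    linarith [Real.add_one_le_exp (s * ‖η‖)]
  calc _ ≤ Real.exp (-(s * ‖η‖)) * (‖η‖ * ‖ξ - ξ'‖) := by gcongr; exact h2.trans h3
    _ = Real.exp (-(s * ‖η‖)) * (s * ‖η‖) * (‖ξ - ξ'‖ / s) := by field_simp
    _ ≤ 1 * (‖ξ - ξ'‖ / s) := by gcongr
    _ = _ := one_mul _

/-- Multiply representatives and use the weighted convolution for the product of the non-constant
parts. The product is determined as a function, so the same element serves for every `ε`, and `ε →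
0` gives submultiplicativity with constant `1`. -/
lemma exists_mul (a b : Symb d s) : ∃ c : Symb d s, (∀ ξ, c ξ = a ξ * b ξ) ∧ ‖c‖ ≤ ‖a‖ * ‖b‖ := by
  have key : ∀ ε : ℝ, 0 < ε → ∃ c : Symb d s, (∀ ξ, c ξ = a ξ * b ξ) ∧
      ‖c‖ ≤ (‖a‖ + ε) * (‖b‖ + ε) := by
    intro ε hε
    obtain ⟨p, g, hg, hga, hgn⟩ := a.exists_rep hε
    obtain ⟨q, k, hk, hkb, hkn⟩ := b.exists_rep hε
    obtain ⟨m, hm, hmk, hmn⟩ := exists_weighted_convolution hs.out hg hk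
    have hint : Integrable fun η => p * k η + q * g η + m η :=
      ((hk.const_mul p).add (hg.const_mul q)).add hm
    obtain ⟨c, hc, hcn⟩ := exists_of_rep (s := s) (p * q) hint
    refine ⟨c, fun ξ => ?_, hcn.trans ?_⟩
    · have h1 : ∫ η, kernel s ξ η * (p * k η + q * g η + m η) =
          p * (∫ η, kernel s ξ η * k η) + q * (∫ η, kernel s ξ η * g η) +
            ∫ η, kernel s ξ η * m η := by
        rw [← integral_const_mul, ← integral_const_mul, ← integral_add, ← integral_add]
        · refine integral_congr_ae (Eventually.of_forall fun η => ?_)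
          simp only; ring
        · exact ((integrable_kernel_mul hs.out ξ hk).const_mul p).add
            ((integrable_kernel_mul hs.out ξ hg).const_mul q)
        · exact integrable_kernel_mul hs.out ξ hm
        · exact (integrable_kernel_mul hs.out ξ hk).const_mul p
        · exact (integrable_kernel_mul hs.out ξ hg).const_mul q
      rw [hc, hga, hkb, h1, hmk]; ring
    · have h2 : ∫ η, ‖p * k η + q * g η + m η‖ ≤ ‖p‖ * (∫ η, ‖k η‖) + ‖q‖ * (∫ η, ‖g η‖)
          + ∫ η, ‖m η‖ := by
        rw [← integral_const_mul, ← integral_const_mul, ← integral_add, ← integral_add]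
        · refine integral_mono hint.norm (((hk.norm.const_mul _).add (hg.norm.const_mul _)).add
            hm.norm) fun η => ?_
          refine (norm_add₃_le).trans ?_
          simp only [norm_mul]; rfl
        · exact (hk.norm.const_mul _).add (hg.norm.const_mul _)
        · exact hm.norm
        · exact hk.norm.const_mul _
        · exact hg.norm.const_mul _
      have h3 : 0 ≤ ∫ η, ‖g η‖ := integral_nonneg fun _ => norm_nonneg _
      have h4 : 0 ≤ ∫ η, ‖k η‖ := integral_nonneg fun _ => norm_nonneg _
      calc _ ≤ (‖p‖ + ∫ η, ‖g η‖) * (‖q‖ + ∫ η, ‖k η‖) := by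
            rw [norm_mul]; nlinarith
        _ ≤ _ := by gcongr
  obtain ⟨c, hc, -⟩ := key 1 one_pos
  refine ⟨c, hc, ?_⟩
  have hlim : Tendsto (fun ε : ℝ => (‖a‖ + ε) * (‖b‖ + ε)) (𝓝[>] 0) (𝓝 (‖a‖ * ‖b‖)) := by
    have : Tendsto (fun ε : ℝ => (‖a‖ + ε) * (‖b‖ + ε)) (𝓝 0) (𝓝 ((‖a‖ + 0) * (‖b‖ + 0))) :=
      (by fun_prop : Continuous fun ε : ℝ => (‖a‖ + ε) * (‖b‖ + ε)).tendsto 0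
    rw [add_zero, add_zero] at this
    exact this.mono_left nhdsWithin_le_nhds
  refine ge_of_tendsto hlim ?_
  filter_upwards [self_mem_nhdsWithin] with ε hε
  obtain ⟨c', hc', hn⟩ := key ε hε
  have : c = c' := ext fun ξ => by rw [hc, hc']
  rw [this]; exact hn

instance : Mul (Symb d s) := ⟨fun a b => (exists_mul a b).choose⟩

@[simp] lemma mul_apply (a b : Symb d s) (ξ : E d) : (a * b) ξ = a ξ * b ξ :=
  (exists_mul a b).choose_spec.1 ξ

lemma exists_one : ∃ a : Symb d s, (∀ ξ, a ξ = 1) ∧ ‖a‖ ≤ 1 := by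
  obtain ⟨a, ha, hn⟩ := exists_of_rep (s := s) (d := d) 1 (integrable_zero _ _ _)
  exact ⟨a, fun ξ => by simpa using ha ξ, by simpa using hn⟩

instance : One (Symb d s) := ⟨exists_one.choose⟩

@[simp] lemma one_apply (ξ : E d) : (1 : Symb d s) ξ = 1 := exists_one.choose_spec.1 ξ

instance : NormedRing (Symb d s) :=
  { (inferInstance : NormedAddCommGroup (Symb d s)) with
    mul := (· * ·)
    one := 1
    left_distrib := fun a b c => by
      change a * (b + c) = a * b + a * c
      ext ξ; simp [mul_add]
    right_distrib := fun a b c => by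
      change (a + b) * c = a * c + b * c
      ext ξ; simp [add_mul]
    zero_mul := fun a => by
      change 0 * a = 0
      ext ξ; simp
    mul_zero := fun a => by
      change a * 0 = 0
      ext ξ; simp
    mul_assoc := fun a b c => by
      change a * b * c = a * (b * c)
      ext ξ; simp [mul_assoc]
    one_mul := fun a => by
      change 1 * a = a
      ext ξ; simp
    mul_one := fun a => by
      change a * 1 = a
      ext ξ; simp
    norm_mul_le := fun a b => (exists_mul a b).choose_spec.2 }

instance : NormOneClass (Symb d s) where
  norm_one := le_antisymm exists_one.choose_spec.2 (by
    have := norm_apply_le (1 : Symb d s) 0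
    rwa [one_apply, norm_one] at this)

instance : NormedAlgebra ℝ (Symb d s) :=
  { Algebra.ofModule (fun c a b => by ext ξ; simp [mul_assoc])
      (fun c a b => by ext ξ; simp [mul_left_comm]) with
    norm_smul_le := fun c a => norm_smul_le c a }

/-- A translation multiplies the density `g` by the phase `exp (iη·v)`, of modulus one, hence does
not change norms. -/
lemma exists_translate (v : E d) (a : Symb d s) :
    ∃ b : Symb d s, (∀ ξ, b ξ = a (ξ + v)) ∧ ‖b‖ ≤ ‖a‖ := by
  have key : ∀ ε : ℝ, 0 < ε → ∃ b : Symb d s, (∀ ξ, b ξ = a (ξ + v)) ∧ ‖b‖ ≤ ‖a‖ + ε := by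
    intro ε hε
    obtain ⟨p, g, hg, hga, hgn⟩ := a.exists_rep hε
    have hg' : Integrable fun η : E d => Complex.exp (Complex.I * (inner ℝ η v : ℝ)) * g η :=
      hg.bdd_mul (c := 1) (by fun_prop : Continuous fun η : E d =>
        Complex.exp (Complex.I * (inner ℝ η v : ℝ))).aestronglyMeasurable
        (Eventually.of_forall fun η => (norm_cexp_I_mul _).le)
    obtain ⟨b, hb, hbn⟩ := exists_of_rep (s := s) p hg'
    refine ⟨b, fun ξ => ?_, hbn.trans ?_⟩
    · rw [hb, hga]
      congr 1
      refine integral_congr_ae (Eventually.of_forall fun η => ?_)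
      simp only [kernel, inner_add_right, Complex.ofReal_add, mul_add, Complex.exp_add]
      ring
    · simp only [norm_mul, norm_cexp_I_mul, one_mul]
      exact hgn.le
  obtain ⟨b, hb, -⟩ := key 1 one_pos
  refine ⟨b, hb, le_of_forall_pos_le_add fun ε hε => ?_⟩
  obtain ⟨b', hb', hn⟩ := key ε hε
  have : b = b' := ext fun ξ => by rw [hb, hb']
  rw [this]; exact hn

/-- Translation `a ↦ a(· + v)`. -/
def translate (v : E d) : Symb d s →+* Symb d s where
  toFun a := (exists_translate v a).choose
  map_one' := by ext ξ; rw [(exists_translate v _).choose_spec.1]; simp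
  map_mul' a b := by
    ext ξ
    rw [(exists_translate v _).choose_spec.1, mul_apply, mul_apply,
      (exists_translate v a).choose_spec.1, (exists_translate v b).choose_spec.1]
  map_zero' := by ext ξ; rw [(exists_translate v _).choose_spec.1]; simp
  map_add' a b := by
    ext ξ
    rw [(exists_translate v _).choose_spec.1, add_apply, add_apply,
      (exists_translate v a).choose_spec.1, (exists_translate v b).choose_spec.1]

@[simp] lemma translate_apply (v : E d) (a : Symb d s) (ξ : E d) : translate v a ξ = a (ξ + v) :=
  (exists_translate v a).choose_spec.1 ξ

lemma norm_translate (v : E d) (a : Symb d s) : ‖translate v a‖ = ‖a‖ := by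
  refine le_antisymm (exists_translate v a).choose_spec.2 ?_
  have h : a = translate (-v) (translate v a) := by ext ξ; simp
  conv_lhs => rw [h]
  exact (exists_translate (-v) _).choose_spec.2

end Symb

lemma intVec_add {d : ℕ} (k l : Fin d → ℤ) : intVec (k + l) = intVec k + intVec l := by
  ext i; simp [intVec]

lemma intVec_zero {d : ℕ} : intVec (0 : Fin d → ℤ) = 0 := by
  ext i; simp [intVec]

lemma intVec_neg {d : ℕ} (k : Fin d → ℤ) : intVec (-k) = -intVec k := by
  ext i; simp [intVec]

lemma intVec_sub {d : ℕ} (k l : Fin d → ℤ) : intVec (k - l) = intVec k - intVec l := by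
  rw [sub_eq_add_neg, intVec_add, intVec_neg, sub_eq_add_neg]

lemma intVec_eq_zero {d : ℕ} {k : Fin d → ℤ} : intVec k = 0 ↔ k = 0 := by
  refine ⟨fun h => ?_, fun h => by rw [h, intVec_zero]⟩
  ext i
  have := congrArg (fun v : E d => v i) h
  simpa [intVec] using this

/-- The action of `ℤᵈ` on symbols by `a ↦ a(· + ħ l)`. -/
def shiftAction (d : ℕ) (s : ℝ) [Fact (0 < s)] (ħ : ℝ) : IsometricAction (Fin d → ℤ) (Symb d s) where
  toFun l := Symb.translate (ħ • intVec l)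
  map_zero a := by ext ξ; simp [intVec_zero]
  map_add k l a := by
    ext ξ
    simp only [Symb.translate_apply, intVec_add, smul_add, add_assoc]
  norm_map k a := Symb.norm_translate _ a

@[simp] lemma shiftAction_apply {d : ℕ} {s : ℝ} [Fact (0 < s)] (ħ : ℝ) (l : Fin d → ℤ) (a : Symb d s)
    (ξ : E d) : shiftAction d s ħ l a ξ = a (ξ + ħ • intVec l) := Symb.translate_apply _ a ξ

end

section

namespace Symb

variable {d : ℕ} {s : ℝ} [hs : Fact (0 < s)]

/-! ### Comparison with the norm of `𝒜_s` -/

lemma exists_of_isFourierTransform {f h : E d → ℂ} (hf : IsFourierTransform f h)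
    (hw : ENNReal.ofReal (normConst d) * ∫⁻ η, ‖h η‖ₑ * ENNReal.ofReal (Real.exp (s * ‖η‖)) ≠ ∞) :
    ∃ a : Symb d s, (∀ ξ, a ξ = f ξ) ∧ ‖a‖ₑ ≤
      ENNReal.ofReal (normConst d) * ∫⁻ η, ‖h η‖ₑ * ENNReal.ofReal (Real.exp (s * ‖η‖)) := by
  have hc := normConst_pos d
  set g : E d → ℂ := fun η => ((normConst d * Real.exp (s * ‖η‖) : ℝ) : ℂ) * h η with hg
  have hmeas : AEStronglyMeasurable g := by
    refine AEStronglyMeasurable.mul ?_ hf.1.aestronglyMeasurable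
    exact (by fun_prop : Continuous fun η : E d =>
      ((normConst d * Real.exp (s * ‖η‖) : ℝ) : ℂ)).aestronglyMeasurable
  have henorm : ∫⁻ η, ‖g η‖ₑ =
      ENNReal.ofReal (normConst d) * ∫⁻ η, ‖h η‖ₑ * ENNReal.ofReal (Real.exp (s * ‖η‖)) := by
    rw [← lintegral_const_mul' _ _ ENNReal.ofReal_ne_top]
    refine lintegral_congr fun η => ?_
    have h1 : ‖((normConst d * Real.exp (s * ‖η‖) : ℝ) : ℂ)‖ₑ
        = ENNReal.ofReal (normConst d) * ENNReal.ofReal (Real.exp (s * ‖η‖)) := by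
      rw [← ofReal_norm, Complex.norm_real, Real.norm_of_nonneg (by positivity),
        ENNReal.ofReal_mul hc.le]
    rw [hg, enorm_mul, h1]; ring
  have hgi : Integrable g := ⟨hmeas, by
    rw [HasFiniteIntegral, henorm]; exact lt_top_iff_ne_top.mpr hw⟩
  obtain ⟨a, ha, han⟩ := exists_of_rep (s := s) 0 hgi
  refine ⟨a, fun ξ => ?_, ?_⟩
  · rw [ha, zero_add, hf.2 ξ, ← integral_const_mul]
    refine integral_congr_ae (Eventually.of_forall fun η => ?_)
    have h1 : (Real.exp (-(s * ‖η‖)) : ℂ) * (Real.exp (s * ‖η‖) : ℂ) = 1 := by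
      rw [← Complex.ofReal_mul, ← Real.exp_add]; simp
    simp only [kernel, hg, Complex.ofReal_mul]
    linear_combination ((normConst d : ℂ) * h η *
      Complex.exp (Complex.I * (inner ℝ η ξ : ℝ))) * h1
  · rw [← henorm, ← ofReal_integral_norm_eq_lintegral_enorm hgi, ← ofReal_norm]
    exact ENNReal.ofReal_le_ofReal (by simpa using han)

/-- Every Fourier transform of finite weighted norm yields an element of the algebra, and all these
elements coincide because they are equal as functions. So the norm is below the infimum. -/
lemma exists_of_normA {f : E d → ℂ} (hf : normA s f ≠ ∞) :
    ∃ a : Symb d s, (∀ ξ, a ξ = f ξ) ∧ ‖a‖ₑ ≤ normA s f ∧ ∃ h, IsFourierTransform f h := by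
  have h1 : ∃ h, IsFourierTransform f h ∧ ENNReal.ofReal (normConst d) *
      ∫⁻ η, ‖h η‖ₑ * ENNReal.ofReal (Real.exp (s * ‖η‖)) ≠ ∞ := by
    by_contra hcon
    push Not at hcon
    exact hf (iInf_eq_top.mpr fun h => iInf_eq_top.mpr fun hh => hcon h hh)
  obtain ⟨h, hh, hw⟩ := h1
  obtain ⟨a, ha, -⟩ := exists_of_isFourierTransform hh hw
  refine ⟨a, ha, le_iInf fun h' => le_iInf fun hh' => ?_, h, hh⟩
  by_cases hw' : ENNReal.ofReal (normConst d) *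
      ∫⁻ η, ‖h' η‖ₑ * ENNReal.ofReal (Real.exp (s * ‖η‖)) = ∞
  · rw [hw']; exact le_top
  · obtain ⟨a', ha', han'⟩ := exists_of_isFourierTransform hh' hw'
    have : a = a' := ext fun ξ => by rw [ha, ha']
    rw [this]; exact han'

/-- Riemann–Lebesgue lemma. -/
lemma tendsto_integral_cexp_cocompact (h : E d → ℂ) :
    Tendsto (fun ξ : E d => ∫ η, Complex.exp (Complex.I * (inner ℝ η ξ : ℝ)) * h η)
      (cocompact (E d)) (𝓝 0) := by
  have h1 := tendsto_integral_exp_inner_smul_cocompact h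
  have hc : (-(2 * Real.pi)⁻¹ : ℝ) ≠ 0 := neg_ne_zero.mpr (inv_ne_zero Real.two_pi_pos.ne')
  have h2 : Tendsto (fun ξ : E d => (-(2 * Real.pi)⁻¹ : ℝ) • ξ) (cocompact (E d)) (cocompact (E d)) :=
    (Homeomorph.smulOfNeZero _ hc).isClosedEmbedding.tendsto_cocompact
  refine (h1.comp h2).congr fun ξ => integral_congr_ae (Eventually.of_forall fun η => ?_)
  simp only [Circle.smul_def, smul_eq_mul, Real.fourierChar_apply, inner_smul_right]
  congr 2
  have : Real.pi ≠ 0 := Real.pi_ne_zero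
  have h3 : 2 * Real.pi * -(-(2 * Real.pi)⁻¹ * inner ℝ η ξ) = inner ℝ η ξ := by
    field_simp
  rw [h3, mul_comm]

lemma tendsto_cocompact_of_isFourierTransform {f h : E d → ℂ} (hf : IsFourierTransform f h) :
    Tendsto f (cocompact (E d)) (𝓝 0) := by
  have := (tendsto_integral_cexp_cocompact h).const_mul (normConst d : ℂ)
  rw [mul_zero] at this
  refine this.congr fun ξ => ?_
  rw [hf.2 ξ]
  simp only [mul_comm (h _)]

lemma tendsto_integral_kernel_cocompact (g : E d → ℂ) :
    Tendsto (fun ξ : E d => ∫ η, kernel s ξ η * g η) (cocompact (E d)) (𝓝 0) := by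
  refine (tendsto_integral_cexp_cocompact fun η => (Real.exp (-(s * ‖η‖)) : ℂ) * g η).congr
    fun ξ => integral_congr_ae (Eventually.of_forall fun η => ?_)
  simp only [kernel]; ring

/-- By the Riemann–Lebesgue lemma the constant in a representation is the limit at infinity. If the
function vanishes there, the representation has no constant part and is a Fourier transform after
reweighting. -/
lemma normA_le [NeZero d] (a : Symb d s) (ha : Tendsto a (cocompact (E d)) (𝓝 0)) :
    normA s a ≤ ‖a‖ₑ := by
  have hc := normConst_pos d
  rw [← ofReal_norm]
  refine ENNReal.le_of_forall_pos_le_add fun ε hε _ => ?_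
  obtain ⟨c, g, hg, h, hn⟩ := a.exists_rep (ε := ε) (by exact_mod_cast hε)
  -- In dimension `0` the space is compact, and decay at infinity would say nothing about the
  -- constant.
  have : Nontrivial (E d) := by
    refine ⟨⟨0, EuclideanSpace.single 0 1, fun h => ?_⟩⟩
    have := congrArg (fun v : E d => v 0) h
    simp at this
  have hc0 : c = 0 := by
    have h1 : Tendsto a (cocompact (E d)) (𝓝 (c + 0)) := by
      have := (tendsto_integral_kernel_cocompact (s := s) g).const_add c
      exact this.congr fun ξ => (h ξ).symm
    rw [add_zero] at h1
    exact tendsto_nhds_unique h1 ha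
  have hcc : ((normConst d)⁻¹ : ℝ) * normConst d = 1 := inv_mul_cancel₀ hc.ne'
  set k : E d → ℂ := fun η => (((normConst d)⁻¹ : ℝ) : ℂ) * ((Real.exp (-(s * ‖η‖)) : ℂ) * g η)
  have hk : Integrable k := by
    have := (integrable_kernel_mul hs.out 0 hg).const_mul (((normConst d)⁻¹ : ℝ) : ℂ)
    refine this.congr (Eventually.of_forall fun η => ?_)
    simp [kernel, k]
  have hft : IsFourierTransform a k := by
    refine ⟨hk, fun ξ => ?_⟩
    rw [h, hc0, zero_add, ← integral_const_mul]
    refine integral_congr_ae (Eventually.of_forall fun η => ?_)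
    simp only [kernel, k]
    have : (((normConst d)⁻¹ : ℝ) : ℂ) * (normConst d : ℂ) = 1 := by
      rw [← Complex.ofReal_mul, hcc, Complex.ofReal_one]
    linear_combination (-(Real.exp (-(s * ‖η‖)) : ℂ) * g η *
      Complex.exp (Complex.I * (inner ℝ η ξ : ℝ))) * this
  refine (iInf₂_le k hft).trans ?_
  have he : ENNReal.ofReal (normConst d) * ∫⁻ η, ‖k η‖ₑ * ENNReal.ofReal (Real.exp (s * ‖η‖))
      = ∫⁻ η, ‖g η‖ₑ := by
    rw [← lintegral_const_mul' _ _ ENNReal.ofReal_ne_top]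
    refine lintegral_congr fun η => ?_
    rw [← ofReal_norm, ← ofReal_norm, ← ENNReal.ofReal_mul (norm_nonneg _),
      ← ENNReal.ofReal_mul hc.le]
    congr 1
    simp only [k, norm_mul, Complex.norm_real, Real.norm_of_nonneg (Real.exp_pos _).le,
      Real.norm_of_nonneg (inv_pos.mpr hc).le]
    have h1 : Real.exp (-(s * ‖η‖)) * Real.exp (s * ‖η‖) = 1 := by
      rw [← Real.exp_add]; simp
    linear_combination (Real.exp (-(s * ‖η‖)) * Real.exp (s * ‖η‖) * ‖g η‖) * hcc + ‖g η‖ * h1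
  rw [he, ← ofReal_integral_norm_eq_lintegral_enorm hg, ← ENNReal.ofReal_coe_nnreal,
    ← ENNReal.ofReal_add (norm_nonneg a) ε.coe_nonneg]
  refine ENNReal.ofReal_le_ofReal ?_
  rw [hc0, norm_zero, zero_add] at hn
  exact hn.le

/-! ### Analyticity -/

/-- The `n`-th Taylor term is obtained under the integral sign; `(s|η|)ⁿ/n! ≤ exp (s|η|)` bounds it
by `s⁻ⁿ` times the `L¹` norm. -/
lemma exists_taylorTerm {g : E d → ℂ} (hg : Integrable g) (ξ₀ : E d) (n : ℕ) :
    ∃ p : ContinuousMultilinearMap ℝ (fun _ : Fin n => E d) ℂ,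
      ‖p‖ ≤ (∫ η, ‖g η‖) * (s⁻¹) ^ n ∧ ∀ y, p (fun _ => y) =
        ∫ η, kernel s ξ₀ η * g η * ((Complex.I * (inner ℝ η y : ℝ)) ^ n / n.factorial) := by
  let M : E d → MultilinearMap ℝ (fun _ : Fin n => E d) ℝ := fun η =>
    (MultilinearMap.mkPiAlgebra ℝ (Fin n) ℝ).compLinearMap fun _ => (innerSL ℝ η).toLinearMap
  have hM : ∀ η y, M η y = ∏ i, inner ℝ η (y i) := fun η y => by simp [M]
  have hle : ∀ η y, ‖kernel s ξ₀ η * g η * (Complex.I ^ n / n.factorial) * (M η y : ℂ)‖ ≤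
      ‖g η‖ * ((s⁻¹) ^ n * ∏ i, ‖y i‖) := fun η y => by
    have hs0 := hs.out
    have hsn : 0 ≤ s * ‖η‖ := mul_nonneg hs0.le (norm_nonneg _)
    have h1 : ‖(M η y : ℂ)‖ ≤ ‖η‖ ^ n * ∏ i, ‖y i‖ := by
      have h0 : ‖η‖ ^ n = ∏ _i : Fin n, ‖η‖ := by simp
      rw [hM, Complex.norm_real, norm_prod, h0, ← Finset.prod_mul_distrib]
      exact Finset.prod_le_prod (fun _ _ => norm_nonneg _) fun i _ => norm_inner_le_norm _ _
    have h2 : Real.exp (-(s * ‖η‖)) * ((s * ‖η‖) ^ n / n.factorial) ≤ 1 := by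
      rw [Real.exp_neg, inv_mul_le_iff₀ (Real.exp_pos _), mul_one]
      exact Real.pow_div_factorial_le_exp _ hsn n
    have h3 : ‖Complex.I ^ n / (n.factorial : ℂ)‖ = 1 / n.factorial := by simp
    rw [norm_mul, norm_mul, norm_mul, norm_kernel, h3]
    calc _ ≤ Real.exp (-(s * ‖η‖)) * ‖g η‖ * (1 / n.factorial) * (‖η‖ ^ n * ∏ i, ‖y i‖) := by gcongr
      _ = (Real.exp (-(s * ‖η‖)) * ((s * ‖η‖) ^ n / n.factorial)) *
          (‖g η‖ * ((s⁻¹) ^ n * ∏ i, ‖y i‖)) := by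
        rw [mul_pow, inv_pow]; field_simp
      _ ≤ 1 * (‖g η‖ * ((s⁻¹) ^ n * ∏ i, ‖y i‖)) := by
        gcongr
      _ = _ := one_mul _
  have hint : ∀ y, Integrable fun η =>
      kernel s ξ₀ η * g η * (Complex.I ^ n / n.factorial) * (M η y : ℂ) := fun y => by
    refine (hg.norm.mul_const ((s⁻¹) ^ n * ∏ i, ‖y i‖)).mono' ?_ (Eventually.of_forall fun η => hle η y)
    refine (((continuous_kernel s ξ₀).aestronglyMeasurable.mul hg.aestronglyMeasurable).mul_const
      _).mul (Continuous.aestronglyMeasurable ?_)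
    simp only [hM]
    fun_prop
  let T : MultilinearMap ℝ (fun _ : Fin n => E d) ℂ :=
    { toFun := fun y => ∫ η, kernel s ξ₀ η * g η * (Complex.I ^ n / n.factorial) * (M η y : ℂ)
      map_update_add' := fun y i u v => by
        rw [← integral_add (hint _) (hint _)]
        refine integral_congr_ae (Eventually.of_forall fun η => ?_)
        simp only
        rw [(M η).map_update_add, Complex.ofReal_add, mul_add]
      map_update_smul' := fun y i c u => by
        rw [Complex.real_smul, ← integral_const_mul]
        refine integral_congr_ae (Eventually.of_forall fun η => ?_)
        simp only
        rw [(M η).map_update_smul, smul_eq_mul, Complex.ofReal_mul]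
        ring }
  have hT : ∀ y, ‖T y‖ ≤ ((∫ η, ‖g η‖) * (s⁻¹) ^ n) * ∏ i, ‖y i‖ := fun y => by
    rw [mul_assoc, ← integral_mul_const]
    exact norm_integral_le_of_norm_le (hg.norm.mul_const _) (Eventually.of_forall fun η => hle η y)
  refine ⟨T.mkContinuous _ hT, T.mkContinuous_norm_le
    (mul_nonneg (integral_nonneg fun _ => norm_nonneg _) (pow_nonneg (inv_nonneg.mpr hs.out.le) n)) hT,
    fun y => ?_⟩
  have h1 : T.mkContinuous _ hT (fun _ => y) = ∫ η, kernel s ξ₀ η * g η *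
    (Complex.I ^ n / n.factorial) * (M η (fun _ => y) : ℝ) := rfl
  rw [h1]
  refine integral_congr_ae (Eventually.of_forall fun η => ?_)
  simp only [hM, Finset.prod_const, Finset.card_univ, Fintype.card_fin, mul_pow, Complex.ofReal_pow]
  ring

/-- Taylor series at `ξ₀` of the function represented by `g`. -/
def taylorSeries (s : ℝ) [hs : Fact (0 < s)] {g : E d → ℂ} (hg : Integrable g) (ξ₀ : E d) :
    FormalMultilinearSeries ℝ (E d) ℂ := fun n => (exists_taylorTerm (s := s) hg ξ₀ n).choose

lemma norm_taylorSeries_le {g : E d → ℂ} (hg : Integrable g) (ξ₀ : E d) (n : ℕ) :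
    ‖taylorSeries s hg ξ₀ n‖ ≤ (∫ η, ‖g η‖) * (s⁻¹) ^ n :=
  (exists_taylorTerm (s := s) hg ξ₀ n).choose_spec.1

lemma taylorSeries_apply {g : E d → ℂ} (hg : Integrable g) (ξ₀ y : E d) (n : ℕ) :
    taylorSeries s hg ξ₀ n (fun _ => y) =
      ∫ η, kernel s ξ₀ η * g η * ((Complex.I * (inner ℝ η y : ℝ)) ^ n / n.factorial) :=
  (exists_taylorTerm (s := s) hg ξ₀ n).choose_spec.2 y

/-- Expand `exp (iη·y)` and integrate termwise; for `|y| < s` the terms are dominated by the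
geometric series in `|y|/s`. -/
lemma hasFPowerSeriesOnBall {g : E d → ℂ} (hg : Integrable g) (ξ₀ : E d) :
    HasFPowerSeriesOnBall (fun ξ => ∫ η, kernel s ξ η * g η) (taylorSeries s hg ξ₀) ξ₀
      (ENNReal.ofReal s) where
  r_le := by
    refine FormalMultilinearSeries.le_radius_of_bound _ (∫ η, ‖g η‖) fun n => ?_
    have hs0 := hs.out
    rw [Real.coe_toNNReal _ hs0.le]
    calc _ ≤ ((∫ η, ‖g η‖) * (s⁻¹) ^ n) * s ^ n := by
          gcongr; exact norm_taylorSeries_le hg ξ₀ n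
      _ = _ := by rw [mul_assoc, ← mul_pow, inv_mul_cancel₀ hs0.ne', one_pow, mul_one]
  r_pos := ENNReal.ofReal_pos.mpr hs.out
  hasSum := by
    intro y hy
    have hs0 := hs.out
    have hy' : ‖y‖ < s := by
      rw [Metric.mem_eball, edist_zero_right, ← ofReal_norm, ENNReal.ofReal_lt_ofReal_iff hs0] at hy
      exact hy
    simp only [taylorSeries_apply hg]
    set F : ℕ → E d → ℂ := fun n η =>
      kernel s ξ₀ η * g η * ((Complex.I * (inner ℝ η y : ℝ)) ^ n / n.factorial) with hF
    have hbound : ∀ n η, ‖F n η‖ ≤ ‖g η‖ * (‖y‖ / s) ^ n := by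
      intro n η
      have hsn : 0 ≤ s * ‖η‖ := mul_nonneg hs0.le (norm_nonneg _)
      have h2 : Real.exp (-(s * ‖η‖)) * ((s * ‖η‖) ^ n / n.factorial) ≤ 1 := by
        rw [Real.exp_neg, inv_mul_le_iff₀ (Real.exp_pos _), mul_one]
        exact Real.pow_div_factorial_le_exp _ hsn n
      have h3 : ‖(Complex.I * (inner ℝ η y : ℝ)) ^ n / (n.factorial : ℂ)‖
          ≤ (‖η‖ * ‖y‖) ^ n / n.factorial := by
        rw [norm_div, norm_pow, norm_mul, Complex.norm_I, one_mul, Complex.norm_real,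
          Complex.norm_natCast]
        gcongr
        exact norm_inner_le_norm _ _
      rw [hF]
      simp only [norm_mul, norm_kernel]
      calc _ ≤ Real.exp (-(s * ‖η‖)) * ‖g η‖ * ((‖η‖ * ‖y‖) ^ n / n.factorial) := by gcongr
        _ = (Real.exp (-(s * ‖η‖)) * ((s * ‖η‖) ^ n / n.factorial)) * (‖g η‖ * (‖y‖ / s) ^ n) := by
          rw [mul_pow, mul_pow, div_pow]; field_simp
        _ ≤ 1 * (‖g η‖ * (‖y‖ / s) ^ n) := by gcongr
        _ = _ := one_mul _
    have hint : ∀ n, Integrable (F n) := fun n => by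
      refine (hg.norm.mul_const _).mono' ?_ (Eventually.of_forall (hbound n))
      refine ((continuous_kernel s ξ₀).aestronglyMeasurable.mul hg.aestronglyMeasurable).mul ?_
      exact (by fun_prop : Continuous fun η : E d =>
        (Complex.I * (inner ℝ η y : ℝ)) ^ n / (n.factorial : ℂ)).aestronglyMeasurable
    have hsum : Summable fun n => ∫ η, ‖F n η‖ := by
      refine Summable.of_nonneg_of_le (fun n => integral_nonneg fun _ => norm_nonneg _) (fun n => ?_)
        ((summable_geometric_of_lt_one (by positivity)
          ((div_lt_one hs0).mpr hy')).mul_left (∫ η, ‖g η‖))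
      rw [← integral_mul_const]
      exact integral_mono (hint n).norm (hg.norm.mul_const _) (hbound n)
    have h := hasSum_integral_of_summable_integral_norm hint hsum
    convert h using 1
    refine integral_congr_ae (Eventually.of_forall fun η => ?_)
    simp only [hF]
    rw [tsum_mul_left]
    have hexp : ∑' n : ℕ, (Complex.I * (inner ℝ η y : ℝ)) ^ n / (n.factorial : ℂ)
        = Complex.exp (Complex.I * (inner ℝ η y : ℝ)) := by
      rw [Complex.exp_eq_exp_ℂ, NormedSpace.exp_eq_tsum_div]
    rw [hexp]
    simp only [kernel, inner_add_right, Complex.ofReal_add, mul_add, Complex.exp_add]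
    ring

lemma analyticOnNhd (a : Symb d s) : AnalyticOnNhd ℝ a Set.univ := by
  obtain ⟨c, g, hg, h, -⟩ := a.exists_rep one_pos
  have : (a : E d → ℂ) = fun ξ => c + ∫ η, kernel s ξ η * g η := funext h
  rw [this]
  intro ξ₀ _
  exact analyticAt_const.add (hasFPowerSeriesOnBall hg ξ₀).analyticAt

lemma memA [NeZero d] (a : Symb d s) (ha : Tendsto a (cocompact (E d)) (𝓝 0))
    (hre : ∀ ξ, (a ξ).im = 0) : MemA s (fun ξ => (a ξ).re) ∧
      normA s (fun ξ => ((a ξ).re : ℂ)) ≤ ‖a‖ₑ := by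
  have h1 : (fun ξ => ((a ξ).re : ℂ)) = a := by
    funext ξ; exact Complex.ext (by simp) (by simp [hre])
  refine ⟨⟨fun ξ hξ => ?_, ?_⟩, ?_⟩
  · exact (Complex.reCLM.analyticAt _).comp (a.analyticOnNhd ξ hξ)
  · rw [h1]; exact (a.normA_le ha).trans_lt enorm_lt_top
  · rw [h1]; exact a.normA_le ha

end Symb

end

section

/-! ### Fourier series on the torus -/

variable {d : ℕ}

lemma character_zero (x : Torus d) : character (0 : Fin d → ℤ) x = 1 := by simp [character]

lemma character_add (k l : Fin d → ℤ) (x : Torus d) :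
    character (k + l) x = character k x * character l x := by
  simp only [character, Pi.add_apply, fourier_add, Finset.prod_mul_distrib, ContinuousMap.coe_mk]

lemma norm_character (k : Fin d → ℤ) (x : Torus d) : ‖character k x‖ = 1 := by
  simp only [character, ContinuousMap.coe_mk, norm_prod]
  exact Finset.prod_eq_one fun i _ => Circle.norm_coe _

lemma normConst_sq_mul (d : ℕ) : normConst d * normConst d * (2 * Real.pi) ^ d = 1 := by
  have h : (0 : ℝ) < 2 * Real.pi := Real.two_pi_pos
  rw [normConst, ← Real.rpow_add h, ← Real.rpow_natCast, ← Real.rpow_add h]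
  convert Real.rpow_zero _ using 2
  ring

lemma integral_character (k : Fin d → ℤ) :
    ∫ x, character k x = if k = 0 then (((2 * Real.pi) ^ d : ℝ) : ℂ) else 0 := by
  have h1 : ∫ x : Torus d, character k x
      = ∏ i, ∫ t : AddCircle (2 * Real.pi), (fourier (k i) t : ℂ) :=
    integral_fintype_prod_volume_eq_prod fun i (t : AddCircle (2 * Real.pi)) => (fourier (k i) t : ℂ)
  rw [h1]
  split_ifs with hk
  · subst hk
    have h2 : (volume : Measure (AddCircle (2 * Real.pi))).real Set.univ = 2 * Real.pi := by
      rw [Measure.real, AddCircle.measure_univ, ENNReal.toReal_ofReal Real.two_pi_pos.le]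
    simp [h2]
  · obtain ⟨i, hi⟩ := Function.ne_iff.mp hk
    refine Finset.prod_eq_zero (Finset.mem_univ i) ?_
    exact integral_eq_zero_of_add_right_eq_neg (fourier_add_half_inv_index hi Real.two_pi_pos)

lemma coeff_character (k j : Fin d → ℤ) :
    coeff (character k) j = if k = j then (normConst d : ℂ) * ((2 * Real.pi) ^ d : ℝ) else 0 := by
  have : ∀ x : Torus d, character k x * character (-j) x = character (k - j) x := fun x => by
    rw [sub_eq_add_neg, character_add]
  simp only [coeff, this, integral_character, sub_eq_zero]
  split_ifs <;> simp

/-- The normalized exponential `e_k` in `L²(𝕋ᵈ)`. -/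
def expVec (k : Fin d → ℤ) : L2T d :=
  (normConst d : ℂ) • ContinuousMap.toLp (E := ℂ) 2 (volume : Measure (Torus d)) ℂ (character k)

lemma coeff_expVec (k j : Fin d → ℤ) : coeff (expVec k) j = if k = j then 1 else 0 := by
  rw [expVec, coeff_smul, coeff_congr_ae (ContinuousMap.coeFn_toLp (p := 2) (𝕜 := ℂ)
    (volume : Measure (Torus d)) (character k)), coeff_character]
  split_ifs
  · rw [← mul_assoc, ← Complex.ofReal_mul, ← Complex.ofReal_mul, normConst_sq_mul,
      Complex.ofReal_one]
  · rw [mul_zero]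

lemma inner_expVec (k : Fin d → ℤ) (ψ : L2T d) : inner ℂ (expVec k) ψ = coeff ψ k := by
  rw [expVec, inner_smul_left, Complex.conj_ofReal, coeff, L2.inner_def]
  congr 1
  refine integral_congr_ae ?_
  filter_upwards [ContinuousMap.coeFn_toLp (p := 2) (𝕜 := ℂ)
    (volume : Measure (Torus d)) (character k)] with x hx
  rw [hx, character_neg]
  simp

lemma norm_expVec (k : Fin d → ℤ) : ‖expVec k‖ = 1 := by
  have h : inner ℂ (expVec k) (expVec k) = 1 := by rw [inner_expVec, coeff_expVec, if_pos rfl]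
  have h2 : ‖expVec k‖ ^ 2 = 1 := by rw [norm_sq_eq_re_inner (𝕜 := ℂ), h]; simp
  exact (pow_eq_one_iff_of_nonneg (norm_nonneg _) two_ne_zero).mp h2

lemma norm_coeff_le (ψ : L2T d) (k : Fin d → ℤ) : ‖coeff ψ k‖ ≤ ‖ψ‖ := by
  rw [← inner_expVec]
  simpa [norm_expVec] using norm_inner_le_norm (𝕜 := ℂ) (expVec k) ψ

lemma coeff_sub (ψ φ : L2T d) (k : Fin d → ℤ) :
    coeff (ψ - φ : L2T d) k = coeff ψ k - coeff φ k := by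
  rw [← inner_expVec, inner_sub_right, inner_expVec, inner_expVec]

lemma ext_coeff {ψ φ : L2T d} (h : ∀ k, coeff ψ k = coeff φ k) : ψ = φ :=
  sub_eq_zero.mp (eq_zero_of_coeff _ fun k => by rw [coeff_sub, h, sub_self])

/-- The element of `L²(𝕋ᵈ)` with summable Fourier coefficients `c`. -/
def ofCoeff (c : (Fin d → ℤ) → ℂ) : L2T d := ∑' k, c k • expVec k

variable {c : (Fin d → ℤ) → ℂ}

lemma hasSum_ofCoeff (hc : Summable fun k => ‖c k‖) :
    HasSum (fun k => c k • expVec k) (ofCoeff c) := by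
  refine Summable.hasSum (Summable.of_norm ?_)
  simpa [norm_smul, norm_expVec] using hc

lemma coeff_ofCoeff (hc : Summable fun k => ‖c k‖) (j : Fin d → ℤ) : coeff (ofCoeff c) j = c j := by
  have h := (innerSL ℂ (expVec j)).hasSum (hasSum_ofCoeff hc)
  have h2 : (fun k => innerSL ℂ (expVec j) (c k • expVec k)) = fun k => if k = j then c j else 0 := by
    funext k
    rw [innerSL_apply_apply, inner_smul_right, inner_expVec, coeff_expVec]
    split_ifs with h
    · rw [h, mul_one]
    · rw [mul_zero]
  rw [← inner_expVec]
  exact h.unique (h2 ▸ hasSum_ite_eq j (c j))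

lemma ofCoeff_coeff {ψ : L2T d} (h : Summable fun k => ‖coeff ψ k‖) : ofCoeff (coeff ψ) = ψ :=
  ext_coeff (coeff_ofCoeff h)

/-- Parseval's identity, by expanding only `ψ`, whose coefficients are summable; `φ` is any square
integrable function. -/
lemma hasSum_inner (ψ φ : L2T d) (h : Summable fun k => ‖coeff ψ k‖) :
    HasSum (fun k => (starRingEnd ℂ) (coeff ψ k) * coeff φ k) (inner ℂ ψ φ) := by
  have h1 := (hasSum_ofCoeff h)
  rw [ofCoeff_coeff h] at h1
  have h2 := (innerSL ℂ φ).hasSum h1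
  have h3 := h2.map (starRingEnd ℂ) Complex.continuous_conj
  rw [innerSL_apply_apply, inner_conj_symm] at h3
  convert h3 using 1
  funext k
  simp only [Function.comp_apply, innerSL_apply_apply]
  rw [inner_conj_symm, inner_smul_left, inner_expVec]

/-- Multiplication of an `L²` function by a character. -/
lemma exists_character_mul (l : Fin d → ℤ) (ψ : L2T d) :
    ∃ φ : L2T d, (φ : Torus d → ℂ) =ᵐ[volume] fun x => character l x * ψ x := by
  have h : MemLp (fun x => character l x * ψ x) 2 (volume : Measure (Torus d)) := by
    refine (Lp.memLp ψ).of_le ((character l).continuous.aestronglyMeasurable.mul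
      (Lp.memLp ψ).aestronglyMeasurable) (Eventually.of_forall fun x => ?_)
    rw [norm_mul, norm_character, one_mul]
  exact ⟨h.toLp _, h.coeFn_toLp⟩

/-- The integral is the inner product of `ψ` with its product by the character, which shifts the
coefficients by `l`. -/
lemma hasSum_integral_character_mul (l : Fin d → ℤ) (ψ : L2T d) (h : Summable fun k => ‖coeff ψ k‖) :
    HasSum (fun k => (starRingEnd ℂ) (coeff ψ k) * coeff ψ (k - l))
      (∫ x, character l x * ((‖ψ x‖ ^ 2 : ℝ) : ℂ)) := by
  obtain ⟨φ, hφ⟩ := exists_character_mul l ψ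
  have h1 := hasSum_inner ψ φ h
  have h2 : inner ℂ ψ φ = ∫ x, character l x * ((‖ψ x‖ ^ 2 : ℝ) : ℂ) := by
    rw [L2.inner_def]
    refine integral_congr_ae ?_
    filter_upwards [hφ] with x hx
    rw [hx, RCLike.inner_apply, mul_assoc, Complex.mul_conj, Complex.normSq_eq_norm_sq]
  have h3 : ∀ k, coeff φ k = coeff ψ (k - l) := fun k => by
    rw [coeff_congr_ae hφ]
    unfold coeff
    congr 1
    refine integral_congr_ae (Eventually.of_forall fun x => ?_)
    have : -(k - l) = l + -k := by abel
    simp only [this, character_add]; ring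
  rw [h2] at h1
  simpa only [h3] using h1

/-! ### Operators given by matrices -/

variable {M : (Fin d → ℤ) → (Fin d → ℤ) → ℂ}

lemma mem_graph_matrixOp {ψ φ : L2T d} : (ψ, φ) ∈ (matrixOp M).graph ↔
    ∀ j, HasSum (fun k => M j k * coeff ψ k) (coeff φ j) := by
  rw [matrixOp, Submodule.toLinearPMap_graph_eq _ (matrixGraph_functional M)]
  rfl

lemma matrixOp_apply {ψ φ : L2T d} (h : ∀ j, HasSum (fun k => M j k * coeff ψ k) (coeff φ j)) :
    ∃ hψ : ψ ∈ (matrixOp M).domain, matrixOp M ⟨ψ, hψ⟩ = φ := by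
  obtain ⟨y, hy, hφ⟩ := (LinearPMap.mem_graph_iff _).mp (mem_graph_matrixOp.mpr h)
  simp only at hy hφ
  subst hy
  exact ⟨y.2, hφ⟩

lemma hasSum_matrixOp {ψ : L2T d} (hψ : ψ ∈ (matrixOp M).domain) (j : Fin d → ℤ) :
    HasSum (fun k => M j k * coeff ψ k) (coeff (matrixOp M ⟨ψ, hψ⟩) j) :=
  mem_graph_matrixOp.mp ((matrixOp M).mem_graph ⟨ψ, hψ⟩) j

lemma eigenEq_matrixOp {z : ℂ} {ψ : L2T d} : EigenEq (matrixOp M) z ψ ↔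
    ∀ j, HasSum (fun k => M j k * coeff ψ k) (z * coeff ψ j) := by
  constructor
  · rintro ⟨hψ, h⟩ j
    have := hasSum_matrixOp hψ j
    rwa [h, coeff_smul] at this
  · intro h
    exact matrixOp_apply (φ := z • ψ) fun j => by rw [coeff_smul]; exact h j

lemma hasSum_diagonal_mul {m c : (Fin d → ℤ) → ℂ} {j : Fin d → ℤ} {b : ℂ} :
    HasSum (fun k => (if j = k then m k else 0) * c k) b ↔ m j * c j = b := by
  have h : HasSum (fun k => (if j = k then m k else 0) * c k) (m j * c j) := by
    convert hasSum_ite_eq j (m j * c j) using 2 with k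
    by_cases hk : j = k
    · simp [hk]
    · simp [hk, Ne.symm hk]
  exact ⟨fun h' => h.unique h', fun h' => h' ▸ h⟩

lemma eigenEq_Lhat {ω : E d} {ħ : ℝ} {z : ℂ} {ψ : L2T d} : EigenEq (Lhat ω ħ) z ψ ↔
    ∀ j, ((ħ * inner ℝ ω (intVec j) : ℝ) : ℂ) * coeff ψ j = z * coeff ψ j := by
  rw [Lhat, eigenEq_matrixOp]
  exact forall_congr' fun j => hasSum_diagonal_mul

/-- The domain of the sum is the intersection of the maximal domains, so both images of `ψ` must lie
in `L²` separately. -/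
lemma eigenEq_Lhat_add {ω : E d} {ħ : ℝ} {z : ℂ} {ψ : L2T d} :
    EigenEq (Lhat ω ħ + (ħ : ℂ) • matrixOp M) z ψ ↔ ∃ φ₁ φ₂ : L2T d,
      (∀ j, coeff φ₁ j = ((ħ * inner ℝ ω (intVec j) : ℝ) : ℂ) * coeff ψ j) ∧
      (∀ j, HasSum (fun k => M j k * coeff ψ k) (coeff φ₂ j)) ∧ φ₁ + (ħ : ℂ) • φ₂ = z • ψ := by
  constructor
  · rintro ⟨⟨h1, h2⟩, h⟩
    refine ⟨Lhat ω ħ ⟨ψ, h1⟩, matrixOp M ⟨ψ, h2⟩, fun j => ?_, hasSum_matrixOp h2, h⟩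
    exact (hasSum_diagonal_mul.mp (hasSum_matrixOp h1 j)).symm
  · rintro ⟨φ₁, φ₂, h1, h2, h⟩
    obtain ⟨hψ1, e1⟩ := matrixOp_apply (ψ := ψ) (φ := φ₁) fun j =>
      (hasSum_diagonal_mul (m := fun k => ((ħ * inner ℝ ω (intVec k) : ℝ) : ℂ))).mpr (h1 j).symm
    obtain ⟨hψ2, e2⟩ := matrixOp_apply h2
    refine ⟨⟨hψ1, hψ2⟩, ?_⟩
    rw [← h, ← e1, ← e2]
    rfl

end

section

/-! ### Matrices of elements of the crossed product -/

lemma Symb.hasSum_apply {d : ℕ} {s : ℝ} [Fact (0 < s)] {ι : Type*} {f : ι → Symb d s} {a : Symb d s}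
    (h : HasSum f a) (ξ : E d) : HasSum (fun i => f i ξ) (a ξ) := by
  let e : Symb d s →+ ℂ := ⟨⟨fun a => a ξ, zero_apply ξ⟩, fun a b => add_apply a b ξ⟩
  have he : Continuous e := AddMonoidHomClass.continuous_of_bound e 1 fun a => by
    rw [one_mul]; exact norm_apply_le a ξ
  exact h.map e he

/-- A domination by a summable family in one index and bounded row sums in the other; it justifies
the exchanges of summation between `ℓ¹` and `ℓ^∞`. -/
lemma summable_uncurry_of_le {ι κ : Type*} {f : ι → κ → ℂ} {a : ι → ℝ} {b : ι → κ → ℝ} {B : ℝ}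
    (ha : Summable a) (ha0 : ∀ i, 0 ≤ a i) (hb0 : ∀ i j, 0 ≤ b i j) (hb : ∀ i, Summable (b i))
    (hB : ∀ i, ∑' j, b i j ≤ B) (hf : ∀ i j, ‖f i j‖ ≤ a i * b i j) :
    Summable (Function.uncurry f) := by
  refine Summable.of_norm_bounded (g := fun p : ι × κ => a p.1 * b p.1 p.2) ?_ fun p => hf p.1 p.2
  have h0 : (0 : ι × κ → ℝ) ≤ fun p => a p.1 * b p.1 p.2 := by
    intro p
    exact mul_nonneg (ha0 p.1) (hb0 p.1 p.2)
  rw [summable_prod_of_nonneg h0]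
  refine ⟨fun i => (hb i).mul_left (a i), ?_⟩
  refine Summable.of_nonneg_of_le (fun i => tsum_nonneg fun j => mul_nonneg (ha0 i) (hb0 i j))
    (fun i => ?_) (ha.mul_right B)
  simp only [tsum_mul_left]
  exact mul_le_mul_of_nonneg_left (hB i) (ha0 i)

/-- Symmetry of a Hermitian matrix with bounded row sums, between `ℓ¹` and `ℓ^∞`. -/
lemma tsum_conj_mul_symm {ι : Type*} {W : ι → ι → ℂ} (hW : ∀ i j, W i j = (starRingEnd ℂ) (W j i))
    {B C : ℝ} (hWs : ∀ i, Summable fun j => ‖W i j‖) (hWB : ∀ i, ∑' j, ‖W i j‖ ≤ B)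
    {u v : ι → ℂ} (hu : Summable fun i => ‖u i‖) (hv : ∀ i, ‖v i‖ ≤ C) :
    ∑' j, (starRingEnd ℂ) (u j) * ∑' i, W j i * v i =
      ∑' j, (starRingEnd ℂ) (∑' i, W j i * u i) * v j := by
  have hC : ∀ i, 0 ≤ C := fun i => (norm_nonneg _).trans (hv i)
  have hsum : Summable (Function.uncurry fun j i => (starRingEnd ℂ) (u j) * (W j i * v i)) := by
    refine summable_uncurry_of_le (b := fun i j => ‖W i j‖ * C) (B := B * C) hu
      (fun _ => norm_nonneg _) (fun i j => mul_nonneg (norm_nonneg _) (hC i))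
      (fun i => (hWs i).mul_right C) (fun i => ?_) fun j i => ?_
    · rw [tsum_mul_right]
      exact mul_le_mul_of_nonneg_right (hWB i) (hC i)
    · rw [norm_mul, norm_mul, RCLike.norm_conj]
      exact mul_le_mul_of_nonneg_left (mul_le_mul_of_nonneg_left (hv i) (norm_nonneg _))
        (norm_nonneg _)
  calc _ = ∑' j, ∑' i, (starRingEnd ℂ) (u j) * (W j i * v i) := by
        refine tsum_congr fun j => ?_
        rw [tsum_mul_left]
    _ = ∑' i, ∑' j, (starRingEnd ℂ) (u j) * (W j i * v i) :=
        (Summable.tsum_comm hsum).symm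
    _ = _ := by
        refine tsum_congr fun i => ?_
        rw [Complex.conj_tsum, ← tsum_mul_right]
        refine tsum_congr fun j => ?_
        rw [map_mul, hW j i]; ring

variable {d : ℕ} {s : ℝ} [hs : Fact (0 < s)] {ħ : ℝ}

/-- The matrix of a crossed product element at base point `ξ`. -/
def mat (a : CrossedProduct (shiftAction d s ħ)) (ξ : E d) (j k : Fin d → ℤ) : ℂ :=
  a (j - k) (ξ + ħ • intVec k)

section mat

variable (a b : CrossedProduct (shiftAction d s ħ)) (ξ : E d)

lemma norm_mat_le (j k : Fin d → ℤ) : ‖mat a ξ j k‖ ≤ ‖a (j - k)‖ := Symb.norm_apply_le _ _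

lemma summable_mat_row (j : Fin d → ℤ) : Summable fun k => ‖mat a ξ j k‖ :=
  Summable.of_nonneg_of_le (fun _ => norm_nonneg _) (norm_mat_le a ξ j)
    ((Equiv.subLeft j).summable_iff.mpr a.hasSum_norm.summable)

lemma tsum_mat_row_le (j : Fin d → ℤ) : ∑' k, ‖mat a ξ j k‖ ≤ ‖a‖ := by
  have h := (Equiv.subLeft j).hasSum_iff.mpr a.hasSum_norm
  exact ((summable_mat_row a ξ j).tsum_le_tsum (norm_mat_le a ξ j) h.summable).trans_eq h.tsum_eq

lemma summable_mat_col (k : Fin d → ℤ) : Summable fun j => ‖mat a ξ j k‖ :=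
  Summable.of_nonneg_of_le (fun _ => norm_nonneg _) (fun j => norm_mat_le a ξ j k)
    ((Equiv.subRight k).summable_iff.mpr a.hasSum_norm.summable)

lemma tsum_mat_col_le (k : Fin d → ℤ) : ∑' j, ‖mat a ξ j k‖ ≤ ‖a‖ := by
  have h := (Equiv.subRight k).hasSum_iff.mpr a.hasSum_norm
  exact ((summable_mat_col a ξ k).tsum_le_tsum (fun j => norm_mat_le a ξ j k)
    h.summable).trans_eq h.tsum_eq

/-- The twist in the convolution is made for this: the left factor is evaluated at `ξ + ħi = (ξ +
ħk) + ħ(i - k)`. At each base point, passing to matrices turns the twisted product into the matrix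
product. -/
lemma hasSum_mat_mul (j k : Fin d → ℤ) :
    HasSum (fun i => mat a ξ j i * mat b ξ i k) (mat (a * b) ξ j k) := by
  have h := Symb.hasSum_apply (CrossedProduct.summable_mul a b (j - k)).hasSum (ξ + ħ • intVec k)
  rw [← CrossedProduct.mul_apply] at h
  have h2 := (Equiv.subRight k).hasSum_iff.mpr h
  convert h2 using 1
  · funext i
    simp only [Function.comp_apply, Equiv.subRight_apply, Symb.mul_apply, shiftAction_apply, mat]
    congr 2
    · congr 1; abel
    · rw [add_assoc, ← smul_add, ← intVec_add, add_sub_cancel]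
  · rfl

lemma mat_diag (r : Symb d s) (j k : Fin d → ℤ) :
    mat (CrossedProduct.diag (shiftAction d s ħ) r) ξ j k =
      if j = k then r (ξ + ħ • intVec k) else 0 := by
  unfold mat
  split_ifs with h
  · rw [h, sub_self, CrossedProduct.diag_apply_zero]
  · rw [CrossedProduct.diag_apply_ne _ (sub_ne_zero.mpr h), Symb.zero_apply]

lemma mat_one (j k : Fin d → ℤ) :
    mat (1 : CrossedProduct (shiftAction d s ħ)) ξ j k = if j = k then 1 else 0 := by
  rw [CrossedProduct.one_def, mat_diag]; simp

lemma mat_sub (j k : Fin d → ℤ) : mat (a - b) ξ j k = mat a ξ j k - mat b ξ j k := by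
  simp [mat]

lemma mat_neg (j k : Fin d → ℤ) : mat (-a) ξ j k = -mat a ξ j k := by
  simp [mat]

end mat

/-! ### Exact conjugation: reality of the counterterm and eigenvectors. -/

/-- The homomorphism `k ↦ ω · k`. -/
def freq (ω : E d) : (Fin d → ℤ) →+ ℝ where
  toFun k := inner ℝ ω (intVec k)
  map_zero' := by rw [intVec_zero, inner_zero_right]
  map_add' k l := by rw [intVec_add, inner_add_right]

lemma freq_apply (ω : E d) (k : Fin d → ℤ) : freq ω k = inner ℝ ω (intVec k) := rfl

open CrossedProduct in
/-- Exact conjugation of `ω · D + V - R` to `ω · D`, with `V` Hermitian. -/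
structure IsConjugation (ω : E d) (V U U' : CrossedProduct (shiftAction d s ħ)) (R : Symb d s) :
    Prop where
  mul_inv : U * U' = 1
  deriv : IsDeriv (freq ω) U (-((V - diag (shiftAction d s ħ) R) * U))
  norm_sub : ‖U - 1‖ ≤ 1 / 8
  hermitian : ∀ ξ j k, mat V ξ j k = (starRingEnd ℂ) (mat V ξ k j)

namespace IsConjugation

variable {ω : E d} {V U U' : CrossedProduct (shiftAction d s ħ)} {R : Symb d s}

/-- The conjugation equation read columnwise: the `k`-th column of `U` is an eigenvector of `ω·j + V
- R` with eigenvalue `ω·k`. -/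
lemma tsum_mul_col (h : IsConjugation ω V U U' R) (ξ : E d) (j k : Fin d → ℤ) :
    ∑' i, mat V ξ j i * mat U ξ i k =
      ((freq ω k : ℂ) - freq ω j + R (ξ + ħ • intVec j)) * mat U ξ j k := by
  have h1 : mat (-((V - CrossedProduct.diag (shiftAction d s ħ) R) * U)) ξ j k
      = ((freq ω j : ℂ) - freq ω k) * mat U ξ j k := by
    have := congrArg (fun f : Symb d s => f (ξ + ħ • intVec k)) (h.deriv (j - k))
    simp only [Symb.smul_apply, map_sub, Complex.ofReal_sub] at this
    exact this
  rw [mat_neg, sub_mul, mat_sub, (hasSum_mat_mul _ _ ξ j k).tsum_eq.symm] at h1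
  have h2 : mat (CrossedProduct.diag (shiftAction d s ħ) R * U) ξ j k
      = R (ξ + ħ • intVec j) * mat U ξ j k := by
    unfold mat
    rw [CrossedProduct.diag_mul_apply, Symb.mul_apply, shiftAction_apply, add_assoc, ← smul_add,
      ← intVec_add, add_sub_cancel]
  rw [h2] at h1
  linear_combination -h1

lemma bound_col (ξ : E d) (k j : Fin d → ℤ) : ‖mat U ξ j k‖ ≤ ‖U‖ :=
  (norm_mat_le U ξ j k).trans (CrossedProduct.norm_apply_le U _)

/-- Green's identity between a column of `U` and a bounded eigenvector. -/
lemma tsum_green (h : IsConjugation ω V U U' R) (ξ : E d) (k : Fin d → ℤ) {v : (Fin d → ℤ) → ℂ}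
    {C : ℝ} (hvC : ∀ j, ‖v j‖ ≤ C) {ζ : ℂ}
    (hv : ∀ j, ∑' i, mat V ξ j i * v i = (ζ - freq ω j + R (ξ + ħ • intVec j)) * v j) :
    ∑' j, (starRingEnd ℂ) (mat U ξ j k) * v j * (ζ - freq ω k +
      (R (ξ + ħ • intVec j) - (starRingEnd ℂ) (R (ξ + ħ • intVec j)))) = 0 := by
  -- Symmetry of `V` pairs the summable column with the merely bounded `v`. Substituting both
  -- eigenvalue equations, the real terms `ω·j` cancel, and only `ζ - ω·k` and twice the imaginary
  -- part of `R` remain.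
  have h1 := tsum_conj_mul_symm (h.hermitian ξ) (summable_mat_row V ξ) (tsum_mat_row_le V ξ)
    (summable_mat_col U ξ k) hvC
  have hA : ∀ j, ∑' i, mat V ξ j i * mat U ξ i k = mat (V * U) ξ j k := fun j =>
    (hasSum_mat_mul V U ξ j k).tsum_eq
  have s1 : Summable fun j => (starRingEnd ℂ) (mat U ξ j k) * ∑' i, mat V ξ j i * v i := by
    refine Summable.of_norm_bounded ((summable_mat_col U ξ k).mul_right (‖V‖ * C)) fun j => ?_
    rw [norm_mul, RCLike.norm_conj]
    refine mul_le_mul_of_nonneg_left ?_ (norm_nonneg _)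
    refine (tsum_of_norm_bounded ((summable_mat_row V ξ j).mul_right C).hasSum fun i => ?_).trans ?_
    · rw [norm_mul]
      exact mul_le_mul_of_nonneg_left (hvC i) (norm_nonneg _)
    · rw [tsum_mul_right]
      exact mul_le_mul_of_nonneg_right (tsum_mat_row_le V ξ j) ((norm_nonneg _).trans (hvC 0))
  have s2 : Summable fun j => (starRingEnd ℂ) (∑' i, mat V ξ j i * mat U ξ i k) * v j := by
    refine Summable.of_norm_bounded ((summable_mat_col (V * U) ξ k).mul_right C) fun j => ?_
    rw [norm_mul, RCLike.norm_conj, hA]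
    exact mul_le_mul_of_nonneg_left (hvC j) (norm_nonneg _)
  rw [← sub_eq_zero, ← s1.tsum_sub s2] at h1
  rw [← h1]
  refine tsum_congr fun j => ?_
  rw [h.tsum_mul_col, hv]
  simp only [map_mul, map_add, map_sub, Complex.conj_ofReal]
  ring

lemma norm_one_sub_mat_le (h : IsConjugation ω V U U' R) (ξ : E d) (k : Fin d → ℤ) :
    7 / 8 ≤ ‖mat U ξ k k‖ := by
  have h1 : mat U ξ k k = 1 + mat (U - 1) ξ k k := by rw [mat_sub, mat_one, if_pos rfl]; ring
  have h2 : ‖mat (U - 1) ξ k k‖ ≤ 1 / 8 := (bound_col ξ k k).trans h.norm_sub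
  have h3 : ‖(1 : ℂ)‖ ≤ ‖mat U ξ k k‖ + ‖mat (U - 1) ξ k k‖ := by
    calc ‖(1 : ℂ)‖ = ‖mat U ξ k k - mat (U - 1) ξ k k‖ := by rw [h1]; ring_nf
      _ ≤ _ := norm_sub_le _ _
  rw [norm_one] at h3
  linarith

lemma summable_conj_mul (ξ : E d) (k : Fin d → ℤ) {v : (Fin d → ℤ) → ℂ} {C : ℝ}
    (hv : ∀ j, ‖v j‖ ≤ C) : Summable fun j => (starRingEnd ℂ) (mat U ξ j k) * v j := by
  refine Summable.of_norm_bounded ((summable_mat_col U ξ k).mul_right C) fun j => ?_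
  rw [norm_mul, RCLike.norm_conj]
  exact mul_le_mul_of_nonneg_left (hv j) (norm_nonneg _)

/-- The counterterm is real. -/
lemma im_eq_zero (h : IsConjugation ω V U U' R) (ξ : E d) : (R ξ).im = 0 := by
  have hbdd : BddAbove (Set.range fun ξ => |(R ξ).im|) :=
    ⟨‖R‖, by rintro _ ⟨ξ, rfl⟩; exact (Complex.abs_im_le_norm _).trans (R.norm_apply_le ξ)⟩
  set S : ℝ := ⨆ ξ, |(R ξ).im| with hS
  have hle : ∀ ξ, |(R ξ).im| ≤ S := fun ξ => le_ciSup hbdd ξ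
  have hS0 : 0 ≤ S := (abs_nonneg _).trans (hle 0)
  -- Green's identity for column `0` with itself is `∑_j |U_{j0}|² Im R(ξ + ħj) = 0`. The term `j =
  -- 0` has weight at least `(7/8)²` and the others have total weight at most `(1/8)²`, which gives
  -- the factor `1/49`. Taking the supremum over `ξ` forces it to vanish.
  have key : ∀ ξ, |(R ξ).im| ≤ S / 49 := by
    intro ξ
    have hg := h.tsum_green ξ 0 (bound_col (U := U) ξ 0) (ζ := freq ω 0)
      fun j => h.tsum_mul_col ξ j 0
    set f : (Fin d → ℤ) → ℂ := fun j => (starRingEnd ℂ) (mat U ξ j 0) * mat U ξ j 0 *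
      ((freq ω 0 : ℂ) - freq ω 0 +
        (R (ξ + ħ • intVec j) - (starRingEnd ℂ) (R (ξ + ħ • intVec j)))) with hf
    have hnorm : ∀ j, ‖f j‖ = ‖mat U ξ j 0‖ ^ 2 * (2 * |(R (ξ + ħ • intVec j)).im|) := by
      intro j
      simp only [hf]
      rw [sub_self, zero_add, Complex.sub_conj, norm_mul, norm_mul, RCLike.norm_conj, norm_mul,
        Complex.norm_I, mul_one, Complex.norm_real, Real.norm_eq_abs, abs_mul, abs_two]
      ring
    have hD : ∀ j, j ≠ 0 → mat U ξ j 0 = mat (U - 1) ξ j 0 := fun j hj => by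
      rw [mat_sub, mat_one, if_neg hj, sub_zero]
    have hb : ∀ j, ‖if j = 0 then 0 else f j‖ ≤ ‖mat (U - 1) ξ j 0‖ * (1 / 8 * (2 * S)) := by
      intro j
      split_ifs with hj
      · rw [norm_zero]; positivity
      · rw [hnorm, hD j hj, sq, mul_assoc]
        have h2 : ‖mat (U - 1) ξ j 0‖ ≤ 1 / 8 := (bound_col ξ 0 j).trans h.norm_sub
        have h3 := hle (ξ + ħ • intVec j)
        gcongr
    have hsumD := (summable_mat_col (U - 1) ξ 0).mul_right (1 / 8 * (2 * S))
    have hsite : Summable fun j => if j = 0 then 0 else f j := Summable.of_norm_bounded hsumD hb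
    have hfs : Summable f := by
      refine (hasSum_ite_eq (0 : Fin d → ℤ) (f 0)).summable.add hsite |>.congr fun j => ?_
      by_cases hj : j = 0 <;> simp [hj]
    rw [hfs.tsum_eq_add_tsum_ite 0] at hg
    have h0 : ‖f 0‖ ≤ 1 / 8 * (1 / 8 * (2 * S)) := by
      rw [eq_neg_of_add_eq_zero_left hg, norm_neg]
      refine (tsum_of_norm_bounded hsumD.hasSum hb).trans ?_
      rw [tsum_mul_right]
      have := (tsum_mat_col_le (U - 1) ξ 0).trans h.norm_sub
      gcongr
    rw [hnorm, intVec_zero, smul_zero, add_zero] at h0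
    have h1 := h.norm_one_sub_mat_le ξ 0
    have h2 : (49 / 64 : ℝ) ≤ ‖mat U ξ 0 0‖ ^ 2 := by nlinarith
    have h3 : 49 / 64 * (2 * |(R ξ).im|) ≤ ‖mat U ξ 0 0‖ ^ 2 * (2 * |(R ξ).im|) := by gcongr
    linarith
  have hS49 : S ≤ S / 49 := ciSup_le key
  have : |(R ξ).im| ≤ 0 := (hle ξ).trans (by linarith)
  exact abs_nonpos_iff.mp this

/-- Columns of `U` are orthogonal to bounded eigenvectors with a different eigenvalue. -/
lemma tsum_conj_mul_eq_zero (h : IsConjugation ω V U U' R) (ξ : E d) (k : Fin d → ℤ)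
    {v : (Fin d → ℤ) → ℂ} {C : ℝ} (hvC : ∀ j, ‖v j‖ ≤ C) {ζ : ℂ}
    (hv : ∀ j, ∑' i, mat V ξ j i * v i = (ζ - freq ω j + R (ξ + ħ • intVec j)) * v j)
    (hζ : ζ ≠ freq ω k) : ∑' j, (starRingEnd ℂ) (mat U ξ j k) * v j = 0 := by
  have hg := h.tsum_green ξ k hvC hv
  have hr : ∀ ξ, R ξ - (starRingEnd ℂ) (R ξ) = 0 := fun ξ => by
    rw [Complex.sub_conj, h.im_eq_zero]; simp
  simp only [hr, add_zero] at hg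
  rw [tsum_mul_right] at hg
  exact (mul_eq_zero.mp hg).resolve_right (sub_ne_zero.mpr hζ)

lemma tsum_conj_mul_col_eq_zero (h : IsConjugation ω V U U' R)
    (hω : ∀ k, freq ω k = 0 → k = 0) (ξ : E d) {k k' : Fin d → ℤ} (hk : k ≠ k') :
    ∑' j, (starRingEnd ℂ) (mat U ξ j k) * mat U ξ j k' = 0 := by
  refine h.tsum_conj_mul_eq_zero ξ k (bound_col (U := U) ξ k') (ζ := freq ω k')
    (fun j => h.tsum_mul_col ξ j k') fun hc => hk ?_
  have : freq ω (k - k') = 0 := by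
    rw [map_sub, sub_eq_zero]; exact_mod_cast hc.symm
  exact sub_eq_zero.mp (hω _ this)

lemma normSq_col_ne_zero (h : IsConjugation ω V U U' R) (ξ : E d) (k : Fin d → ℤ) :
    ∑' j, (starRingEnd ℂ) (mat U ξ j k) * mat U ξ j k ≠ 0 := by
  intro h0
  have hs : Summable fun j => (starRingEnd ℂ) (mat U ξ j k) * mat U ξ j k :=
    summable_conj_mul ξ k (bound_col (U := U) ξ k)
  have e : ∀ j, (starRingEnd ℂ) (mat U ξ j k) * mat U ξ j k = ((‖mat U ξ j k‖ ^ 2 : ℝ) : ℂ) :=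
    fun j => by rw [mul_comm, Complex.mul_conj, Complex.normSq_eq_norm_sq]
  simp only [e] at h0 hs
  have hs' : Summable fun j => ‖mat U ξ j k‖ ^ 2 := Complex.summable_ofReal.mp hs
  rw [← Complex.ofReal_tsum, Complex.ofReal_eq_zero] at h0
  have h1 := hs'.le_tsum k fun j _ => sq_nonneg _
  have h2 := h.norm_one_sub_mat_le ξ k
  rw [h0] at h1
  nlinarith

/-- The columns of `U` are complete. -/
lemma eq_zero_of_tsum_conj (h : IsConjugation ω V U U' R) (ξ : E d) {v : (Fin d → ℤ) → ℂ} {C : ℝ}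
    (hvC : ∀ j, ‖v j‖ ≤ C) (h0 : ∀ k, ∑' j, (starRingEnd ℂ) (mat U ξ j k) * v j = 0)
    (i : Fin d → ℤ) : v i = 0 := by
  have hC : 0 ≤ C := (norm_nonneg _).trans (hvC 0)
  have hsum : Summable (Function.uncurry fun k j =>
      (starRingEnd ℂ) (mat U' ξ k i) * ((starRingEnd ℂ) (mat U ξ j k) * v j)) := by
    refine summable_uncurry_of_le (a := fun k => ‖mat U' ξ k i‖) (b := fun k j => ‖mat U ξ j k‖ * C)
      (B := ‖U‖ * C) (summable_mat_col U' ξ i)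
      (fun _ => norm_nonneg _) (fun i j => mul_nonneg (norm_nonneg _) hC)
      (fun k => (summable_mat_col U ξ k).mul_right C) (fun k => ?_) fun k j => ?_
    · rw [tsum_mul_right]
      exact mul_le_mul_of_nonneg_right (tsum_mat_col_le U ξ k) hC
    · rw [norm_mul, norm_mul, RCLike.norm_conj, RCLike.norm_conj]
      exact mul_le_mul_of_nonneg_left (mul_le_mul_of_nonneg_left (hvC j) (norm_nonneg _))
        (norm_nonneg _)
  -- Summing the vanishing pairings against the conjugate of `U'` reconstructs `v` because `U U' =
  -- 1`.
  have h1 := Summable.tsum_comm hsum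
  have h2 : ∀ k, ∑' j, (starRingEnd ℂ) (mat U' ξ k i) * ((starRingEnd ℂ) (mat U ξ j k) * v j) = 0 :=
    fun k => by rw [tsum_mul_left, h0, mul_zero]
  have h3 : ∀ j, ∑' k, (starRingEnd ℂ) (mat U' ξ k i) * ((starRingEnd ℂ) (mat U ξ j k) * v j) =
      if j = i then v i else 0 := by
    intro j
    have h4 : ∑' k, mat U ξ j k * mat U' ξ k i = if j = i then 1 else 0 := by
      rw [(hasSum_mat_mul U U' ξ j i).tsum_eq, h.mul_inv, mat_one]
    calc _ = ∑' k, (starRingEnd ℂ) (mat U ξ j k * mat U' ξ k i) * v j := by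
          refine tsum_congr fun k => ?_
          rw [map_mul]; ring
      _ = (starRingEnd ℂ) (∑' k, mat U ξ j k * mat U' ξ k i) * v j := by
          rw [tsum_mul_right, Complex.conj_tsum]
      _ = _ := by
          rw [h4]; split_ifs with hj
          · simp [hj]
          · simp
  simp only [h2, h3, tsum_zero, tsum_ite_eq] at h1
  exact h1

lemma summable_col (ξ : E d) (k : Fin d → ℤ) (c : ℂ) : Summable fun j => ‖c * mat U ξ j k‖ := by
  simpa only [norm_mul] using (summable_mat_col U ξ k).mul_left ‖c‖

/-- The operator with the matrix of `V - R`. -/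
abbrev pertOp (V : CrossedProduct (shiftAction d s ħ)) (R : Symb d s) : L2T d →ₗ.[ℂ] L2T d :=
  matrixOp (mat (V - CrossedProduct.diag (shiftAction d s ħ) R) 0)

/-- Multiples of the columns of `U` are eigenfunctions. -/
lemma eigenEq_of_col (h : IsConjugation ω V U U' R) {ψ : L2T d} {c : ℂ} {k : Fin d → ℤ}
    (hψ : ∀ j, coeff ψ j = c * mat U 0 j k) :
    EigenEq (Lhat ω ħ + (ħ : ℂ) • pertOp V R) ((ħ * inner ℝ ω (intVec k) : ℝ) : ℂ) ψ := by
  set W := V - CrossedProduct.diag (shiftAction d s ħ) R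
  rw [eigenEq_Lhat_add]
  have hsW : Summable fun j => ‖c * mat (W * U) 0 j k‖ := summable_col 0 k c
  -- The perturbation maps a column of `U` to the corresponding column of the product, which is
  -- again summable; this puts the column in the domain.
  set φ₂ : L2T d := ofCoeff fun j => c * mat (W * U) 0 j k with hφ₂
  have h2 : ∀ j, coeff φ₂ j = c * mat (W * U) 0 j k := coeff_ofCoeff hsW
  refine ⟨(((ħ * inner ℝ ω (intVec k) : ℝ) : ℂ)) • ψ - (ħ : ℂ) • φ₂, φ₂, fun j => ?_, fun j => ?_,
    sub_add_cancel _ _⟩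
  · rw [coeff_sub, coeff_smul, coeff_smul, h2, hψ]
    have h3 : mat (W * U) 0 j k = ((freq ω k : ℂ) - freq ω j) * mat U 0 j k := by
      have := congrArg (fun f : Symb d s => f (0 + ħ • intVec k)) (h.deriv (j - k))
      simp only [Symb.smul_apply, map_sub, Complex.ofReal_sub, CrossedProduct.neg_apply,
        Symb.neg_apply] at this
      have h4 : -mat (W * U) 0 j k = ((freq ω j : ℂ) - freq ω k) * mat U 0 j k := this
      linear_combination -h4
    rw [h3, freq_apply, freq_apply]
    push_cast
    ring
  · rw [h2]
    have := (hasSum_mat_mul W U 0 j k).mul_left c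
    have e : (fun i => mat W 0 j i * coeff ψ i) = fun i => c * (mat W 0 j i * mat U 0 i k) := by
      funext i
      rw [hψ]; ring
    rw [e]
    exact this

/-- Classification of the eigenfunctions. -/
lemma exists_col_of_eigenEq (h : IsConjugation ω V U U' R) (hħ : ħ ≠ 0)
    (hω : ∀ k, freq ω k = 0 → k = 0) {ψ : L2T d} (hψ0 : ψ ≠ 0) {z : ℂ}
    (hψ : EigenEq (Lhat ω ħ + (ħ : ℂ) • pertOp V R) z ψ) :
    ∃ (k : Fin d → ℤ) (c : ℂ), z = ((ħ * inner ℝ ω (intVec k) : ℝ) : ℂ) ∧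
      ∀ j, coeff ψ j = c * mat U 0 j k := by
  obtain ⟨φ₁, φ₂, h1, h2, h3⟩ := eigenEq_Lhat_add.mp hψ
  have hħ' : (ħ : ℂ) ≠ 0 := by exact_mod_cast hħ
  set v : (Fin d → ℤ) → ℂ := fun j => coeff ψ j with hv
  have hvC : ∀ j, ‖v j‖ ≤ ‖ψ‖ := norm_coeff_le ψ
  set ζ : ℂ := z / ħ with hζ
  have hz : z = ħ * ζ := by rw [hζ]; field_simp
  have heq : ∀ j, coeff φ₂ j = (ζ - freq ω j) * v j := by
    intro j
    have h4 : coeff (φ₁ + (ħ : ℂ) • φ₂ : L2T d) j = coeff (z • ψ : L2T d) j := by rw [h3]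
    rw [coeff_add, coeff_smul, coeff_smul, h1, hz] at h4
    refine mul_left_cancel₀ hħ' ?_
    rw [freq_apply]
    push_cast at h4
    simp only [hv]
    linear_combination h4
  have hVv : ∀ j, ∑' i, mat V 0 j i * v i = (ζ - freq ω j + R (0 + ħ • intVec j)) * v j := by
    intro j
    have hd : HasSum (fun i => mat (CrossedProduct.diag (shiftAction d s ħ) R) 0 j i * v i)
        (R (0 + ħ • intVec j) * v j) := by
      simp only [mat_diag]
      exact (hasSum_diagonal_mul (m := fun i => R (0 + ħ • intVec i))).mpr rfl
    have hs := (h2 j).add hd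
    rw [heq, ← add_mul] at hs
    rw [← hs.tsum_eq]
    refine tsum_congr fun i => ?_
    rw [mat_sub]; ring
  -- By completeness some column pairs non-trivially with `ψ`; orthogonality then forces the
  -- eigenvalue to be that of the column.
  have hex : ∃ k, ∑' j, (starRingEnd ℂ) (mat U 0 j k) * v j ≠ 0 := by
    by_contra hcon
    push Not at hcon
    exact hψ0 (eq_zero_of_coeff ψ (h.eq_zero_of_tsum_conj 0 hvC hcon))
  obtain ⟨k, hk⟩ := hex
  have hζk : ζ = freq ω k := by
    by_contra hne
    exact hk (h.tsum_conj_mul_eq_zero 0 k hvC hVv hne)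
  set N := ∑' j, (starRingEnd ℂ) (mat U 0 j k) * mat U 0 j k with hN
  have hN0 : N ≠ 0 := h.normSq_col_ne_zero 0 k
  -- The coefficient of the projection onto column `k`. The remainder is orthogonal to column `k` by
  -- this choice and to the others because `ω·k' ≠ ω·k`, hence it is zero.
  set c : ℂ := (∑' j, (starRingEnd ℂ) (mat U 0 j k) * v j) / N with hc
  refine ⟨k, c, by rw [hz, hζk, freq_apply]; push_cast; ring, fun j => ?_⟩
  have hdiff : ∀ j, ‖v j - c * mat U 0 j k‖ ≤ ‖ψ‖ + ‖c‖ * ‖U‖ := fun j => by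
    refine (norm_sub_le _ _).trans (add_le_add (hvC j) ?_)
    rw [norm_mul]
    exact mul_le_mul_of_nonneg_left (bound_col 0 k j) (norm_nonneg _)
  refine sub_eq_zero.mp (h.eq_zero_of_tsum_conj 0 hdiff (fun k' => ?_) j)
  have hsp : ∑' j, (starRingEnd ℂ) (mat U 0 j k') * (v j - c * mat U 0 j k) =
      (∑' j, (starRingEnd ℂ) (mat U 0 j k') * v j) -
        c * ∑' j, (starRingEnd ℂ) (mat U 0 j k') * mat U 0 j k := by
    rw [← tsum_mul_left, ← (summable_conj_mul 0 k' hvC).tsum_sub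
      ((summable_conj_mul 0 k' (bound_col (U := U) 0 k)).mul_left c)]
    refine tsum_congr fun j => ?_
    ring
  rw [hsp]
  by_cases hkk : k' = k
  · rw [hkk, ← hN, hc, div_mul_cancel₀ _ hN0, sub_self]
  · rw [h.tsum_conj_mul_col_eq_zero hω 0 hkk, mul_zero, sub_zero]
    refine h.tsum_conj_mul_eq_zero 0 k' hvC hVv fun hc' => hkk ?_
    have : freq ω (k' - k) = 0 := by
      rw [map_sub, sub_eq_zero]
      have := hc'.symm.trans hζk
      exact_mod_cast this
    exact sub_eq_zero.mp (hω _ this)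

end IsConjugation

end

section

/-! ### The quotient map onto the torus -/

section Quotient

variable {d : ℕ}

lemma isOpenQuotientMap_toTorus : IsOpenQuotientMap (toTorus (d := d)) := by
  have h1 : IsOpenQuotientMap fun (y : Fin d → ℝ) (i : Fin d) => (y i : AddCircle (2 * Real.pi)) := by
    refine ⟨fun x => ?_, continuous_pi fun i => (AddCircle.continuous_mk' _).comp (continuous_apply i), ?_⟩
    · choose y hy using fun i => QuotientAddGroup.mk_surjective (x i)
      exact ⟨y, funext hy⟩
    · exact IsOpenMap.piMap (f := fun _ : Fin d => fun y : ℝ => (y : AddCircle (2 * Real.pi)))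
        (fun _ => QuotientAddGroup.isOpenMap_coe) (Eventually.of_forall fun _ =>
          QuotientAddGroup.mk_surjective)
  exact h1.comp (EuclideanSpace.equiv (Fin d) ℝ).toHomeomorph.isOpenQuotientMap

lemma continuous_of_lift {X : Type*} [TopologicalSpace X] {g : Phase d → X}
    (h : Continuous fun p : E d × E d => g (toTorus p.1, p.2)) : Continuous g :=
  (isOpenQuotientMap_toTorus.prodMap IsOpenQuotientMap.id).continuous_comp_iff.mp h

lemma toTorus_surjective : Function.Surjective (toTorus (d := d)) := isOpenQuotientMap_toTorus.surjective

end Quotient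

/-! ### Fourier coefficients of symbols -/

section Coeff

variable {d : ℕ}

lemma conj_coeff {f : Torus d → ℝ} (k : Fin d → ℤ) :
    (starRingEnd ℂ) (coeff (fun x => (f x : ℂ)) k) = coeff (fun x => (f x : ℂ)) (-k) := by
  simp only [coeff, map_mul, Complex.conj_ofReal, ← integral_conj, ← character_neg]

lemma normConst_mul_coeff_const (c : ℂ) (k : Fin d → ℤ) :
    (normConst d : ℂ) * coeff (fun _ : Torus d => c) k = if k = 0 then c else 0 := by
  have h1 : (fun _ : Torus d => c) = fun x => c * character 0 x := by
    funext x; rw [character_zero, mul_one]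
  have h2 : coeff (fun _ : Torus d => c) k = c * coeff (character 0) k := by
    rw [h1]
    simp only [coeff, mul_assoc]
    rw [integral_const_mul]; ring
  rw [h2, coeff_character]
  have := normConst_sq_mul d
  have h3 : (normConst d : ℂ) * normConst d * ((2 * Real.pi) ^ d : ℝ) = 1 := by exact_mod_cast this
  by_cases hk : k = 0
  · rw [if_pos hk.symm, if_pos hk]; linear_combination c * h3
  · rw [if_neg (Ne.symm hk), if_neg hk]; ring

lemma normConst_mul_coeffX_sub {V : Phase d → ℝ} (hV : Continuous V) (R : E d → ℝ) (k : Fin d → ℤ)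
    (ξ : E d) : (normConst d : ℂ) * coeffX (fun p => ((V p - R p.2 : ℝ) : ℂ)) k ξ =
      normConst d * coeffX (fun p => (V p : ℂ)) k ξ - if k = 0 then (R ξ : ℂ) else 0 := by
  rw [← normConst_mul_coeff_const, ← mul_sub]
  congr 1
  simp only [coeffX, coeff]
  have hi : ∀ f : Torus d → ℂ, Continuous f → Integrable fun x => f x * character (-k) x := fun f hf =>
    (hf.mul (character (-k)).continuous).integrable_of_hasCompactSupport
      (HasCompactSupport.of_compactSpace _)
  rw [← mul_sub, ← integral_sub (hi _ (by fun_prop)) (hi _ (by fun_prop))]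
  simp only [Complex.ofReal_sub, sub_mul]

end Coeff

/-! ### Symbols as elements of the crossed product -/

/-- The Euclidean norm on `ℤᵈ`. -/
def latticeNorm (d : ℕ) : AddGroupSeminorm (Fin d → ℤ) where
  toFun k := ‖intVec k‖
  map_zero' := by rw [intVec_zero, norm_zero]
  add_le' k l := by rw [intVec_add]; exact norm_add_le _ _
  neg' k := by rw [intVec_neg, norm_neg]

lemma latticeNorm_apply {d : ℕ} (k : Fin d → ℤ) : latticeNorm d k = ‖intVec k‖ := rfl

section Quantization

variable {d : ℕ} {s : ℝ} [hs : Fact (0 < s)]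

/-- The Weyl midpoint is `ħ(j+k)/2 = ħk + (ħ/2)(j-k)`, so the degree-`m` coefficient is translated
by `(ħ/2)m`. Translations being isometric, the weighted norm is controlled by that of the symbol for
every `ħ`. -/
lemma exists_weylElement {ρ : ℝ} (hρ : 0 ≤ ρ) (ħ : ℝ) {g : Phase d → ℂ} (hg : normSymbol s ρ g ≠ ∞) :
    ∃ W : CrossedProduct (shiftAction d s ħ),
      (∀ k ξ, W k ξ = normConst d * coeffX g k (ξ + (ħ / 2) • intVec k)) ∧
      CrossedProduct.NormLE (latticeNorm d) ρ W (normSymbol s ρ g).toReal ∧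
      ∀ k, Tendsto (W k) (cocompact (E d)) (𝓝 0) := by
  have hc := normConst_pos d
  have hsum : ∑' k : Fin d → ℤ, normA s (coeffX g k) *
      ENNReal.ofReal (Real.exp (ρ * ‖intVec k‖)) ≠ ∞ := by
    intro h
    apply hg
    rw [normSymbol, h, ENNReal.mul_top]
    simpa using hc
  have hk : ∀ k, normA s (coeffX g k) ≠ ∞ := fun k h => by
    refine ENNReal.ne_top_of_tsum_ne_top hsum k ?_
    rw [h, ENNReal.top_mul]
    simpa using Real.exp_pos _
  choose a ha han h hh using fun k => Symb.exists_of_normA (s := s) (hk k)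
  set w : (Fin d → ℤ) → Symb d s := fun k =>
    Symb.translate ((ħ / 2) • intVec k) (normConst d • a k) with hw
  have hwn : ∀ k, ‖w k‖ₑ ≤ ENNReal.ofReal (normConst d) * normA s (coeffX g k) := fun k => by
    have : ‖w k‖ₑ = ENNReal.ofReal (normConst d) * ‖a k‖ₑ := by
      rw [hw, ← ofReal_norm, Symb.norm_translate, norm_smul, Real.norm_of_nonneg hc.le,
        ENNReal.ofReal_mul hc.le, ofReal_norm]
    rw [this]
    gcongr
    exact han k
  have hwt : weightedNorm (expWeight (latticeNorm d) ρ) w ≤ normSymbol s ρ g := by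
    rw [normSymbol, ← ENNReal.tsum_mul_left]
    refine ENNReal.tsum_le_tsum fun k => ?_
    rw [← mul_assoc]
    exact mul_le_mul_left (hwn k) _
  have h1 : weightedNorm 1 w ≠ ∞ := ne_top_of_le_ne_top hg
    ((weightedNorm_mono (fun k => one_le_expWeight _ hρ k) w).trans hwt)
  refine ⟨CrossedProduct.mk _ w h1, fun k ξ => ?_, ⟨ENNReal.toReal_nonneg, ?_⟩, fun k => ?_⟩
  · rw [CrossedProduct.mk_apply, hw, Symb.translate_apply, Symb.smul_apply, ha]
  · rw [ENNReal.ofReal_toReal hg, CrossedProduct.coe_mk]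
    exact hwt
  · have h2 := Symb.tendsto_cocompact_of_isFourierTransform (hh k)
    have h3 : Tendsto (fun ξ : E d => ξ + (ħ / 2) • intVec k) (cocompact (E d)) (cocompact (E d)) :=
      (Homeomorph.addRight ((ħ / 2) • intVec k)).isClosedEmbedding.tendsto_cocompact
    have h4 := (h2.comp h3).const_mul (normConst d : ℂ)
    rw [mul_zero] at h4
    refine h4.congr fun ξ => ?_
    simp only [CrossedProduct.mk_apply, hw, Symb.translate_apply, Symb.smul_apply, ha,
      Function.comp_apply]

/-- The derivation kills degree `0`, so the conjugation equation there reads `R U_0 = (VU)_0`. The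
right side tends to `0` by dominated convergence over the degrees, and `|U_0| ≥ 7/8`. This decay
places `R` in `𝒜_s` without a constant part. -/
lemma IsConjugation.tendsto_cocompact {ħ : ℝ} {ω : E d} {V U U' : CrossedProduct (shiftAction d s ħ)}
    {R : Symb d s} (h : IsConjugation ω V U U' R)
    (hV : ∀ k, Tendsto (V k) (cocompact (E d)) (𝓝 0)) : Tendsto R (cocompact (E d)) (𝓝 0) := by
  have h0 : (V * U) 0 = R * U 0 := by
    have := h.deriv 0
    rw [(freq ω).map_zero, zero_smul, CrossedProduct.neg_apply, neg_eq_zero, sub_mul,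
      CrossedProduct.sub_apply, CrossedProduct.diag_mul_apply, sub_eq_zero,
      (shiftAction d s ħ).map_zero] at this
    exact this
  have hU0 : ∀ ξ, 7 / 8 ≤ ‖U 0 ξ‖ := fun ξ => by
    have h1 : ‖(U - 1) 0 ξ‖ ≤ 1 / 8 :=
      (Symb.norm_apply_le _ _).trans ((CrossedProduct.norm_apply_le _ _).trans h.norm_sub)
    rw [CrossedProduct.sub_apply, CrossedProduct.one_def, CrossedProduct.diag_apply_zero,
      Symb.sub_apply, Symb.one_apply] at h1
    have h2 := norm_sub_norm_le (1 : ℂ) (U 0 ξ)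
    rw [norm_sub_rev, norm_one] at h2
    linarith
  have hVU : ∀ ξ, R ξ * U 0 ξ = ∑' l, V (0 - l) (ξ + ħ • intVec l) * U l ξ := fun ξ => by
    have h1 := Symb.hasSum_apply (CrossedProduct.summable_mul V U 0).hasSum ξ
    rw [← CrossedProduct.mul_apply, h0, Symb.mul_apply] at h1
    rw [← h1.tsum_eq]
    simp only [Symb.mul_apply, shiftAction_apply]
  have hlim : Tendsto (fun ξ => R ξ * U 0 ξ) (cocompact (E d)) (𝓝 0) := by
    simp only [hVU]
    have hb : Summable fun l => ‖V (0 - l)‖ * ‖U‖ :=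
      (((Equiv.subLeft 0).summable_iff.mpr V.hasSum_norm.summable)).mul_right _
    have hle : ∀ l ξ, ‖V (0 - l) (ξ + ħ • intVec l) * U l ξ‖ ≤ ‖V (0 - l)‖ * ‖U‖ := fun l ξ => by
      rw [norm_mul]
      exact mul_le_mul (Symb.norm_apply_le _ _)
        ((Symb.norm_apply_le _ _).trans (CrossedProduct.norm_apply_le _ _)) (norm_nonneg _)
        (norm_nonneg _)
    have := tendsto_tsum_of_dominated_convergence (𝓕 := cocompact (E d)) (g := fun _ => (0 : ℂ)) hb
      (fun l => ?_) (Eventually.of_forall fun ξ l => hle l ξ)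
    · rwa [tsum_zero] at this
    · have h3 : Tendsto (fun ξ : E d => ξ + ħ • intVec l) (cocompact (E d)) (cocompact (E d)) :=
        (Homeomorph.addRight (ħ • intVec l)).isClosedEmbedding.tendsto_cocompact
      have h4 := (((hV (0 - l)).comp h3).norm).mul_const ‖U‖
      rw [norm_zero, zero_mul] at h4
      refine squeeze_zero_norm (fun ξ => ?_) h4
      rw [norm_mul]
      exact mul_le_mul_of_nonneg_left
        ((Symb.norm_apply_le _ _).trans (CrossedProduct.norm_apply_le _ _)) (norm_nonneg _)
  have h5 := hlim.norm.const_mul (8 / 7)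
  rw [norm_zero, mul_zero] at h5
  refine squeeze_zero_norm (fun ξ => ?_) h5
  rw [norm_mul]
  nlinarith [hU0 ξ, norm_nonneg (R ξ)]

lemma freq_ne_zero {ς γ : ℝ} (hς : 0 < ς) {ω : E d} (hω : IsDiophantine ς γ ω) (k : Fin d → ℤ)
    (hk : freq ω k = 0) : k = 0 := by
  by_contra hne
  have h1 := hω k hne
  rw [← freq_apply, hk, abs_zero] at h1
  have h2 : 0 < ‖intVec k‖ := norm_pos_iff.mpr fun h => hne (intVec_eq_zero.mp h)
  have : 0 < ς / ‖intVec k‖ ^ (γ - 1) := div_pos hς (Real.rpow_pos_of_pos h2 _)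
  linarith

/-- The renormalization theorem at fixed `ħ`. -/
theorem exists_isConjugation [NeZero d] {ρ γ ς : ℝ} (hρ : 0 < ρ) (hγ : 1 < γ) (hς : 0 < ς) {ω : E d}
    (hω : IsDiophantine ς γ ω) {V : Phase d → ℝ} (hV : MemSymbol s ρ V)
    (hVn : normSymbol s ρ (fun p => (V p : ℂ)) ≤ ENNReal.ofReal (CrossedProduct.kamThreshold ρ (γ - 1) ς)) (ħ : ℝ) :
    ∃ (W U U' : CrossedProduct (shiftAction d s ħ)) (R : Symb d s), IsConjugation ω W U U' R ∧
      CrossedProduct.NormLE (latticeNorm d) (ρ / 2) (U - 1) (1 / 8) ∧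
      MemA s (fun ξ => (R ξ).re) ∧
      normA s (fun ξ => ((R ξ).re : ℂ)) ≤
        ENNReal.ofReal 2 * normSymbol s ρ (fun p => (V p : ℂ)) ∧
      Qhat ω V (fun ξ => (R ξ).re) ħ = Lhat ω ħ + (ħ : ℂ) • IsConjugation.pertOp W R := by
  have hfin : normSymbol s ρ (fun p => (V p : ℂ)) ≠ ∞ := hV.2.ne
  have hcont : Continuous V := continuous_of_lift (continuousOn_univ.mp hV.1.continuousOn)
  obtain ⟨W, hW, hWn, hW0⟩ := exists_weylElement (s := s) hρ.le ħ hfin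
  obtain ⟨U, U', R, h1, -, h3, -, h4, h5⟩ := CrossedProduct.exists_conjugation (ℓ := latticeNorm d) (lam := freq ω) hς
    (p := γ - 1) (by linarith) hρ (fun k hk => norm_pos_iff.mpr fun h => hk (intVec_eq_zero.mp h))
    hω hWn (ENNReal.toReal_le_of_le_ofReal
      (CrossedProduct.kamThreshold_pos hρ (by linarith) hς).le hVn)
  -- The Weyl midpoint is symmetric in `j` and `k`, so a real symbol gives a Hermitian matrix at
  -- every base point.
  have hherm : ∀ ξ j k, mat W ξ j k = (starRingEnd ℂ) (mat W ξ k j) := fun ξ j k => by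
    simp only [mat, hW, map_mul, Complex.conj_ofReal, coeffX, conj_coeff, neg_sub]
    have : ξ + ħ • intVec k + (ħ / 2) • intVec (j - k) = ξ + ħ • intVec j + (ħ / 2) • intVec (k - j) := by
      rw [intVec_sub, intVec_sub]
      module
    rw [this]
  have hconj : IsConjugation ω W U U' R := ⟨h1, h4, h3.norm_le (by linarith), hherm⟩
  have hR0 := hconj.tendsto_cocompact hW0
  have hR := hconj.im_eq_zero
  have hre : ∀ ξ, ((R ξ).re : ℂ) = R ξ := fun ξ => Complex.ext rfl (by simp [hR])
  obtain ⟨h6, h7⟩ := R.memA hR0 hR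
  refine ⟨W, U, U', R, hconj, h3, h6, h7.trans ?_, ?_⟩
  · rw [← ofReal_norm]
    refine (ENNReal.ofReal_le_ofReal h5).trans ?_
    rw [ENNReal.ofReal_mul (by norm_num), ENNReal.ofReal_toReal hfin]
  -- Base point `0` gives the operator itself; a function of `ξ` alone contributes only on the
  -- diagonal.
  · have hmat : (fun j k => (normConst d : ℂ) * coeffX (fun p => ((V p - (R p.2).re : ℝ) : ℂ)) (j - k)
        ((ħ / 2) • intVec (j + k))) = mat (W - CrossedProduct.diag (shiftAction d s ħ) R) 0 := by
      funext j k
      rw [normConst_mul_coeffX_sub hcont (fun ξ => (R ξ).re), mat_sub, mat_diag, mat, hW, hre]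
      have e : (0 : E d) + ħ • intVec k + (ħ / 2) • intVec (j - k) = (ħ / 2) • intVec (j + k) := by
        rw [intVec_sub, intVec_add]
        module
      rw [e]
      congr 1
      by_cases hjk : j = k
      · subst hjk
        simp only [sub_self, if_true]
        congr 1
        rw [intVec_add]; module
      · rw [if_neg hjk, if_neg (sub_ne_zero.mpr hjk)]
    rw [Qhat, weylOp, hmat]

/-! ### The point spectrum -/

lemma pointSpectrum_Lhat (ω : E d) (ħ : ℝ) : pointSpectrum (Lhat ω ħ) =
    Set.range (fun k : Fin d → ℤ => ((ħ * inner ℝ ω (intVec k) : ℝ) : ℂ)) := by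
  ext z
  constructor
  · rintro ⟨ψ, hψ0, hψ⟩
    rw [eigenEq_Lhat] at hψ
    obtain ⟨k, hk⟩ : ∃ k, coeff ψ k ≠ 0 := by
      by_contra hcon
      push Not at hcon
      exact hψ0 (eq_zero_of_coeff ψ hcon)
    exact ⟨k, mul_right_cancel₀ hk (hψ k)⟩
  · rintro ⟨k, rfl⟩
    refine ⟨expVec k, fun h => ?_, eigenEq_Lhat.mpr fun j => ?_⟩
    · have := norm_expVec k
      rw [h, norm_zero] at this
      exact zero_ne_one this
    · rw [coeff_expVec]
      split_ifs with h
      · rw [h]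
      · simp

lemma IsConjugation.pointSpectrum_eq {ħ : ℝ} {ω : E d} {V U U' : CrossedProduct (shiftAction d s ħ)}
    {R : Symb d s} (h : IsConjugation ω V U U' R) (hħ : ħ ≠ 0) (hω : ∀ k, freq ω k = 0 → k = 0) :
    pointSpectrum (Lhat ω ħ + (ħ : ℂ) • IsConjugation.pertOp V R) = pointSpectrum (Lhat ω ħ) := by
  rw [pointSpectrum_Lhat]
  ext z
  constructor
  · rintro ⟨ψ, hψ0, hψ⟩
    obtain ⟨k, c, hz, -⟩ := h.exists_col_of_eigenEq hħ hω hψ0 hψ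
    exact ⟨k, hz.symm⟩
  · rintro ⟨k, rfl⟩
    have hc : ∀ j, coeff (ofCoeff fun j => 1 * mat U 0 j k) j = 1 * mat U 0 j k :=
      coeff_ofCoeff (summable_col 0 k 1)
    refine ⟨ofCoeff fun j => 1 * mat U 0 j k, fun h0 => ?_, h.eigenEq_of_col hc⟩
    refine h.normSq_col_ne_zero 0 k ?_
    have hz : ∀ j, mat U 0 j k = 0 := fun j => by rw [← one_mul (mat U 0 j k), ← hc j, h0, coeff_zero]
    simp only [hz, mul_zero, tsum_zero]

end Quantization

end

section

/-! ### Summable families on the lattice -/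

lemma summable_prod_apply {g : ℤ → ℝ} (h0 : ∀ n, 0 ≤ g n) (hg : Summable g) :
    ∀ d : ℕ, Summable fun k : Fin d → ℤ => ∏ i, g (k i)
  | 0 => (hasSum_fintype _).summable
  | d + 1 => by
    have h := hg.mul_of_nonneg (summable_prod_apply h0 hg d) h0
      (fun k => Finset.prod_nonneg fun i _ => h0 _)
    rw [← (Fin.consEquiv fun _ : Fin (d + 1) => ℤ).summable_iff]
    refine h.congr fun p => ?_
    simp [Fin.consEquiv, Fin.prod_univ_succ]

lemma abs_le_norm_intVec {d : ℕ} (k : Fin d → ℤ) (i : Fin d) : |(k i : ℝ)| ≤ ‖intVec k‖ := by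
  simpa [intVec] using PiLp.norm_apply_le (intVec k) i

/-- Since `∑_i |k_i| ≤ d|k|`, the exponential is dominated by a product of one-dimensional
exponentials. -/
lemma summable_exp_neg_norm_intVec (d : ℕ) {r : ℝ} (hr : 0 < r) :
    Summable fun k : Fin d → ℤ => Real.exp (-(r * ‖intVec k‖)) := by
  obtain ⟨c, hc, hcr⟩ : ∃ c : ℝ, 0 < c ∧ d * c ≤ r := by
    refine ⟨r / (d + 1), by positivity, ?_⟩
    rw [mul_div_assoc', div_le_iff₀ (by positivity)]
    nlinarith
  have hnat : Summable fun n : ℕ => Real.exp (-(c * |((n : ℤ) : ℝ)|)) := by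
    refine (Real.summable_exp_nat_mul_iff.mpr (neg_lt_zero.mpr hc)).congr fun n => ?_
    congr 1
    simp [mul_comm]
  have hint : Summable fun n : ℤ => Real.exp (-(c * |(n : ℝ)|)) := by
    refine Summable.of_nat_of_neg hnat (hnat.congr fun n => ?_)
    simp
  refine Summable.of_nonneg_of_le (fun k => (Real.exp_pos _).le) (fun k => ?_)
    (summable_prod_apply (fun n => (Real.exp_pos _).le) hint d)
  rw [← Real.exp_sum]
  refine Real.exp_le_exp.mpr ?_
  rw [Finset.sum_neg_distrib, neg_le_neg_iff, ← Finset.mul_sum]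
  calc c * ∑ i, |(k i : ℝ)| ≤ c * ∑ _i : Fin d, ‖intVec k‖ := by
        gcongr with i; exact abs_le_norm_intVec k i
    _ = d * c * ‖intVec k‖ := by simp; ring
    _ ≤ r * ‖intVec k‖ := by gcongr

lemma summable_one_add_sq_inv : Summable fun n : ℤ => (1 + (n : ℝ) ^ 2)⁻¹ := by
  have h : Summable fun n : ℤ => 1 / (n : ℝ) ^ 2 := Real.summable_one_div_int_pow.mpr (by norm_num)
  refine Summable.of_norm_bounded_eventually h ?_
  have : ∀ᶠ n : ℤ in cofinite, n ≠ 0 := (Set.finite_singleton (0 : ℤ)).compl_mem_cofinite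
  filter_upwards [this] with n hn
  have hn' : (0 : ℝ) < (n : ℝ) ^ 2 := by positivity
  rw [Real.norm_of_nonneg (by positivity), one_div]
  exact inv_anti₀ hn' (by linarith)

/-! ### Test functions -/

section TestFunction

variable {d : ℕ} {a : Phase d → ℂ}

lemma toTorus_add (y z : E d) : toTorus (y + z) = toTorus y + toTorus z := by
  funext i
  simp [toTorus]

lemma toTorus_zero : toTorus (0 : E d) = 0 := by
  funext i
  simp [toTorus]

lemma character_apply_add (k : Fin d → ℤ) (x y : Torus d) :
    character k (x + y) = character k x * character k y := by
  simp only [character, ContinuousMap.coe_mk, ← Finset.prod_mul_distrib, Pi.add_apply]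
  refine Finset.prod_congr rfl fun i _ => ?_
  simp only [fourier_apply, smul_add, AddCircle.toCircle_add, Circle.coe_mul]

/-- A unit step of length `t` in the `i`-th direction. -/
abbrev step (i : Fin d) (t : ℝ) : E d := t • EuclideanSpace.single i (1 : ℝ)

lemma character_step (k : Fin d → ℤ) (i : Fin d) (t : ℝ) :
    character k (toTorus (step i t)) = Complex.exp (t * (k i * Complex.I)) := by
  have h : ∀ j, fourier (k j) (toTorus (step i t) j) = Complex.exp (Complex.I * (k j * (step i t) j)) := by
    intro j
    rw [toTorus, fourier_coe_apply]
    congr 1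
    have : (Real.pi : ℂ) ≠ 0 := by exact_mod_cast Real.pi_ne_zero
    push_cast
    field_simp
  simp only [character, ContinuousMap.coe_mk, h]
  rw [← Complex.exp_sum, Finset.sum_eq_single i]
  · congr 1
    simp
    ring
  · intro j _ hj
    simp [hj]
  · simp

/-- The derivative of `a` in the direction `x_i`. -/
def xDeriv (i : Fin d) (a : Phase d → ℂ) (p : Phase d) : ℂ :=
  deriv (fun t : ℝ => a (p.1 + toTorus (step i t), p.2)) 0

namespace IsTestFunction

lemma continuous (ha : IsTestFunction a) : Continuous a := continuous_of_lift ha.1.continuous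

lemma exists_bound (ha : IsTestFunction a) : ∃ C, ∀ p, ‖a p‖ ≤ C :=
  ha.continuous.bounded_above_of_compact_support ha.2

lemma hasDerivAt_lift (ha : IsTestFunction a) (i : Fin d) (y ξ : E d) (t : ℝ) :
    HasDerivAt (fun t : ℝ => a (toTorus (y + step i t), ξ))
      (fderiv ℝ (fun p : E d × E d => a (toTorus p.1, p.2)) (y + step i t, ξ)
        (EuclideanSpace.single i 1, 0)) t := by
  have h1 : HasDerivAt (fun t : ℝ => ((y + step i t, ξ) : E d × E d))
      (EuclideanSpace.single i 1, 0) t := by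
    refine HasDerivAt.prodMk ?_ (hasDerivAt_const _ _)
    have := ((hasDerivAt_id t).smul_const (EuclideanSpace.single i (1 : ℝ))).const_add y
    simpa using this
  have h2 := (ha.1.differentiable (by simp)).differentiableAt (x := (y + step i t, ξ))
  exact h2.hasFDerivAt.comp_hasDerivAt t h1

lemma xDeriv_toTorus (ha : IsTestFunction a) (i : Fin d) (y ξ : E d) :
    xDeriv i a (toTorus y, ξ) =
      fderiv ℝ (fun p : E d × E d => a (toTorus p.1, p.2)) (y, ξ) (EuclideanSpace.single i 1, 0) := by
  have := (ha.hasDerivAt_lift i y ξ 0).deriv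
  simpa [xDeriv, ← toTorus_add] using this

lemma hasDerivAt_step (ha : IsTestFunction a) (i : Fin d) (x : Torus d) (ξ : E d) (t : ℝ) :
    HasDerivAt (fun t : ℝ => a (x + toTorus (step i t), ξ))
      (xDeriv i a (x + toTorus (step i t), ξ)) t := by
  obtain ⟨y, rfl⟩ := toTorus_surjective x
  simp only [← toTorus_add]
  rw [ha.xDeriv_toTorus]
  exact ha.hasDerivAt_lift i y ξ t

lemma xDeriv (ha : IsTestFunction a) (i : Fin d) : IsTestFunction (xDeriv i a) := by
  constructor
  · simp only [ha.xDeriv_toTorus]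
    exact (ha.1.fderiv_right (by simp)).clm_apply contDiff_const
  · refine ha.2.mono' fun p hp => ?_
    by_contra hcon
    refine hp ?_
    have h0 : a =ᶠ[𝓝 p] 0 := notMem_tsupport_iff_eventuallyEq.mp hcon
    have hc : Tendsto (fun t : ℝ => ((p.1 + toTorus (step i t), p.2) : Phase d)) (𝓝 0) (𝓝 p) := by
      have : Continuous (fun t : ℝ => ((p.1 + toTorus (step i t), p.2) : Phase d)) := by
        have := (isOpenQuotientMap_toTorus (d := d)).continuous
        fun_prop
      have h := this.tendsto 0
      simpa [toTorus_zero] using h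
    have h1 : (fun t : ℝ => a (p.1 + toTorus (step i t), p.2)) =ᶠ[𝓝 0] fun _ => 0 := hc.eventually h0
    rw [SemiclassicalTorus.xDeriv, h1.deriv_eq, deriv_const]

/-- Translation invariance of the measure multiplies the coefficient of the translated function by
`exp (i t k_i)`; both sides are differentiated at `t = 0`. -/
lemma coeffX_xDeriv (ha : IsTestFunction a) (i : Fin d) (k : Fin d → ℤ) (ξ : E d) :
    coeffX (SemiclassicalTorus.xDeriv i a) k ξ = (k i * Complex.I) * coeffX a k ξ := by
  have hac := ha.continuous
  have hac' := (ha.xDeriv i).continuous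
  obtain ⟨C, hC⟩ := (ha.xDeriv i).exists_bound
  have hi : ∀ f : Torus d → ℂ, Continuous f → Integrable fun x => f x * character (-k) x := fun f hf =>
    (hf.mul (character (-k)).continuous).integrable_of_hasCompactSupport
      (HasCompactSupport.of_compactSpace _)
  have h1 : HasDerivAt (fun t : ℝ => ∫ x, a (x + toTorus (step i t), ξ) * character (-k) x)
      (∫ x, SemiclassicalTorus.xDeriv i a (x + toTorus (step i 0), ξ) * character (-k) x) 0 := by
    refine (hasDerivAt_integral_of_dominated_loc_of_deriv_le (s := Set.univ)
      (F' := fun (t : ℝ) x => SemiclassicalTorus.xDeriv i a (x + toTorus (step i t), ξ) * character (-k) x)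
      (bound := fun _ => C)
      univ_mem (Eventually.of_forall fun t => ?_) (hi _ ?_) ?_ (Eventually.of_forall fun x t _ => ?_)
      (integrable_const _) (Eventually.of_forall fun x t _ => ?_)).2
    · exact (hi _ (by fun_prop)).aestronglyMeasurable
    · fun_prop
    · exact (hi _ (by fun_prop)).aestronglyMeasurable
    · rw [norm_mul, norm_character, mul_one]; exact hC _
    · exact (ha.hasDerivAt_step i x ξ t).mul_const _
  have h2 : ∀ t : ℝ, ∫ x, a (x + toTorus (step i t), ξ) * character (-k) x =
      Complex.exp (t * (k i * Complex.I)) * ∫ x, a (x, ξ) * character (-k) x := fun t => by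
    rw [← integral_add_right_eq_self (μ := (volume : Measure (Torus d)))
      (fun x => a (x, ξ) * character (-k) x) (toTorus (step i t)), ← integral_const_mul]
    refine integral_congr_ae (Eventually.of_forall fun x => ?_)
    have h3 : Complex.exp (t * (k i * Complex.I)) * character (-k) (toTorus (step i t)) = 1 := by
      rw [character_step, ← Complex.exp_add]
      simp
    simp only [character_apply_add]
    linear_combination (-(a (x + toTorus (step i t), ξ) * character (-k) x)) * h3
  simp only [h2] at h1
  have h4 : HasDerivAt (fun t : ℝ => Complex.exp (t * (k i * Complex.I)) *
      ∫ x, a (x, ξ) * character (-k) x) ((k i * Complex.I) * ∫ x, a (x, ξ) * character (-k) x) 0 := by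
    have h5 : HasDerivAt (fun t : ℝ => ((t : ℂ) * (k i * Complex.I))) (k i * Complex.I) (0 : ℝ) := by
      simpa using (Complex.ofRealCLM.hasDerivAt (x := (0 : ℝ))).mul_const (k i * Complex.I)
    have := (h5.cexp).mul_const (∫ x, a (x, ξ) * character (-k) x)
    simpa using this
  have h6 := h1.unique h4
  simp only [step, zero_smul, toTorus_zero, add_zero] at h6
  simp only [coeffX, coeff, h6]
  ring

lemma exists_coeffX_bound (ha : IsTestFunction a) : ∃ C, ∀ k ξ, ‖coeffX a k ξ‖ ≤ C := by
  obtain ⟨C, hC⟩ := ha.exists_bound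
  refine ⟨normConst d * (C * (volume : Measure (Torus d)).real Set.univ), fun k ξ => ?_⟩
  rw [coeffX, coeff, norm_mul, Complex.norm_real, Real.norm_of_nonneg (normConst_pos d).le]
  refine mul_le_mul_of_nonneg_left ?_ (normConst_pos d).le
  refine norm_integral_le_of_norm_le_const (Eventually.of_forall fun x => ?_)
  rw [norm_mul, norm_character, mul_one]
  exact hC _

/-- One direction at a time: the factor `1 + k_i²` is paid for by `a` and its second derivative
along `x_i`, both test functions, so the induction is over all test functions at once. -/
lemma exists_coeffX_prod_bound (S : Finset (Fin d)) :
    ∀ {a : Phase d → ℂ}, IsTestFunction a →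
      ∃ C, ∀ (k : Fin d → ℤ) ξ, (∏ i ∈ S, (1 + (k i : ℝ) ^ 2)) * ‖coeffX a k ξ‖ ≤ C := by
  classical
  induction S using Finset.induction_on with
  | empty => intro a ha; simpa using ha.exists_coeffX_bound
  | insert i S hi ih =>
    intro a ha
    obtain ⟨C₁, h₁⟩ := ih ha
    obtain ⟨C₂, h₂⟩ := ih ((ha.xDeriv i).xDeriv i)
    refine ⟨C₁ + C₂, fun k ξ => ?_⟩
    have h3 := h₂ k ξ
    rw [(ha.xDeriv i).coeffX_xDeriv, ha.coeffX_xDeriv] at h3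
    simp only [norm_mul, Complex.norm_I, mul_one, Complex.norm_intCast] at h3
    rw [Finset.prod_insert hi]
    have h4 : |(k i : ℝ)| * |(k i : ℝ)| = (k i : ℝ) ^ 2 := by rw [← sq, sq_abs]
    calc _ = (∏ i ∈ S, (1 + (k i : ℝ) ^ 2)) * ‖coeffX a k ξ‖ +
        (∏ i ∈ S, (1 + (k i : ℝ) ^ 2)) * (|(k i : ℝ)| * (|(k i : ℝ)| * ‖coeffX a k ξ‖)) := by
          rw [← mul_assoc |(k i : ℝ)|, h4]; ring
      _ ≤ C₁ + C₂ := add_le_add (h₁ k ξ) h3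

/-- The Fourier coefficients of a test function decay rapidly. -/
lemma exists_summable_bound (ha : IsTestFunction a) :
    ∃ b : (Fin d → ℤ) → ℝ, Summable b ∧ ∀ k ξ, ‖coeffX a k ξ‖ ≤ b k := by
  obtain ⟨C, hC⟩ := exists_coeffX_prod_bound Finset.univ ha
  refine ⟨fun k => C * ∏ i, (1 + (k i : ℝ) ^ 2)⁻¹, (summable_prod_apply (fun n => by positivity)
    summable_one_add_sq_inv d).mul_left C, fun k ξ => ?_⟩
  simp only [Finset.prod_inv_distrib]
  rw [← div_eq_mul_inv, le_div_iff₀ (Finset.prod_pos fun i _ => by positivity),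
    mul_comm]
  exact hC k ξ

lemma uniformContinuous_coeffX (ha : IsTestFunction a) (k : Fin d → ℤ) :
    UniformContinuous (coeffX a k) := by
  have hu : UniformContinuous a := ha.2.uniformContinuous_of_continuous ha.continuous
  set M : ℝ := normConst d * (volume : Measure (Torus d)).real Set.univ with hM
  have hM0 : 0 ≤ M := mul_nonneg (normConst_pos d).le measureReal_nonneg
  rw [Metric.uniformContinuous_iff] at hu ⊢
  intro ε hε
  obtain ⟨δ, hδ, h⟩ := hu (ε / (M + 1)) (by positivity)
  refine ⟨δ, hδ, fun ξ ξ' hξ => ?_⟩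
  have hi : ∀ ξ : E d, Integrable fun x => a (x, ξ) * character (-k) x := fun ξ =>
    Continuous.integrable_of_hasCompactSupport (by have := ha.continuous; fun_prop)
      (HasCompactSupport.of_compactSpace _)
  rw [dist_eq_norm, coeffX, coeffX, coeff, coeff, ← mul_sub, ← integral_sub (hi _) (hi _), norm_mul,
    Complex.norm_real, Real.norm_of_nonneg (normConst_pos d).le]
  have h1 : ‖∫ x, (a (x, ξ) * character (-k) x - a (x, ξ') * character (-k) x)‖ ≤
      ε / (M + 1) * (volume : Measure (Torus d)).real Set.univ := by
    refine norm_integral_le_of_norm_le_const (Eventually.of_forall fun x => ?_)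
    rw [← sub_mul, norm_mul, norm_character, mul_one, ← dist_eq_norm]
    refine (h ?_).le
    rw [Prod.dist_eq, dist_self]
    exact max_lt hδ hξ
  calc _ ≤ normConst d * (ε / (M + 1) * (volume : Measure (Torus d)).real Set.univ) :=
        mul_le_mul_of_nonneg_left h1 (normConst_pos d).le
    _ = ε * (M / (M + 1)) := by rw [hM]; ring
    _ < ε * 1 := by
        gcongr
        rw [div_lt_one (by positivity)]; linarith
    _ = ε := mul_one _

end IsTestFunction

end TestFunction

end

section

/-! ### Wigner distributions and densities of concentrating sequences -/

section Wigner

variable {d : ℕ} {a : Phase d → ℂ}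

/-- The equivalence `(l, m) ↦ (m + l, m)`. -/
def diagEquiv (G : Type*) [AddCommGroup G] : G × G ≃ G × G where
  toFun p := (p.2 + p.1, p.2)
  invFun p := (p.1 - p.2, p.2)
  left_inv p := by simp
  right_inv p := by simp

/-- Summable coefficients of `ψ` and the rapid decay of those of `a` make the double series
absolutely convergent, which also puts `ψ` in the domain. It is indexed by the jump `l` and by the
offset `m` from a reference point `k`, later the concentration point. -/
lemma hasSum_wigner (ha : IsTestFunction a) (ħ : ℝ) {ψ : L2T d} (hψ : Summable fun k => ‖coeff ψ k‖)
    (k : Fin d → ℤ) :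
    HasSum (fun p : (Fin d → ℤ) × (Fin d → ℤ) => (starRingEnd ℂ) (coeff ψ (k + (p.2 + p.1))) *
      (normConst d * coeffX a p.1 ((ħ / 2) • intVec (k + (p.2 + p.1) + (k + p.2))) *
        coeff ψ (k + p.2))) (wigner ħ ψ a) := by
  obtain ⟨b, hb, hab⟩ := ha.exists_summable_bound
  have hnc := (normConst_pos d).le
  set M : (Fin d → ℤ) → (Fin d → ℤ) → ℂ := fun j k =>
    (normConst d : ℂ) * coeffX a (j - k) ((ħ / 2) • intVec (j + k)) with hM
  set H : (Fin d → ℤ) × (Fin d → ℤ) → ℂ := fun p => M p.1 p.2 * coeff ψ p.2 with hH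
  have hHs : Summable fun p => ‖H p‖ := by
    rw [← (diagEquiv (Fin d → ℤ)).summable_iff]
    have hb0 : ∀ l, 0 ≤ b l := fun l => (norm_nonneg _).trans (hab l 0)
    refine Summable.of_nonneg_of_le (fun _ => norm_nonneg _) (fun p => ?_)
      ((hb.mul_left (normConst d)).mul_of_nonneg hψ (fun l => mul_nonneg hnc (hb0 l))
        (fun m => norm_nonneg _))
    simp only [Function.comp_apply, hH, hM, diagEquiv, Equiv.coe_fn_mk, norm_mul, Complex.norm_real,
      Real.norm_of_nonneg hnc, add_sub_cancel_left]
    gcongr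
    exact hab _ _
  set c : (Fin d → ℤ) → ℂ := fun j => ∑' k, H (j, k) with hc
  have hcs : Summable fun j => ‖c j‖ :=
    Summable.of_nonneg_of_le (fun _ => norm_nonneg _)
      (fun j => norm_tsum_le_tsum_norm (hHs.prod_factor j)) hHs.prod
  obtain ⟨hdom, hφ⟩ := matrixOp_apply (M := M) (ψ := ψ) (φ := ofCoeff c) fun j => by
    rw [coeff_ofCoeff hcs]
    exact (hHs.of_norm.prod_factor j).hasSum
  have hw : wigner ħ ψ a = inner ℂ ψ (ofCoeff c) := by
    have h : wigner ħ ψ a = inner ℂ ψ (weylOp ħ a ⟨ψ, hdom⟩) := dif_pos hdom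
    rw [h]
    exact congrArg _ hφ
  have hin := hasSum_inner ψ (ofCoeff c) hψ
  simp only [coeff_ofCoeff hcs] at hin
  have hs : Summable fun p : (Fin d → ℤ) × (Fin d → ℤ) => (starRingEnd ℂ) (coeff ψ p.1) * H p := by
    refine Summable.of_norm_bounded (hHs.mul_left ‖ψ‖) fun p => ?_
    rw [norm_mul, RCLike.norm_conj]
    exact mul_le_mul_of_nonneg_right (norm_coeff_le _ _) (norm_nonneg _)
  have hsum : HasSum (fun p : (Fin d → ℤ) × (Fin d → ℤ) => (starRingEnd ℂ) (coeff ψ p.1) * H p)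
      (wigner ħ ψ a) := by
    rw [hw, ← hin.tsum_eq]
    convert hs.hasSum using 1
    rw [hs.tsum_prod]
    exact tsum_congr fun j => tsum_mul_left.symm
  have h2 := ((Equiv.prodCongr (Equiv.refl _) (Equiv.addLeft k)).trans
    (diagEquiv (Fin d → ℤ))).hasSum_iff.mpr hsum
  convert h2 using 1
  funext p
  simp only [Function.comp_apply, hH, hM, diagEquiv, Equiv.trans_apply, Equiv.prodCongr_apply,
    Equiv.coe_fn_mk, Equiv.refl_apply, Prod.map, Equiv.coe_addLeft, add_assoc]
  congr 4
  abel

/-- The correlations `∑_m conj (ψ̂(m + l)) ψ̂(m)` of Fourier coefficients. -/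
def correlation (ψ : L2T d) (l : Fin d → ℤ) : ℂ :=
  ∑' m, (starRingEnd ℂ) (coeff ψ (m + l)) * coeff ψ m

/-- The Fourier coefficients of `ψ_n`, translated by `k_n`, are dominated by a summable family, and
the correlations of `ψ_n` tend to those of an exponential. -/
structure IsConcentrating (ψ : ℕ → L2T d) (k : ℕ → Fin d → ℤ) : Prop where
  exists_bound : ∃ B : (Fin d → ℤ) → ℝ, Summable B ∧ ∀ n m, ‖coeff (ψ n) (k n + m)‖ ≤ B m
  tendsto_correlation : ∀ l, Tendsto (fun n => correlation (ψ n) l) atTop (𝓝 (if l = 0 then 1 else 0))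

namespace IsConcentrating

variable {ψ : ℕ → L2T d} {k : ℕ → Fin d → ℤ}

lemma summable_coeff (h : IsConcentrating ψ k) (n : ℕ) : Summable fun m => ‖coeff (ψ n) m‖ := by
  obtain ⟨B, hB, hle⟩ := h.exists_bound
  rw [← (Equiv.addLeft (k n)).summable_iff]
  exact Summable.of_nonneg_of_le (fun _ => norm_nonneg _) (hle n) hB

/-- Wigner distributions of a concentrating sequence. -/
lemma tendsto_wigner_sub (h : IsConcentrating ψ k) (ha : IsTestFunction a) {ħ : ℕ → ℝ}
    (hħ : Tendsto ħ atTop (𝓝 0)) :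
    Tendsto (fun n => wigner (ħ n) (ψ n) a - normConst d * coeffX a 0 (ħ n • intVec (k n))) atTop
      (𝓝 0) := by
  obtain ⟨b, hb, hab⟩ := ha.exists_summable_bound
  obtain ⟨B, hB, hle⟩ := h.exists_bound
  have hnc := (normConst_pos d).le
  have hb0 : ∀ l, 0 ≤ b l := fun l => (norm_nonneg _).trans (hab l 0)
  have hB0 : ∀ m, 0 ≤ B m := fun m => (norm_nonneg _).trans (hle 0 m)
  set K := ∑' m, B m with hK
  have hBK : ∀ m, B m ≤ K := fun m => hB.le_tsum m fun j _ => hB0 j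
  have hK0 : 0 ≤ K := tsum_nonneg hB0
  set ξ : ℕ → E d := fun n => ħ n • intVec (k n) with hξ
  set f : ℕ → (Fin d → ℤ) × (Fin d → ℤ) → ℂ := fun n p =>
    (starRingEnd ℂ) (coeff (ψ n) (k n + (p.2 + p.1))) * coeff (ψ n) (k n + p.2) with hf
  have hfle : ∀ n p, ‖f n p‖ ≤ K * B p.2 := fun n p => by
    rw [hf, norm_mul, RCLike.norm_conj]
    exact mul_le_mul ((hle n _).trans (hBK _)) (hle n _) (norm_nonneg _) hK0
  -- The error of evaluating `a` at `ħk` instead of the midpoint. The two points are at distance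
  -- `ħ|m + l/2|` whatever `k` is, so uniform continuity suffices even if `ħk` escapes to infinity.
  set g : ℕ → (Fin d → ℤ) × (Fin d → ℤ) → ℂ := fun n p => normConst d * (coeffX a p.1 ((ħ n / 2) •
    intVec (k n + (p.2 + p.1) + (k n + p.2))) - coeffX a p.1 (ξ n)) with hg
  have hgle : ∀ n p, ‖g n p‖ ≤ normConst d * (2 * b p.1) := fun n p => by
    rw [hg, norm_mul, Complex.norm_real, Real.norm_of_nonneg hnc]
    refine mul_le_mul_of_nonneg_left ((norm_sub_le _ _).trans ?_) hnc
    linarith [hab p.1 ((ħ n / 2) • intVec (k n + (p.2 + p.1) + (k n + p.2))), hab p.1 (ξ n)]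
  have hbound : Summable fun p : (Fin d → ℤ) × (Fin d → ℤ) =>
      (normConst d * (2 * b p.1)) * (K * B p.2) :=
    ((hb.mul_left 2).mul_left (normConst d)).mul_of_nonneg (hB.mul_left K)
      (fun l => mul_nonneg hnc (mul_nonneg zero_le_two (hb0 l))) (fun m => mul_nonneg hK0 (hB0 m))
  have hgf : ∀ n p, ‖g n p * f n p‖ ≤ (normConst d * (2 * b p.1)) * (K * B p.2) := fun n p => by
    rw [norm_mul]
    exact mul_le_mul (hgle n p) (hfle n p) (norm_nonneg _)
      (mul_nonneg hnc (mul_nonneg zero_le_two (hb0 _)))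
  have hg0 : ∀ p, Tendsto (fun n => g n p) atTop (𝓝 0) := fun p => by
    have hu := ha.uniformContinuous_coeffX p.1
    have hd : Tendsto (fun n => ((ħ n / 2) • intVec (k n + (p.2 + p.1) + (k n + p.2)), ξ n)) atTop
        (uniformity (E d)) := by
      rw [tendsto_uniformity_iff_dist_tendsto_zero]
      have e : ∀ n, dist ((ħ n / 2) • intVec (k n + (p.2 + p.1) + (k n + p.2))) (ξ n) =
          ‖ħ n‖ * ‖(1 / 2 : ℝ) • intVec (p.2 + p.1 + p.2)‖ := fun n => by
        rw [dist_eq_norm, ← norm_smul, hξ]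
        congr 1
        simp only [intVec_add]
        module
      simp only [e]
      simpa using hħ.norm.mul_const ‖(1 / 2 : ℝ) • intVec (p.2 + p.1 + p.2)‖
    have h2 := tendsto_uniformity_iff_dist_tendsto_zero.mp (Tendsto.comp hu hd)
    have h3 := h2.const_mul (normConst d)
    rw [mul_zero] at h3
    refine squeeze_zero_norm (fun n => ?_) h3
    rw [hg, norm_mul, Complex.norm_real, Real.norm_of_nonneg hnc, Function.comp_apply, dist_eq_norm]
  have hD : Tendsto (fun n => ∑' p, g n p * f n p) atTop (𝓝 0) := by
    have := tendsto_tsum_of_dominated_convergence (𝓕 := atTop) (g := fun _ => (0 : ℂ)) hbound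
      (fun p => ?_) (Eventually.of_forall fun n p => hgf n p)
    · rwa [tsum_zero] at this
    · have h2 := (hg0 p).norm.mul_const (K * B p.2)
      rw [norm_zero, zero_mul] at h2
      refine squeeze_zero_norm (fun n => ?_) h2
      rw [norm_mul]
      exact mul_le_mul_of_nonneg_left (hfle n p) (norm_nonneg _)
  have hcorr : ∀ n l, correlation (ψ n) l = ∑' m, f n (l, m) := fun n l => by
    rw [correlation, ← (Equiv.addLeft (k n)).tsum_eq]
    simp only [hf, Equiv.coe_addLeft, add_assoc]
  have hcle : ∀ n l, ‖correlation (ψ n) l‖ ≤ K * K := fun n l => by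
    rw [hcorr]
    exact tsum_of_norm_bounded (hB.hasSum.mul_left K) fun m => hfle n (l, m)
  -- Once frozen at `ħk`, the symbol enters only through the correlations, and only `l = 0` survives
  -- in the limit.
  have hE : Tendsto (fun n => ∑' l, normConst d * coeffX a l (ξ n) *
      (correlation (ψ n) l - if l = 0 then 1 else 0)) atTop (𝓝 0) := by
    have hle2 : ∀ n l, ‖normConst d * coeffX a l (ξ n)‖ ≤ normConst d * b l := fun n l => by
      rw [norm_mul, Complex.norm_real, Real.norm_of_nonneg hnc]
      exact mul_le_mul_of_nonneg_left (hab _ _) hnc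
    have := tendsto_tsum_of_dominated_convergence (𝓕 := atTop) (g := fun _ => (0 : ℂ))
      (f := fun n l => normConst d * coeffX a l (ξ n) *
        (correlation (ψ n) l - if l = 0 then 1 else 0))
      ((hb.mul_left (normConst d)).mul_right (K * K + 1))
      (fun l => ?_) (Eventually.of_forall fun n l => ?_)
    · rwa [tsum_zero] at this
    · have h2 := ((h.tendsto_correlation l).sub_const (if l = 0 then 1 else 0)).norm.const_mul
        (normConst d * b l)
      rw [sub_self, norm_zero, mul_zero] at h2
      refine squeeze_zero_norm (fun n => ?_) h2
      rw [norm_mul]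
      exact mul_le_mul_of_nonneg_right (hle2 n l) (norm_nonneg _)
    · rw [norm_mul]
      refine mul_le_mul (hle2 n l) ((norm_sub_le _ _).trans (add_le_add (hcle n l) ?_))
        (norm_nonneg _) (mul_nonneg hnc (hb0 l))
      split_ifs <;> simp
  have hDE := hD.add hE
  rw [add_zero] at hDE
  refine hDE.congr fun n => ?_
  have hsw := hasSum_wigner ha (ħ n) (h.summable_coeff n) (k n)
  have hs1 : Summable fun p => g n p * f n p := Summable.of_norm_bounded hbound (hgf n)
  have hs2 : Summable fun p : (Fin d → ℤ) × (Fin d → ℤ) => normConst d * coeffX a p.1 (ξ n) * f n p := by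
    refine Summable.of_norm_bounded ((hb.mul_left (normConst d)).mul_of_nonneg (hB.mul_left K)
      (fun l => mul_nonneg hnc (hb0 l)) fun m => mul_nonneg hK0 (hB0 m)) fun p => ?_
    rw [norm_mul, norm_mul, Complex.norm_real, Real.norm_of_nonneg hnc]
    exact mul_le_mul (mul_le_mul_of_nonneg_left (hab _ _) hnc) (hfle n p) (norm_nonneg _)
      (mul_nonneg hnc (hb0 _))
  have hw : wigner (ħ n) (ψ n) a =
      ∑' p, g n p * f n p + ∑' l, normConst d * coeffX a l (ξ n) * correlation (ψ n) l := by
    rw [← hsw.tsum_eq]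
    have e : ∑' l, normConst d * coeffX a l (ξ n) * correlation (ψ n) l =
        ∑' p : (Fin d → ℤ) × (Fin d → ℤ), normConst d * coeffX a p.1 (ξ n) * f n p := by
      rw [hs2.tsum_prod]
      refine tsum_congr fun l => ?_
      rw [hcorr, ← tsum_mul_left]
    rw [e, ← hs1.tsum_add hs2]
    refine tsum_congr fun p => ?_
    simp only [hg, hf]
    ring
  have hs3 : Summable fun l => normConst d * coeffX a l (ξ n) * correlation (ψ n) l := by
    refine Summable.of_norm_bounded ((hb.mul_left (normConst d)).mul_right (K * K)) fun l => ?_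
    rw [norm_mul, norm_mul, Complex.norm_real, Real.norm_of_nonneg hnc]
    exact mul_le_mul (mul_le_mul_of_nonneg_left (hab _ _) hnc) (hcle n l) (norm_nonneg _)
      (mul_nonneg hnc (hb0 _))
  have hδ : HasSum (fun l : Fin d → ℤ => normConst d * coeffX a l (ξ n) * (if l = 0 then 1 else 0))
      (normConst d * coeffX a 0 (ξ n)) := by
    convert hasSum_ite_eq (0 : Fin d → ℤ) ((normConst d : ℂ) * coeffX a 0 (ξ n)) using 2 with l
    split_ifs with hl
    · rw [hl, mul_one]
    · rw [mul_zero]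
  simp only [mul_sub]
  rw [hs3.tsum_sub hδ.summable, hδ.tsum_eq, hw]
  ring

end IsConcentrating

end Wigner

/-! ### Densities -/

section Density

variable {d : ℕ}

instance : IsProbabilityMeasure (normalizedLebesgue d) := by
  refine ⟨?_⟩
  have h : (volume : Measure (Torus d)) Set.univ = ENNReal.ofReal ((2 * Real.pi) ^ d) := by
    rw [← Set.pi_univ Set.univ, volume_pi_pi]
    simp [AddCircle.measure_univ, ENNReal.ofReal_pow Real.two_pi_pos.le]
  rw [normalizedLebesgue, Measure.smul_apply, h, smul_eq_mul, ← ENNReal.ofReal_mul (by positivity),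
    inv_mul_cancel₀ (by positivity), ENNReal.ofReal_one]

lemma integral_normalizedLebesgue (f : Torus d → ℂ) :
    ∫ x, f x ∂(normalizedLebesgue d) = normConst d * coeff f 0 := by
  rw [normalizedLebesgue, integral_smul_measure, ENNReal.toReal_ofReal (by positivity), coeff,
    neg_zero, ← mul_assoc, Complex.real_smul]
  have h := normConst_sq_mul d
  have h2 : ((2 * Real.pi) ^ d)⁻¹ = normConst d * normConst d := by
    field_simp
    linarith
  rw [h2]
  simp [character_zero]

lemma integrable_mul_normSq (b : C(Torus d, ℂ)) (ψ : L2T d) :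
    Integrable fun x => b x * ((‖ψ x‖ ^ 2 : ℝ) : ℂ) := by
  have h1 : Integrable fun x => ((‖ψ x‖ ^ 2 : ℝ) : ℂ) :=
    ((Lp.memLp ψ).integrable_norm_pow (by norm_num)).ofReal
  exact h1.bdd_mul (c := ‖b‖) b.continuous.aestronglyMeasurable
    (Eventually.of_forall fun x => b.norm_coe_le_norm x)

lemma integral_normSq (ψ : L2T d) : ∫ x, ‖ψ x‖ ^ 2 = ‖ψ‖ ^ 2 := by
  have h : (inner ℂ ψ ψ : ℂ) = ((∫ x, ‖ψ x‖ ^ 2 : ℝ) : ℂ) := by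
    rw [L2.inner_def, ← integral_complex_ofReal]
    refine integral_congr_ae (Eventually.of_forall fun x => ?_)
    simp only [inner_self_eq_norm_sq_to_K]
    norm_cast
  rw [inner_self_eq_norm_sq_to_K] at h
  refine Complex.ofReal_injective ?_
  rw [← h, Complex.ofReal_pow]
  rfl

lemma norm_integral_mul_normSq_le (b : C(Torus d, ℂ)) (ψ : L2T d) :
    ‖∫ x, b x * ((‖ψ x‖ ^ 2 : ℝ) : ℂ)‖ ≤ ‖b‖ * ‖ψ‖ ^ 2 := by
  rw [← integral_normSq, ← integral_const_mul]
  refine norm_integral_le_of_norm_le (((Lp.memLp ψ).integrable_norm_pow (by norm_num)).const_mul _)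
    (Eventually.of_forall fun x => ?_)
  rw [norm_mul, Complex.norm_real, Real.norm_of_nonneg (by positivity)]
  exact mul_le_mul_of_nonneg_right (b.norm_coe_le_norm x) (by positivity)

lemma integral_character_mul_normSq (l : Fin d → ℤ) (ψ : L2T d) (h : Summable fun k => ‖coeff ψ k‖) :
    ∫ x, character l x * ((‖ψ x‖ ^ 2 : ℝ) : ℂ) = correlation ψ l := by
  rw [← (hasSum_integral_character_mul l ψ h).tsum_eq, correlation, ← (Equiv.addRight l).tsum_eq]
  simp

/-- Densities of a concentrating sequence. -/
lemma IsConcentrating.tendsto_integral {ψ : ℕ → L2T d} {k : ℕ → Fin d → ℤ} (h : IsConcentrating ψ k)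
    (hψ : ∀ n, ‖ψ n‖ = 1) (b : C(Torus d, ℂ)) :
    Tendsto (fun n => ∫ x, b x * ((‖ψ n x‖ ^ 2 : ℝ) : ℂ)) atTop
      (𝓝 (∫ x, b x ∂(normalizedLebesgue d))) := by
  have hint : ∀ b : C(Torus d, ℂ), Integrable (fun x => b x) (normalizedLebesgue d) := fun b =>
    b.continuous.integrable_of_hasCompactSupport (HasCompactSupport.of_compactSpace _)
  have hspan : ∀ b ∈ Submodule.span ℂ (Set.range (character (d := d))),
      Tendsto (fun n => ∫ x, b x * ((‖ψ n x‖ ^ 2 : ℝ) : ℂ)) atTop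
        (𝓝 (∫ x, b x ∂(normalizedLebesgue d))) := by
    intro b hb
    induction hb using Submodule.span_induction with
    | mem b hb =>
      obtain ⟨l, rfl⟩ := hb
      simp only [fun n => integral_character_mul_normSq l (ψ n) (h.summable_coeff n)]
      have e : ∫ x, character l x ∂(normalizedLebesgue d) = if l = 0 then 1 else 0 := by
        rw [integral_normalizedLebesgue, coeff_character]
        have h3 : (normConst d : ℂ) * (normConst d * ((2 * Real.pi) ^ d : ℝ)) = 1 := by
          rw [← mul_assoc]; exact_mod_cast normConst_sq_mul d
        split_ifs
        · exact h3
        · rw [mul_zero]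
      rw [e]
      exact h.tendsto_correlation l
    | zero => simp
    | add f g _ _ hf hg =>
      simp only [ContinuousMap.add_apply, add_mul]
      rw [integral_add (hint f) (hint g)]
      refine (hf.add hg).congr fun n => ?_
      rw [integral_add (integrable_mul_normSq f _) (integrable_mul_normSq g _)]
    | smul c f _ hf =>
      simp only [ContinuousMap.smul_apply, smul_eq_mul, mul_assoc, integral_const_mul]
      exact hf.const_mul c
  rw [Metric.tendsto_atTop]
  intro ε hε
  have hb : b ∈ closure (Submodule.span ℂ (Set.range (character (d := d))) : Set C(Torus d, ℂ)) := by
    rw [← Submodule.topologicalClosure_coe, span_character_dense]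
    trivial
  -- Trigonometric polynomials approximate `b` uniformly, and the densities all have mass one, so
  -- the error is uniform in `n`.
  obtain ⟨b', hb', hbb'⟩ := Metric.mem_closure_iff.mp hb (ε / 3) (by positivity)
  rw [dist_eq_norm] at hbb'
  obtain ⟨N, hN⟩ := Metric.tendsto_atTop.mp (hspan b' hb') (ε / 3) (by positivity)
  refine ⟨N, fun n hn => ?_⟩
  have h1 : ‖(∫ x, b x * ((‖ψ n x‖ ^ 2 : ℝ) : ℂ)) - ∫ x, b' x * ((‖ψ n x‖ ^ 2 : ℝ) : ℂ)‖ < ε / 3 := by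
    rw [← integral_sub (integrable_mul_normSq b _) (integrable_mul_normSq b' _)]
    have h3 := norm_integral_mul_normSq_le (b - b') (ψ n)
    rw [hψ, one_pow, mul_one] at h3
    simp only [ContinuousMap.sub_apply, sub_mul] at h3
    exact h3.trans_lt hbb'
  have h2 : ‖(∫ x, b' x ∂(normalizedLebesgue d)) - ∫ x, b x ∂(normalizedLebesgue d)‖ < ε / 3 := by
    rw [← integral_sub (hint b') (hint b)]
    have h3 : ‖∫ x, (b' x - b x) ∂(normalizedLebesgue d)‖ ≤
        ‖b - b'‖ * (normalizedLebesgue d).real Set.univ := by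
      refine norm_integral_le_of_norm_le_const (Eventually.of_forall fun x => ?_)
      rw [norm_sub_rev]
      exact (b - b').norm_coe_le_norm x
    rw [probReal_univ, mul_one] at h3
    exact h3.trans_lt hbb'
  have h3 := hN n hn
  rw [dist_eq_norm] at h3 ⊢
  calc _ = ‖((∫ x, b x * ((‖ψ n x‖ ^ 2 : ℝ) : ℂ)) - ∫ x, b' x * ((‖ψ n x‖ ^ 2 : ℝ) : ℂ)) +
      ((∫ x, b' x * ((‖ψ n x‖ ^ 2 : ℝ) : ℂ)) - ∫ x, b' x ∂(normalizedLebesgue d)) +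
      ((∫ x, b' x ∂(normalizedLebesgue d)) - ∫ x, b x ∂(normalizedLebesgue d))‖ := by
        congr 1; ring
    _ ≤ _ := norm_add₃_le
    _ < ε := by linarith

end Density

end

section

/-! ### Diagonalized operators and their eigenfunctions -/

section Diagonalized

variable {d : ℕ} {s : ℝ} [hs : Fact (0 < s)] {ħ r : ℝ}

lemma exists_le_add_exp {U : CrossedProduct (shiftAction d s ħ)}
    (hU : CrossedProduct.NormLE (latticeNorm d) r (U - 1) (1 / 8)) (m : Fin d → ℤ) :
    ‖U m‖ ≤ (if m = 0 then 1 else 0) + Real.exp (-(r * ‖intVec m‖)) := by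
  have h1 : ‖(U - 1) m‖ * Real.exp (r * ‖intVec m‖) ≤ 1 / 8 := by
    have h2 : ‖(U - 1) m‖ₑ * expWeight (latticeNorm d) r m ≤ ENNReal.ofReal (1 / 8) :=
      (ENNReal.le_tsum m).trans hU.2
    rw [← ofReal_norm, expWeight, latticeNorm_apply, ← ENNReal.ofReal_mul (norm_nonneg _)] at h2
    exact (ENNReal.ofReal_le_ofReal_iff (by norm_num)).mp h2
  have h2 : ‖(U - 1) m‖ ≤ Real.exp (-(r * ‖intVec m‖)) := by
    rw [Real.exp_neg, ← one_div, le_div_iff₀ (Real.exp_pos _)]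
    linarith
  have h3 : ‖(1 : CrossedProduct (shiftAction d s ħ)) m‖ ≤ if m = 0 then 1 else 0 := by
    rw [CrossedProduct.one_def]
    split_ifs with h
    · rw [h, CrossedProduct.diag_apply_zero, norm_one]
    · rw [CrossedProduct.diag_apply_ne _ h, norm_zero]
  calc ‖U m‖ = ‖(1 : CrossedProduct (shiftAction d s ħ)) m + (U - 1) m‖ := by
        rw [CrossedProduct.sub_apply, add_sub_cancel]
    _ ≤ _ := (norm_add_le _ _).trans (add_le_add h3 h2)

/-- The operator `A` is diagonalized by `U`, which is close to `1`, with eigenvalues `ħ ω · k`. -/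
structure IsDiagonalizedBy (r : ℝ) (ω : E d) (A : L2T d →ₗ.[ℂ] L2T d)
    (U : CrossedProduct (shiftAction d s ħ)) : Prop where
  near : CrossedProduct.NormLE (latticeNorm d) r (U - 1) (1 / 8)
  orthogonal : ∀ k k', k ≠ k' → ∑' j, (starRingEnd ℂ) (mat U 0 j k) * mat U 0 j k' = 0
  ne_zero : ∀ k, ∑' j, (starRingEnd ℂ) (mat U 0 j k) * mat U 0 j k ≠ 0
  eigenEq : ∀ (ψ : L2T d) (c : ℂ) (k : Fin d → ℤ), (∀ j, coeff ψ j = c * mat U 0 j k) →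
    EigenEq A ((ħ * inner ℝ ω (intVec k) : ℝ) : ℂ) ψ
  exists_col : ∀ (ψ : L2T d) (z : ℂ), ψ ≠ 0 → EigenEq A z ψ →
    ∃ (k : Fin d → ℤ) (c : ℂ), z = ((ħ * inner ℝ ω (intVec k) : ℝ) : ℂ) ∧
      ∀ j, coeff ψ j = c * mat U 0 j k

namespace IsDiagonalizedBy

variable {ω : E d} {A : L2T d →ₗ.[ℂ] L2T d} {U : CrossedProduct (shiftAction d s ħ)}

lemma norm_le (h : IsDiagonalizedBy r ω A U) (hr : 0 ≤ r) : ‖U‖ ≤ 9 / 8 :=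
  ((CrossedProduct.NormLE.of_sub_one h.near).norm_le hr).trans (by norm_num)

/-- The `k`-th coefficient of `ψ` is `c U_{kk}` with `|U_{kk}| ≥ 7/8`, and it is at most `‖ψ‖ = 1`.
-/
lemma norm_factor_le (h : IsDiagonalizedBy r ω A U) (hr : 0 ≤ r) {ψ : L2T d} {c : ℂ} {k : Fin d → ℤ}
    (hψ : ∀ j, coeff ψ j = c * mat U 0 j k) (hψ1 : ‖ψ‖ = 1) : ‖c‖ ≤ 2 := by
  have h1 : ‖mat (U - 1) 0 k k‖ ≤ 1 / 8 := (norm_mat_le _ _ _ _).trans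
    ((CrossedProduct.norm_apply_le _ _).trans (h.near.norm_le hr))
  rw [mat_sub, mat_one, if_pos rfl] at h1
  have h2 := norm_sub_norm_le (1 : ℂ) (mat U 0 k k)
  rw [norm_sub_rev, norm_one] at h2
  have h3 := norm_coeff_le ψ k
  rw [hψ, norm_mul, hψ1] at h3
  nlinarith [norm_nonneg c]

lemma norm_coeff_le (h : IsDiagonalizedBy r ω A U) (hr : 0 ≤ r) {ψ : L2T d} {c : ℂ} {k : Fin d → ℤ}
    (hψ : ∀ j, coeff ψ j = c * mat U 0 j k) (hψ1 : ‖ψ‖ = 1) (m : Fin d → ℤ) :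
    ‖coeff ψ (k + m)‖ ≤ 2 * ((if m = 0 then 1 else 0) + Real.exp (-(r * ‖intVec m‖))) := by
  rw [hψ, norm_mul]
  refine mul_le_mul (h.norm_factor_le hr hψ hψ1) ?_ (norm_nonneg _) zero_le_two
  have := norm_mat_le U 0 (k + m) k
  rw [add_sub_cancel_left] at this
  exact this.trans (exists_le_add_exp h.near m)

lemma correlation_zero {ψ : L2T d} (hψ : Summable fun k => ‖coeff ψ k‖) (hψ1 : ‖ψ‖ = 1) :
    correlation ψ 0 = 1 := by
  have h1 := (hasSum_inner ψ ψ hψ).tsum_eq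
  rw [inner_self_eq_norm_sq_to_K, hψ1] at h1
  simp only [correlation, add_zero, h1]
  simp

/-- The entries `(j + l, k)` and `(j, k - l)` of `U` are the same coefficient at points `ħk` and
`ħ(k - l)`, hence differ by `O(ħ|l|/s)`. Replacing one by the other turns the correlation into the
scalar product of columns `k - l` and `k`, which vanishes. The constant `8` comes from `|c|² ≤ 4`
and `‖U‖² ≤ 2`. -/
lemma norm_correlation_le (h : IsDiagonalizedBy r ω A U) (hr : 0 ≤ r) (hħ : 0 ≤ ħ) {ψ : L2T d} {c : ℂ}
    {k : Fin d → ℤ} (hψ : ∀ j, coeff ψ j = c * mat U 0 j k) (hψ1 : ‖ψ‖ = 1) {l : Fin d → ℤ}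
    (hl : l ≠ 0) : ‖correlation ψ l‖ ≤ 8 * (ħ * ‖intVec l‖ / s) := by
  have hs0 := hs.out
  have hU := h.norm_le hr
  have hc := h.norm_factor_le hr hψ hψ1
  have hsum1 : Summable fun j => (starRingEnd ℂ) (mat U 0 j (k - l)) * mat U 0 j k := by
    refine Summable.of_norm_bounded ((summable_mat_col U 0 k).mul_left ‖U‖) fun j => ?_
    rw [norm_mul, RCLike.norm_conj]
    exact mul_le_mul_of_nonneg_right (IsConjugation.bound_col 0 _ _) (norm_nonneg _)
  set f : (Fin d → ℤ) → ℂ := fun j =>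
    (starRingEnd ℂ) (mat U 0 (j + l) k - mat U 0 j (k - l)) * mat U 0 j k with hf
  have hdiff : ∀ j, ‖mat U 0 (j + l) k - mat U 0 j (k - l)‖ ≤ ‖U‖ * (ħ * ‖intVec l‖ / s) := fun j => by
    have e : j + l - k = j - (k - l) := by abel
    rw [mat, mat, e]
    refine (Symb.norm_sub_apply_le _ _ _).trans ?_
    have e2 : (0 : E d) + ħ • intVec k - (0 + ħ • intVec (k - l)) = ħ • intVec l := by
      rw [intVec_sub]; module
    rw [e2, norm_smul, Real.norm_of_nonneg hħ]
    exact mul_le_mul_of_nonneg_right (CrossedProduct.norm_apply_le _ _)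
      (div_nonneg (mul_nonneg hħ (norm_nonneg _)) hs0.le)
  have hfle : ∀ j, ‖f j‖ ≤ ‖U‖ * (ħ * ‖intVec l‖ / s) * ‖mat U 0 j k‖ := fun j => by
    rw [hf, norm_mul, RCLike.norm_conj]
    exact mul_le_mul_of_nonneg_right (hdiff j) (norm_nonneg _)
  have hfs : Summable f := Summable.of_norm_bounded ((summable_mat_col U 0 k).mul_left _) hfle
  have hcorr : correlation ψ l = (starRingEnd ℂ) c * c * ∑' j, f j := by
    have e : ∑' j, (starRingEnd ℂ) (mat U 0 (j + l) k) * mat U 0 j k = ∑' j, f j := by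
      have h1 := h.orthogonal (k - l) k (fun h' => hl (by simpa using h'))
      have h2 := hfs.tsum_add hsum1
      rw [h1, add_zero] at h2
      rw [← h2]
      refine tsum_congr fun j => ?_
      simp only [hf, map_sub]
      ring
    rw [correlation, ← e, ← tsum_mul_left]
    refine tsum_congr fun j => ?_
    rw [hψ, hψ, map_mul]
    ring
  have hq : 0 ≤ ħ * ‖intVec l‖ / s := div_nonneg (mul_nonneg hħ (norm_nonneg _)) hs0.le
  have hfn : ‖∑' j, f j‖ ≤ ‖U‖ * (ħ * ‖intVec l‖ / s) * ‖U‖ := by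
    refine (tsum_of_norm_bounded ((summable_mat_col U 0 k).hasSum.mul_left _) hfle).trans ?_
    exact mul_le_mul_of_nonneg_left (tsum_mat_col_le U 0 k) (mul_nonneg (norm_nonneg _) hq)
  rw [hcorr, norm_mul, norm_mul, RCLike.norm_conj]
  have h1 : ‖U‖ * (ħ * ‖intVec l‖ / s) * ‖U‖ ≤ 2 * (ħ * ‖intVec l‖ / s) := by
    have : ‖U‖ * ‖U‖ ≤ 2 := by nlinarith [norm_nonneg U]
    nlinarith
  calc ‖c‖ * ‖c‖ * ‖∑' j, f j‖ ≤ (2 * 2) * (2 * (ħ * ‖intVec l‖ / s)) := by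
        refine mul_le_mul (mul_le_mul hc hc (norm_nonneg _) zero_le_two) (hfn.trans h1) (norm_nonneg _)
          (by norm_num)
    _ = _ := by ring

/-- Each eigenvalue has a normalized eigenfunction. -/
lemma exists_eigenfunction (h : IsDiagonalizedBy r ω A U) (k : Fin d → ℤ) :
    ∃ ψ : L2T d, ‖ψ‖ = 1 ∧ EigenEq A ((ħ * inner ℝ ω (intVec k) : ℝ) : ℂ) ψ ∧
      ∃ c : ℂ, ∀ j, coeff ψ j = c * mat U 0 j k := by
  set φ : L2T d := ofCoeff fun j => 1 * mat U 0 j k with hφ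
  have hc : ∀ j, coeff φ j = 1 * mat U 0 j k := coeff_ofCoeff (IsConjugation.summable_col 0 k 1)
  have hφ0 : φ ≠ 0 := fun h0 => by
    refine h.ne_zero k ?_
    have hz : ∀ j, mat U 0 j k = 0 := fun j => by rw [← one_mul (mat U 0 j k), ← hc j, h0, coeff_zero]
    simp only [hz, mul_zero, tsum_zero]
  have hcol : ∀ j, coeff (((‖φ‖⁻¹ : ℝ) : ℂ) • φ : L2T d) j = ((‖φ‖⁻¹ : ℝ) : ℂ) * mat U 0 j k := fun j => by
    rw [coeff_smul, hc, one_mul]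
  refine ⟨((‖φ‖⁻¹ : ℝ) : ℂ) • φ, ?_, h.eigenEq _ _ k hcol, _, hcol⟩
  rw [norm_smul, Complex.norm_real, norm_inv, norm_norm, inv_mul_cancel₀ (norm_ne_zero_iff.mpr hφ0)]

end IsDiagonalizedBy

open CrossedProduct in
lemma IsConjugation.isDiagonalizedBy {ω : E d} {V U U' : CrossedProduct (shiftAction d s ħ)} {R : Symb d s}
    (h : IsConjugation ω V U U' R) (hħ : ħ ≠ 0) (hω : ∀ k, freq ω k = 0 → k = 0)
    (hU : NormLE (latticeNorm d) r (U - 1) (1 / 8)) :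
    IsDiagonalizedBy r ω (Lhat ω ħ + (ħ : ℂ) • pertOp V R) U where
  near := hU
  orthogonal _ _ hk := h.tsum_conj_mul_col_eq_zero hω 0 hk
  ne_zero := h.normSq_col_ne_zero 0
  eigenEq _ _ _ hψ := h.eigenEq_of_col hψ
  exists_col _ _ h0 hψ := h.exists_col_of_eigenEq hħ hω h0 hψ

/-- The unperturbed operator is the case `U = 1`, so that one computation of the limits serves both
families. -/
lemma isDiagonalizedBy_Lhat {ω : E d} (hħ : ħ ≠ 0) (hω : ∀ k, freq ω k = 0 → k = 0) :
    IsDiagonalizedBy r ω (Lhat ω ħ) (1 : CrossedProduct (shiftAction d s ħ)) where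
  near := by
    rw [sub_self]
    exact CrossedProduct.NormLE.zero.mono (by norm_num)
  orthogonal k k' hk := by
    simp only [mat_one]
    rw [tsum_eq_single k fun j hj => by simp [hj]]
    simp [hk]
  ne_zero k := by
    simp only [mat_one]
    rw [tsum_eq_single k fun j hj => by simp [hj]]
    simp
  eigenEq ψ c k hψ := by
    rw [eigenEq_Lhat]
    intro j
    rw [hψ, mat_one]
    split_ifs with h
    · rw [h]
    · simp
  exists_col ψ z h0 hψ := by
    rw [eigenEq_Lhat] at hψ
    obtain ⟨k, hk⟩ : ∃ k, coeff ψ k ≠ 0 := by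
      by_contra hcon
      push Not at hcon
      exact h0 (eq_zero_of_coeff ψ hcon)
    have hz := mul_right_cancel₀ hk (hψ k)
    refine ⟨k, coeff ψ k, hz.symm, fun j => ?_⟩
    rw [mat_one]
    split_ifs with h
    · rw [h, mul_one]
    · rw [mul_zero]
      by_contra hj
      have h1 := (mul_right_cancel₀ hj (hψ j)).trans hz.symm
      have h2 : ħ * inner ℝ ω (intVec j) = ħ * inner ℝ ω (intVec k) := by exact_mod_cast h1
      have h3 := mul_left_cancel₀ hħ h2
      refine h (sub_eq_zero.mp (hω _ ?_))
      rw [map_sub, freq_apply, freq_apply, h3, sub_self]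

variable {ω : E d} {A : ℝ → L2T d →ₗ.[ℂ] L2T d} {U : ∀ ħ : ℝ, CrossedProduct (shiftAction d s ħ)}

/-- The exponential bound around `k` and the decay of correlations hold with constants independent
of `ħ`, which is all that concentration requires. -/
lemma isConcentrating_of_col (h : ∀ ħ ∈ Set.Ioc (0 : ℝ) 1, IsDiagonalizedBy r ω (A ħ) (U ħ)) (hr : 0 < r)
    {ħ : ℕ → ℝ} (hħ : ∀ n, ħ n ∈ Set.Ioc (0 : ℝ) 1) (hħ0 : Tendsto ħ atTop (𝓝 0)) {ψ : ℕ → L2T d}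
    {k : ℕ → Fin d → ℤ} {c : ℕ → ℂ} (hψ1 : ∀ n, ‖ψ n‖ = 1)
    (hψ : ∀ n j, coeff (ψ n) j = c n * mat (U (ħ n)) 0 j (k n)) : IsConcentrating ψ k := by
  have hB : Summable fun m : Fin d → ℤ =>
      2 * ((if m = 0 then 1 else 0) + Real.exp (-(r * ‖intVec m‖))) :=
    (((hasSum_ite_eq (0 : Fin d → ℤ) (1 : ℝ)).summable).add (summable_exp_neg_norm_intVec d hr)).mul_left 2
  have hle : ∀ n m, ‖coeff (ψ n) (k n + m)‖ ≤
      2 * ((if m = 0 then 1 else 0) + Real.exp (-(r * ‖intVec m‖))) := fun n m =>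
    (h _ (hħ n)).norm_coeff_le hr.le (hψ n) (hψ1 n) m
  refine ⟨⟨_, hB, hle⟩, fun l => ?_⟩
  split_ifs with hl
  · subst hl
    have hsum : ∀ n, Summable fun m => ‖coeff (ψ n) m‖ := fun n => by
      rw [← (Equiv.addLeft (k n)).summable_iff]
      exact Summable.of_nonneg_of_le (fun _ => norm_nonneg _) (hle n) hB
    simp only [fun n => IsDiagonalizedBy.correlation_zero (hsum n) (hψ1 n)]
    exact tendsto_const_nhds
  · have h1 : Tendsto (fun n => 8 * (ħ n * ‖intVec l‖ / s)) atTop (𝓝 0) := by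
      simpa using (((hħ0.mul_const ‖intVec l‖).div_const s).const_mul 8)
    exact squeeze_zero_norm (fun n =>
      (h _ (hħ n)).norm_correlation_le hr.le (hħ n).1.le (hψ n) (hψ1 n) hl) h1

/-- Eigenfunction sequences concentrate at lattice points. -/
lemma exists_isConcentrating (h : ∀ ħ ∈ Set.Ioc (0 : ℝ) 1, IsDiagonalizedBy r ω (A ħ) (U ħ))
    (hr : 0 < r) {ħ : ℕ → ℝ} {z : ℕ → ℂ} {ψ : ℕ → L2T d} (hψ : IsEigenSequence A ħ z ψ) :
    ∃ k : ℕ → Fin d → ℤ, IsConcentrating ψ k ∧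
      Tendsto (fun n => inner ℝ ω (ħ n • intVec (k n))) atTop (𝓝 (1 : ℝ)) := by
  obtain ⟨hħ, hħ0, hz, hE⟩ := hψ
  choose k c hk hc using fun n => (h _ (hħ n)).exists_col (ψ n) (z n)
    (norm_ne_zero_iff.mp (by rw [(hE n).1]; exact one_ne_zero)) (hE n).2
  refine ⟨k, isConcentrating_of_col h hr hħ hħ0 (fun n => (hE n).1) hc, ?_⟩
  have h1 := (Complex.continuous_re.tendsto _).comp hz
  refine h1.congr fun n => ?_
  rw [Function.comp_apply, hk, Complex.ofReal_re, inner_smul_right]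

/-- Eigenfunction sequences concentrating at prescribed lattice points. -/
lemma exists_isEigenSequence (h : ∀ ħ ∈ Set.Ioc (0 : ℝ) 1, IsDiagonalizedBy r ω (A ħ) (U ħ))
    (hr : 0 < r) {ħ : ℕ → ℝ} (hħ : ∀ n, ħ n ∈ Set.Ioc (0 : ℝ) 1) (hħ0 : Tendsto ħ atTop (𝓝 0))
    {k : ℕ → Fin d → ℤ}
    (hk : Tendsto (fun n => inner ℝ ω (ħ n • intVec (k n))) atTop (𝓝 (1 : ℝ))) :
    ∃ (z : ℕ → ℂ) (ψ : ℕ → L2T d), IsEigenSequence A ħ z ψ ∧ IsConcentrating ψ k := by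
  choose ψ hψ1 hψ c hc using fun n => (h _ (hħ n)).exists_eigenfunction (k n)
  refine ⟨_, ψ, ⟨hħ, hħ0, ?_, fun n => ⟨hψ1 n, hψ n⟩⟩, isConcentrating_of_col h hr hħ hħ0 hψ1 hc⟩
  have h1 := (Complex.continuous_ofReal.tendsto _).comp hk
  rw [Complex.ofReal_one] at h1
  refine h1.congr fun n => ?_
  rw [Function.comp_apply, inner_smul_right]

end Diagonalized

end

section

/-! ### Measures are determined by test functions -/

section Measures

variable {d : ℕ} {a : Phase d → ℂ}

/-- The embedding of `T*𝕋ᵈ` into `ℂᵈ × ℝᵈ`. -/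
def phaseEmbedding (p : Phase d) : (Fin d → ℂ) × E d := (fun i => fourier 1 (p.1 i), p.2)

/-- Test functions are pulled back from a vector space, where every open set is the support of a
smooth function. -/
lemma isInducing_phaseEmbedding : IsInducing (phaseEmbedding (d := d)) := by
  have h1 : IsClosedEmbedding fun (x : Torus d) (i : Fin d) => (fourier 1 (x i) : ℂ) := by
    refine Continuous.isClosedEmbedding (by fun_prop) fun x y h => funext fun i => ?_
    have := congrFun h i
    simp only [fourier_one] at this
    exact AddCircle.injective_toCircle Real.two_pi_pos.ne' (Circle.ext this)
  exact (h1.isEmbedding.prodMap IsEmbedding.id).isInducing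

lemma contDiff_phaseEmbedding : ContDiff ℝ ((⊤ : ℕ∞) : WithTop ℕ∞)
    fun p : E d × E d => phaseEmbedding (toTorus p.1, p.2) := by
  refine ContDiff.prodMk (contDiff_pi.mpr fun i => ?_) contDiff_snd
  have h : ∀ p : E d × E d, (fourier 1 (toTorus p.1 i) : ℂ) = Complex.exp ((p.1 i : ℂ) * Complex.I) := by
    intro p
    rw [toTorus, fourier_coe_apply]
    congr 1
    have : (Real.pi : ℂ) ≠ 0 := by exact_mod_cast Real.pi_ne_zero
    push_cast
    field_simp
  simp only [h]
  have h2 : ContDiff ℝ ((⊤ : ℕ∞) : WithTop ℕ∞) fun p : E d × E d => p.1 i :=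
    ((EuclideanSpace.proj (𝕜 := ℝ) i).contDiff).comp contDiff_fst
  exact ((Complex.ofRealCLM.contDiff.comp h2).mul contDiff_const).cexp

/-- The indicator of a relatively compact open set is an increasing limit of test functions. -/
lemma exists_testFunction_tendsto {V : Set (Phase d)} (hV : IsOpen V) (hVc : IsCompact (closure V)) :
    ∃ f : ℕ → Phase d → ℝ, (∀ n, IsTestFunction fun p => (f n p : ℂ)) ∧
      (∀ n p, ‖f n p‖ ≤ (closure V).indicator (fun _ => 1) p) ∧
      ∀ p, Tendsto (fun n => f n p) atTop (𝓝 (V.indicator (fun _ => 1) p)) := by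
  obtain ⟨O, hO, rfl⟩ := isInducing_phaseEmbedding.isOpen_iff.mp hV
  obtain ⟨φ, hφs, hφ, hφr⟩ := hO.exists_contDiff_support_eq (n := ⊤)
  have hφ0 : ∀ q, 0 ≤ φ q := fun q => (hφr (Set.mem_range_self q)).1
  -- Where `φ > 0` the value is `1` as soon as `nφ ≥ 1`; elsewhere it is always `0`.
  set f : ℕ → Phase d → ℝ := fun n p => Real.smoothTransition (n * φ (phaseEmbedding p)) with hf
  have hsupp : ∀ n, ∀ p, f n p ≠ 0 → p ∈ phaseEmbedding ⁻¹' O := fun n p hp => by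
    rw [Set.mem_preimage, ← hφs, Function.mem_support]
    intro h
    apply hp
    simp [hf, h]
  refine ⟨f, fun n => ⟨?_, ?_⟩, fun n p => ?_, fun p => ?_⟩
  · have h1 : ContDiff ℝ ((⊤ : ℕ∞) : WithTop ℕ∞)
        fun p : E d × E d => (n : ℝ) * φ (phaseEmbedding (toTorus p.1, p.2)) :=
      contDiff_const.mul (hφ.comp contDiff_phaseEmbedding)
    exact Complex.ofRealCLM.contDiff.comp (Real.smoothTransition.contDiff.comp h1)
  · refine HasCompactSupport.intro' hVc isClosed_closure fun p hp => ?_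
    by_contra h
    exact hp (subset_closure (hsupp n p (by exact_mod_cast h)))
  · rw [Real.norm_of_nonneg (Real.smoothTransition.nonneg _)]
    by_cases hp : p ∈ closure (phaseEmbedding ⁻¹' O)
    · rw [Set.indicator_of_mem hp]
      exact Real.smoothTransition.le_one _
    · rw [Set.indicator_of_notMem hp]
      refine le_of_eq ?_
      by_contra h
      exact hp (subset_closure (hsupp n p h))
  · by_cases hp : p ∈ phaseEmbedding ⁻¹' O
    · rw [Set.indicator_of_mem hp]
      have hpos : 0 < φ (phaseEmbedding p) := by
        refine lt_of_le_of_ne (hφ0 _) (Ne.symm ?_)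
        rw [← Function.mem_support, hφs]
        exact hp
      have ht : Tendsto (fun n : ℕ => (n : ℝ) * φ (phaseEmbedding p)) atTop atTop :=
        tendsto_natCast_atTop_atTop.atTop_mul_const hpos
      refine tendsto_const_nhds.congr' ?_
      filter_upwards [ht.eventually_ge_atTop 1] with n hn
      exact (Real.smoothTransition.one_of_one_le hn).symm
    · rw [Set.indicator_of_notMem hp]
      refine tendsto_const_nhds.congr fun n => ?_
      by_contra h
      exact hp (hsupp n p (Ne.symm h))

lemma measure_eq_of_integral_eq {μ ν : Measure (Phase d)} [IsLocallyFiniteMeasure μ]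
    [IsLocallyFiniteMeasure ν]
    (h : ∀ a : Phase d → ℂ, IsTestFunction a → ∫ p, a p ∂μ = ∫ p, a p ∂ν) {V : Set (Phase d)}
    (hV : IsOpen V) (hVc : IsCompact (closure V)) : μ V = ν V := by
  obtain ⟨f, hf, hle, hlim⟩ := exists_testFunction_tendsto hV hVc
  have key : ∀ (μ : Measure (Phase d)) [IsLocallyFiniteMeasure μ],
      Tendsto (fun n => ∫ p, f n p ∂μ) atTop (𝓝 (μ.real V)) := fun μ _ => by
    rw [← integral_indicator_one hV.measurableSet]
    refine tendsto_integral_of_dominated_convergence ((closure V).indicator fun _ => 1) (fun n => ?_)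
      ?_ (fun n => Eventually.of_forall (hle n)) (Eventually.of_forall hlim)
    · have : Continuous (f n) := by
        have := Complex.continuous_re.comp (hf n).continuous
        exact this
      exact this.aestronglyMeasurable
    · exact (integrable_indicator_iff isClosed_closure.measurableSet).mpr
        (integrableOn_const hVc.measure_ne_top)
  have he : ∀ n, ∫ p, f n p ∂μ = ∫ p, f n p ∂ν := fun n => by
    have := h _ (hf n)
    rw [integral_complex_ofReal, integral_complex_ofReal] at this
    exact_mod_cast this
  have hr : μ.real V = ν.real V := by
    refine tendsto_nhds_unique (key μ) ?_
    simp only [he]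
    exact key ν
  have hfin : ∀ (μ : Measure (Phase d)) [IsLocallyFiniteMeasure μ], μ V ≠ ∞ := fun μ _ =>
    ne_top_of_le_ne_top hVc.measure_ne_top (measure_mono subset_closure)
  exact (ENNReal.toReal_eq_toReal_iff' (hfin μ) (hfin ν)).mp hr

/-- Locally finite measures on `T*𝕋ᵈ` are determined by the integrals of test functions. -/
lemma ext_of_integral_testFunction {μ ν : Measure (Phase d)} [IsLocallyFiniteMeasure μ]
    [IsLocallyFiniteMeasure ν]
    (h : ∀ a : Phase d → ℂ, IsTestFunction a → ∫ p, a p ∂μ = ∫ p, a p ∂ν) : μ = ν := by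
  -- Relatively compact open sets are stable under intersection with open sets, generate the Borel
  -- sets and have finite measure; a countable family of them covers the space.
  set C : Set (Set (Phase d)) := {V | IsOpen V ∧ IsCompact (closure V)} with hC
  set B : ℕ → Set (Phase d) := fun n => Prod.snd ⁻¹' Metric.ball (0 : E d) n with hB
  have hBC : ∀ n, B n ∈ C := fun n => by
    refine ⟨Metric.isOpen_ball.preimage continuous_snd, ?_⟩
    refine (isCompact_univ.prod (isCompact_closedBall (0 : E d) n)).of_isClosed_subset isClosed_closure ?_
    refine closure_minimal (fun p hp => ⟨trivial, Metric.ball_subset_closedBall hp⟩)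
      (isClosed_univ.prod Metric.isClosed_closedBall)
  have hU : ⋃ n, B n = Set.univ := by
    refine Set.eq_univ_of_forall fun p => ?_
    obtain ⟨n, hn⟩ := exists_nat_gt ‖p.2‖
    exact Set.mem_iUnion.mpr ⟨n, by simpa [hB] using hn⟩
  have hinter : ∀ V ∈ C, ∀ W, IsOpen W → V ∩ W ∈ C := fun V hV W hW =>
    ⟨hV.1.inter hW, hV.2.of_isClosed_subset isClosed_closure (closure_mono Set.inter_subset_left)⟩
  refine Measure.ext_of_generateFrom_of_iUnion C B ?_ (fun V hV W hW _ => hinter V hV W hW.1) hU hBC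
    (fun n => ?_) (fun V hV => measure_eq_of_integral_eq h hV.1 hV.2)
  · rw [BorelSpace.measurable_eq (α := Phase d)]
    refine le_antisymm ?_ (MeasurableSpace.generateFrom_le fun V hV =>
      MeasurableSpace.measurableSet_generateFrom hV.1)
    refine MeasurableSpace.generateFrom_le fun W hW => ?_
    have : W = ⋃ n, B n ∩ W := by rw [← Set.iUnion_inter, hU, Set.univ_inter]
    rw [this]
    exact MeasurableSet.iUnion fun n =>
      MeasurableSpace.measurableSet_generateFrom (hinter _ (hBC n) W hW)
  · exact ne_top_of_le_ne_top (hBC n).2.measure_ne_top (measure_mono subset_closure)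

instance (ξ : E d) : IsProbabilityMeasure (haarTorus ξ) := by
  unfold haarTorus
  infer_instance

lemma integral_haarTorus (ha : IsTestFunction a) (ξ : E d) :
    ∫ p, a p ∂(haarTorus ξ) = normConst d * coeffX a 0 ξ := by
  rw [haarTorus, Measure.prod_dirac, integral_map (by fun_prop)
    ha.continuous.aestronglyMeasurable, integral_normalizedLebesgue]
  rfl

lemma IsTestFunction.tendsto_coeffX (ha : IsTestFunction a) (k : Fin d → ℤ) :
    Tendsto (coeffX a k) (cocompact (E d)) (𝓝 0) := by
  have hK : IsCompact (Prod.snd '' tsupport a) := ha.2.isCompact.image continuous_snd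
  refine tendsto_const_nhds.congr' ?_
  filter_upwards [hK.compl_mem_cocompact] with ξ hξ
  have : ∀ x, a (x, ξ) = 0 := fun x => image_eq_zero_of_notMem_tsupport fun h => hξ ⟨_, h, rfl⟩
  simp [coeffX, coeff, this]

end Measures

/-! ### Lattice points -/

section Lattice

variable {d : ℕ}

lemma exists_lattice_approx {ħ : ℕ → ℝ} (hħ : ∀ n, 0 < ħ n) (hħ0 : Tendsto ħ atTop (𝓝 0))
    (ξ : ℕ → E d) : ∃ k : ℕ → Fin d → ℤ,
      Tendsto (fun n => ħ n • intVec (k n) - ξ n) atTop (𝓝 0) := by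
  -- Coordinatewise rounding at scale `ħ` makes an error of at most `ħ/2` in each coordinate.
  refine ⟨fun n i => round (ξ n i / ħ n), ?_⟩
  have h : Tendsto (fun n i => (ħ n • intVec (fun i => round (ξ n i / ħ n)) - ξ n : E d) i) atTop
      (𝓝 (0 : Fin d → ℝ)) := by
    rw [tendsto_pi_nhds]
    intro i
    refine squeeze_zero_norm (fun n => ?_) hħ0
    have h1 := abs_sub_round (ξ n i / ħ n)
    have h2 : (ħ n • intVec (fun i => round (ξ n i / ħ n)) - ξ n : E d) i =
        -(ħ n * (ξ n i / ħ n - round (ξ n i / ħ n))) := by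
      simp only [intVec, PiLp.sub_apply, PiLp.smul_apply, smul_eq_mul]
      rw [mul_sub, mul_div_cancel₀ _ (hħ n).ne']
      ring
    rw [h2, norm_neg, norm_mul, Real.norm_of_nonneg (hħ n).le, Real.norm_eq_abs]
    nlinarith [hħ n]
  exact ((EuclideanSpace.equiv (Fin d) ℝ).symm.continuous.tendsto 0).comp h

/-- A direction inside the hyperplane `ω·ξ = 1`, along which lattice points can escape to infinity;
here `d ≥ 2` is essential. -/
lemma exists_inner_eq_zero (hd : 2 ≤ d) {ω : E d} (hω : ∀ k, freq ω k = 0 → k = 0) :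
    ∃ v : E d, v ≠ 0 ∧ inner ℝ ω v = 0 := by
  let i₀ : Fin d := ⟨0, by omega⟩
  let i₁ : Fin d := ⟨1, by omega⟩
  have hi : i₁ ≠ i₀ := by simp [i₀, i₁]
  have h0 : ω i₀ ≠ 0 := fun h => by
    have : freq ω (Pi.single i₀ 1) = 0 := by
      have e : intVec (Pi.single i₀ 1 : Fin d → ℤ) = EuclideanSpace.single i₀ (1 : ℝ) := by
        ext i
        by_cases hi : i = i₀ <;> simp [intVec, hi]
      rw [freq_apply, e, EuclideanSpace.inner_single_right]
      simp [h]
    have := congrFun (hω _ this) i₀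
    simp at this
  refine ⟨ω i₁ • EuclideanSpace.single i₀ 1 - ω i₀ • EuclideanSpace.single i₁ 1, fun h => ?_, ?_⟩
  · have := congrArg (fun v : E d => v i₁) h
    simp [hi, h0] at this
  · rw [inner_sub_right, inner_smul_right, inner_smul_right, EuclideanSpace.inner_single_right,
      EuclideanSpace.inner_single_right]
    simp
    ring

lemma tendsto_one_div_nat : Tendsto (fun n : ℕ => 1 / ((n : ℝ) + 1)) atTop (𝓝 0) :=
  tendsto_one_div_add_atTop_nhds_zero_nat

lemma one_div_nat_mem (n : ℕ) : 1 / ((n : ℝ) + 1) ∈ Set.Ioc (0 : ℝ) 1 := by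
  refine ⟨by positivity, ?_⟩
  rw [div_le_one (by positivity)]
  linarith [(Nat.cast_nonneg n : (0 : ℝ) ≤ n)]

end Lattice

/-! ### Semiclassical measures and quantum limits -/

section Limits

variable {d : ℕ} {s : ℝ} [hs : Fact (0 < s)] {r : ℝ} {ω : E d} {A : ℝ → L2T d →ₗ.[ℂ] L2T d}
  {U : ∀ ħ : ℝ, CrossedProduct (shiftAction d s ħ)}

/-- If the points escape to infinity, they leave the support of every test function and the limit is
`0`. Otherwise a subsequence converges, necessarily to a point of the hyperplane, and this already
determines the limit. -/
lemma haarTorus_or_zero_of_tendsto {μ : Measure (Phase d)} [IsLocallyFiniteMeasure μ] {ξ : ℕ → E d}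
    (hξ : Tendsto (fun n => inner ℝ ω (ξ n)) atTop (𝓝 (1 : ℝ)))
    (h : ∀ a : Phase d → ℂ, IsTestFunction a →
      Tendsto (fun n => normConst d * coeffX a 0 (ξ n)) atTop (𝓝 (∫ p, a p ∂μ))) :
    (∃ ξ : E d, inner ℝ ω ξ = 1 ∧ μ = haarTorus ξ) ∨ μ = 0 := by
  by_cases hc : Tendsto ξ atTop (cocompact (E d))
  · right
    refine ext_of_integral_testFunction fun a ha => ?_
    rw [integral_zero_measure]
    refine tendsto_nhds_unique (h a ha) ?_
    have := ((ha.tendsto_coeffX 0).comp hc).const_mul (normConst d : ℂ)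
    rwa [mul_zero] at this
  · left
    rw [hasBasis_cocompact.tendsto_right_iff] at hc
    push Not at hc
    obtain ⟨K, hK, hKf⟩ := hc
    have hKf' : ∃ᶠ n in atTop, ξ n ∈ K := by
      simpa [Filter.not_eventually] using hKf
    obtain ⟨η, -, φ, hφ, hη⟩ := hK.tendsto_subseq' hKf'
    refine ⟨η, ?_, ?_⟩
    · have h1 : Tendsto (fun n => inner ℝ ω (ξ (φ n))) atTop (𝓝 (inner ℝ ω η)) :=
        tendsto_const_nhds.inner hη
      exact tendsto_nhds_unique h1 (hξ.comp hφ.tendsto_atTop)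
    · refine ext_of_integral_testFunction fun a ha => ?_
      rw [integral_haarTorus ha]
      refine tendsto_nhds_unique ((h a ha).comp hφ.tendsto_atTop) ?_
      exact (((ha.uniformContinuous_coeffX 0).continuous.tendsto η).comp hη).const_mul _

/-- The semiclassical measures of a family of diagonalized operators. -/
theorem semiclassicalMeasures_eq (hd : 2 ≤ d) (hω : ∀ k, freq ω k = 0 → k = 0)
    (h : ∀ ħ ∈ Set.Ioc (0 : ℝ) 1, IsDiagonalizedBy r ω (A ħ) (U ħ)) (hr : 0 < r) :
    semiclassicalMeasures A =
      {μ : Measure (Phase d) | ∃ ξ : E d, inner ℝ ω ξ = 1 ∧ μ = haarTorus ξ} ∪ {0} := by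
  ext μ
  constructor
  · rintro ⟨hμ, ħ, z, ψ, hψ, hW⟩
    obtain ⟨k, hk, hinner⟩ := exists_isConcentrating h hr hψ
    refine haarTorus_or_zero_of_tendsto hinner fun a ha => ?_
    have := (hW a ha).sub (hk.tendsto_wigner_sub ha hψ.2.1)
    simpa using this
  -- Any sequence on the hyperplane is approximated by points `ħ_n k_n`, and the eigenfunctions at
  -- those `k_n` have the same limit as the Haar measures there.
  · have key : ∀ (μ : Measure (Phase d)) [IsLocallyFiniteMeasure μ] (ξ : ℕ → E d),
        (∀ n, inner ℝ ω (ξ n) = 1) →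
        (∀ ξ' : ℕ → E d, Tendsto (fun n => ξ' n - ξ n) atTop (𝓝 0) → ∀ a : Phase d → ℂ,
          IsTestFunction a → Tendsto (fun n => normConst d * coeffX a 0 (ξ' n)) atTop
            (𝓝 (∫ p, a p ∂μ))) → μ ∈ semiclassicalMeasures A := by
      intro μ hμ ξ hξ hlim
      obtain ⟨k, hk⟩ := exists_lattice_approx (fun n => (one_div_nat_mem n).1) tendsto_one_div_nat ξ
      have hinner : Tendsto (fun n : ℕ => inner ℝ ω ((1 / ((n : ℝ) + 1)) • intVec (k n))) atTop
          (𝓝 (1 : ℝ)) := by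
        have h1 := ((tendsto_const_nhds (x := ω)).inner hk (𝕜 := ℝ)).add_const (1 : ℝ)
        rw [inner_zero_right, zero_add] at h1
        refine h1.congr fun n => ?_
        rw [inner_sub_right, hξ]
        ring
      obtain ⟨z, ψ, hψ, hconc⟩ := exists_isEigenSequence h hr one_div_nat_mem tendsto_one_div_nat hinner
      refine ⟨hμ, _, z, ψ, hψ, fun a ha => ?_⟩
      have := (hconc.tendsto_wigner_sub ha hψ.2.1).add (hlim _ hk a ha)
      simpa using this
    rintro (⟨ξ, hξ, rfl⟩ | h0)
    · refine key _ (fun _ => ξ) (fun _ => hξ) fun ξ' hξ' a ha => ?_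
      rw [integral_haarTorus ha]
      have h1 : Tendsto ξ' atTop (𝓝 ξ) := by simpa using hξ'.add_const ξ
      exact (((ha.uniformContinuous_coeffX 0).continuous.tendsto ξ).comp h1).const_mul _
    · rw [Set.mem_singleton_iff] at h0
      subst h0
      obtain ⟨v, hv0, hv⟩ := exists_inner_eq_zero hd hω
      have hω0 : inner ℝ ω ω ≠ 0 := fun h' => by
        rw [inner_self_eq_zero] at h'
        have : (fun _ : Fin d => (1 : ℤ)) = 0 := hω _ (by rw [freq_apply, h', inner_zero_left])
        have := congrFun this ⟨0, by omega⟩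
        simp at this
      -- Points of the hyperplane going to infinity along `v`: the mass escapes and the zero measure
      -- is reached.
      refine key _ (fun n : ℕ => (inner ℝ ω ω)⁻¹ • ω + (n : ℝ) • v) (fun n => ?_) fun ξ' hξ' a ha => ?_
      · rw [inner_add_right, inner_smul_right, inner_smul_right, hv, inv_mul_cancel₀ hω0]
        simp
      · rw [integral_zero_measure]
        have hc : Tendsto ξ' atTop (cocompact (E d)) := by
          rw [← Metric.cobounded_eq_cocompact, ← tendsto_norm_atTop_iff_cobounded]
          have h1 : Tendsto (fun n : ℕ => (n : ℝ) * ‖v‖ - (‖ξ' n - ((inner ℝ ω ω)⁻¹ • ω + (n : ℝ) • v)‖ +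
              ‖(inner ℝ ω ω)⁻¹ • ω‖)) atTop atTop := by
            refine (tendsto_natCast_atTop_atTop.atTop_mul_const (norm_pos_iff.mpr hv0)).atTop_add
              (C := -(0 + ‖(inner ℝ ω ω)⁻¹ • ω‖)) ?_
            have := (hξ'.norm.add_const ‖(inner ℝ ω ω)⁻¹ • ω‖).neg
            rwa [norm_zero] at this
          refine tendsto_atTop_mono (fun n => ?_) h1
          have h2 : (n : ℝ) * ‖v‖ = ‖(n : ℝ) • v‖ := by
            rw [norm_smul, Real.norm_of_nonneg (Nat.cast_nonneg n)]
          have h3 : (n : ℝ) • v = ξ' n - (ξ' n - ((inner ℝ ω ω)⁻¹ • ω + (n : ℝ) • v)) -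
              (inner ℝ ω ω)⁻¹ • ω := by abel
          have h4 : ‖(n : ℝ) • v‖ ≤ ‖ξ' n‖ + ‖ξ' n - ((inner ℝ ω ω)⁻¹ • ω + (n : ℝ) • v)‖ +
              ‖(inner ℝ ω ω)⁻¹ • ω‖ := by
            conv_lhs => rw [h3]
            exact (norm_sub_le _ _).trans (add_le_add (norm_sub_le _ _) le_rfl)
          rw [h2]
          linarith
        have := ((ha.tendsto_coeffX 0).comp hc).const_mul (normConst d : ℂ)
        rwa [mul_zero] at this

/-- The quantum limits of a family of diagonalized operators. -/
theorem quantumLimits_eq (hd : 2 ≤ d) (hω : ∀ k, freq ω k = 0 → k = 0)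
    (h : ∀ ħ ∈ Set.Ioc (0 : ℝ) 1, IsDiagonalizedBy r ω (A ħ) (U ħ)) (hr : 0 < r) :
    quantumLimits A = {normalizedLebesgue d} := by
  have hlim : ∀ {ψ : ℕ → L2T d} {k : ℕ → Fin d → ℤ}, IsConcentrating ψ k → (∀ n, ‖ψ n‖ = 1) →
      ∀ b : C(Torus d, ℝ), Tendsto (fun n => ∫ x, b x * ‖ψ n x‖ ^ 2) atTop
        (𝓝 (∫ x, b x ∂(normalizedLebesgue d))) := by
    intro ψ k hk hψ b
    have h1 := hk.tendsto_integral hψ ⟨fun x => (b x : ℂ), by fun_prop⟩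
    have h2 := (Complex.continuous_re.tendsto _).comp h1
    simp only [ContinuousMap.coe_mk, integral_complex_ofReal, Complex.ofReal_re] at h2
    refine h2.congr fun n => ?_
    rw [Function.comp_apply, ← Complex.ofReal_re (∫ x, b x * ‖ψ n x‖ ^ 2), ← integral_complex_ofReal]
    simp only [Complex.ofReal_mul]
  ext ν
  constructor
  · rintro ⟨hν, ħ, z, ψ, hψ, hW⟩
    obtain ⟨k, hk, -⟩ := exists_isConcentrating h hr hψ
    refine Set.mem_singleton_iff.mpr (ext_of_forall_integral_eq_of_IsFiniteMeasure fun f => ?_)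
    exact tendsto_nhds_unique (hW f.toContinuousMap)
      (hlim hk (fun n => (hψ.2.2.2 n).1) f.toContinuousMap)
  · intro hν
    rw [Set.mem_singleton_iff] at hν
    subst hν
    -- Used only to know that some admissible eigenfunction sequence exists; every such sequence has
    -- the same limiting density.
    have h0 : (0 : Measure (Phase d)) ∈ semiclassicalMeasures A := by
      rw [semiclassicalMeasures_eq hd hω h hr]
      exact Or.inr rfl
    obtain ⟨-, ħ, z, ψ, hψ, -⟩ := h0
    obtain ⟨k, hk, -⟩ := exists_isConcentrating h hr hψ
    exact ⟨inferInstance, ħ, z, ψ, hψ, hlim hk fun n => (hψ.2.2.2 n).1⟩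

end Limits

end

end SemiclassicalTorus

end

/-! ### The main theorem. -/

open SemiclassicalTorus in
theorem theorem2 (s ρ γ ς : ℝ) (hs : 0 < s) (hρ : 0 < ρ) (hς : 0 < ς) :
    ∃ ε : ℝ, 0 < ε ∧ ∃ C : ℝ, 0 < C ∧
      ∀ d : ℕ, 2 ≤ d → (d : ℝ) < γ →
      ∀ ω : E d, IsDiophantine ς γ ω →
      ∀ V : Phase d → ℝ, MemSymbol s ρ V →
        normSymbol s ρ (fun p => (V p : ℂ)) ≤ ENNReal.ofReal ε →
      ∃ R : ℝ → E d → ℝ,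
        (∀ ħ ∈ Set.Ioc (0 : ℝ) 1,
          MemA s (R ħ) ∧
          normA s (fun ξ => (R ħ ξ : ℂ)) ≤
            ENNReal.ofReal C * normSymbol s ρ (fun p => (V p : ℂ)) ∧
          pointSpectrum (Qhat ω V (R ħ) ħ) = pointSpectrum (Lhat ω ħ) ∧
          pointSpectrum (Lhat ω ħ) =
            Set.range (fun k : Fin d → ℤ => ((ħ * inner ℝ ω (intVec k) : ℝ) : ℂ))) ∧
        semiclassicalMeasures (fun ħ => Qhat ω V (R ħ) ħ) =
          semiclassicalMeasures (fun ħ => Lhat ω ħ) ∧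
        semiclassicalMeasures (fun ħ => Lhat ω ħ) =
          {μ : MeasureTheory.Measure (Phase d) |
            ∃ ξ : E d, inner ℝ ω ξ = 1 ∧ μ = haarTorus ξ} ∪ {0} ∧
        quantumLimits (fun ħ => Qhat ω V (R ħ) ħ) = {normalizedLebesgue d} := by
  -- `ε` and `C` are chosen before `d`. If `γ ≤ 1` no dimension `d ≥ 2` satisfies `d < γ`, and any
  -- constants will do; otherwise the exponent `γ - 1` is positive, as the scheme requires.
  by_cases hγ : 1 < γ
  swap
  · refine ⟨1, one_pos, 1, one_pos, fun d hd hdγ => ?_⟩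
    have : (2 : ℝ) ≤ d := by exact_mod_cast hd
    linarith
  refine ⟨CrossedProduct.kamThreshold ρ (γ - 1) ς,
    CrossedProduct.kamThreshold_pos hρ (by linarith) hς, 2, two_pos, ?_⟩
  intro d hd hdγ ω hω V hV hVn
  have : Fact (0 < s) := ⟨hs⟩
  have : NeZero d := ⟨by omega⟩
  have hfreq := freq_ne_zero hς hω
  choose W U U' R hconj hU hR hRn hQ using exists_isConjugation hρ hγ hς hω hV hVn
  have hdQ : ∀ ħ ∈ Set.Ioc (0 : ℝ) 1,
      IsDiagonalizedBy (ρ / 2) ω (Qhat ω V (fun ξ => (R ħ ξ).re) ħ) (U ħ) := fun ħ hħ => by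
    rw [hQ]
    exact (hconj ħ).isDiagonalizedBy hħ.1.ne' hfreq (hU ħ)
  have hdL : ∀ ħ ∈ Set.Ioc (0 : ℝ) 1,
      IsDiagonalizedBy (ρ / 2) ω (Lhat ω ħ) (1 : CrossedProduct (shiftAction d s ħ)) := fun ħ hħ =>
    isDiagonalizedBy_Lhat hħ.1.ne' hfreq
  have hρ2 : 0 < ρ / 2 := by linarith
  refine ⟨fun ħ ξ => (R ħ ξ).re, fun ħ hħ => ⟨hR ħ, hRn ħ, ?_, pointSpectrum_Lhat ω ħ⟩, ?_,
    semiclassicalMeasures_eq hd hfreq hdL hρ2, quantumLimits_eq hd hfreq hdQ hρ2⟩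
  · rw [hQ]
    exact (hconj ħ).pointSpectrum_eq hħ.1.ne' hfreq
  · rw [semiclassicalMeasures_eq hd hfreq hdQ hρ2, semiclassicalMeasures_eq hd hfreq hdL hρ2]
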